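/- Let $N\ge 1$, $\mathbb T^N=\mathbb R^N/\mathbb Z^N$, $T>0$ and $\gamma>1$. Consider the compressible Navier–Stokes system with degenerate viscosity $$\rho_t+\operatorname{div}(\rho u)=0,\qquad (\rho u)_t+\operatorname{div}(\rho u\otimes u)+\nabla\rho^\gamma-\operatorname{div}(\rho\,\mathbb D u)=0\quad\text{on }(0,T)\times\mathbb T^N,$$ $$\rho|_{t=0}=\rho_0,\qquad (\rho u)|_{t=0}=\rho_0u_0,\qquad \mathbb D u=\tfrac12(\nabla u+\nabla^{\mathsf T}u).$$ A pair $(\rho,u)$ is a weak solution if the two equations hold in $\mathcal D'((0,T)\times\mathbb T^N)$, the initial conditions hold in $\mathcal D'(\mathbb T^N)$ (that is, $\rho_0,\rho_0u_0\in L^1(\mathbb T^N)$ and, for every $\varphi\in C^\infty(\mathbb T^N)$, $\int\rho(t)\varphi\,dx\to\int\rho_0\varphi\,dx$ and $\int(\rho u)(t)\varphi\,dx\to\int\rho_0u_0\varphi\,dx$ as $t\to0^+$ outside a null set of times), and $$\rho\ge0,\quad \rho\in L^\infty(0,T;L^\gamma),\quad \nabla\rho^{\gamma/2}\in L^2(0,T;L^2),\quad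 \nabla\sqrt\rho\in L^\infty(0,T;L^2),$$ $$\sqrt\rho\,u\in L^\infty(0,T;L^2),\quad \sqrt\rho\,\nabla u\in L^2(0,T;L^2),$$ the gradients being taken in the sense of distributions. Theorem. Let $(\rho,u)$ be a weak solution such that 1. $0<\underline\rho\le\rho(t,x)\le\bar\rho<\infty$ for almost every $(t,x)\in(0,T)\times\mathbb T^N$, with constants $\underline\rho,\bar\rho$; 2. $u\in L^p(0,T;L^q(\mathbb T^N))$ for some $p,q\in[1,\infty]$ with $\frac1p+\frac1q\le\frac5{12}$ and $q\ge6$; 3. $\sqrt{\rho_0}\,u_0\in L^4(\mathbb T^N)$. Then, after modification of $(\rho,u)$ on a null set, $\rho$ and $\rho u$ are weakly continuous from $[0,T]$ to $L^2(\mathbb T^N)$, and for every such version and every $t\in[0,T]$ $$\int_{\mathbb T^N}\Big(\tfrac12\rho|u|^2+\tfrac{\rho^\gamma}{\gamma-1}\Big)(t,x)\,dx+\int_0^t\!\!\int_{\mathbb T^N}\rho|\mathbb D u|^2\,dx\,ds=\int_{\mathbb T^N}\Big(\tfrac12\rho_0|u_0|^2+\tfrac{\rho_0^\gamma}{\gamma-1}\Big)dx,$$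 all the integrals being finite. -/

import Mathlib

open MeasureTheory Filter Topology Set
open scoped ENNReal ContDiff

namespace DegenerateNS

noncomputable section

/-- The flat torus `ℝ^N / ℤ^N`; its measure `volume` is the product of the Lebesgue measures of
the circles, of total mass one. -/
abbrev Torus (N : ℕ) : Type := UnitAddTorus (Fin N)

/-- Values of vector fields, with the Euclidean norm. -/
abbrev Vec (N : ℕ) : Type := EuclideanSpace ℝ (Fin N)

variable {N : ℕ}

/-- The covering map `ℝ^N → ℝ^N / ℤ^N`. -/
def cover (y : Fin N → ℝ) : Torus N := fun i => (y i : UnitAddCircle)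

/-- Partial derivative in the `i`-th direction of a function on the torus. -/
def partialX (i : Fin N) (f : Torus N → ℝ) (x : Torus N) : ℝ :=
  deriv (fun s : ℝ => f (x + Pi.single i (s : UnitAddCircle))) 0

/-- Partial derivative in time of a function of time and space. -/
def partialT (f : ℝ → Torus N → ℝ) (t : ℝ) (x : Torus N) : ℝ :=
  deriv (fun s : ℝ => f s x) t

/-- Smooth functions on the torus, the test functions of `𝒟'(𝕋^N)`. -/
def IsSmooth (φ : Torus N → ℝ) : Prop :=
  ContDiff ℝ ∞ (fun y : Fin N → ℝ => φ (cover y))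

/-- Smooth functions with compact support in `(0,T) × 𝕋^N`, the test functions of
`𝒟'((0,T) × 𝕋^N)`. -/
structure IsTestFunction (T : ℝ) (φ : ℝ → Torus N → ℝ) : Prop where
  smooth : ContDiff ℝ ∞ (fun z : ℝ × (Fin N → ℝ) => φ z.1 (cover z.2))
  support : ∃ a b : ℝ, 0 < a ∧ b < T ∧ ∀ t, t ∉ Icc a b → ∀ x, φ t x = 0

/-- The measure `dt dx` on `(0,T) × 𝕋^N`. -/
def spaceTime (N : ℕ) (T : ℝ) : Measure (ℝ × Torus N) :=
  (volume.restrict (Ioo 0 T)).prod volume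

/-- The space `L^p(0,T; L^q(𝕋^N))`. -/
def MemLpLq {E : Type*} [NormedAddCommGroup E] (T : ℝ) (p q : ℝ≥0∞) (f : ℝ → Torus N → E) :
    Prop :=
  AEStronglyMeasurable (Function.uncurry f) (spaceTime N T) ∧
    eLpNorm (fun t => eLpNorm (f t) q volume) p (volume.restrict (Ioo 0 T)) < ⊤

/-- `g` is the spatial gradient of `f` in `𝒟'((0,T) × 𝕋^N)`. -/
structure HasWeakGradient (T : ℝ) (f : ℝ → Torus N → ℝ) (g : ℝ → Torus N → Vec N) : Prop where
  locInt : LocallyIntegrableOn (Function.uncurry f) (Ioo 0 T ×ˢ univ) volume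
  locInt_grad : LocallyIntegrableOn (Function.uncurry g) (Ioo 0 T ×ˢ univ) volume
  eq : ∀ φ : ℝ → Torus N → ℝ, IsTestFunction T φ → ∀ i : Fin N,
    ∫ z, f z.1 z.2 * partialX i (φ z.1) z.2 ∂(spaceTime N T)
      = - ∫ z, g z.1 z.2 i * φ z.1 z.2 ∂(spaceTime N T)

/-- The entry `(i, j)` of the strain tensor `𝔻u = (∇u + ∇ᵀu) / 2`, where `Du i` is the gradient
of the `i`-th component of `u`. -/
def strain (Du : Fin N → ℝ → Torus N → Vec N) (t : ℝ) (x : Torus N) (i j : Fin N) : ℝ :=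
  (Du i t x j + Du j t x i) / 2

/-- `|𝔻u|²`. -/
def strainSq (Du : Fin N → ℝ → Torus N → Vec N) (t : ℝ) (x : Torus N) : ℝ :=
  ∑ i, ∑ j, strain Du t x i j ^ 2

/-- `(ρ, u)` is a weak solution on `(0,T) × 𝕋^N` of
`∂ₜρ + div(ρu) = 0`, `∂ₜ(ρu) + div(ρu ⊗ u) + ∇ρ^γ - div(ρ𝔻u) = 0`,
`ρ(0) = ρ₀`, `(ρu)(0) = ρ₀u₀`; here `Du i` is the weak gradient of the component `u i`. -/
structure IsWeakSolution (T γ : ℝ) (ρ : ℝ → Torus N → ℝ) (u : ℝ → Torus N → Vec N)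
    (Du : Fin N → ℝ → Torus N → Vec N) (ρ₀ : Torus N → ℝ) (u₀ : Torus N → Vec N) : Prop where
  nonneg : ∀ᵐ z ∂(spaceTime N T), 0 ≤ ρ z.1 z.2
  rho_mem : MemLpLq T ⊤ (ENNReal.ofReal γ) ρ
  grad_rho_pow : ∃ g : ℝ → Torus N → Vec N,
    HasWeakGradient T (fun t x => ρ t x ^ (γ / 2)) g ∧ MemLpLq T 2 2 g
  grad_sqrt_rho : ∃ g : ℝ → Torus N → Vec N,
    HasWeakGradient T (fun t x => √(ρ t x)) g ∧ MemLpLq T ⊤ 2 g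
  sqrt_rho_u : MemLpLq T ⊤ 2 (fun t x => √(ρ t x) • u t x)
  grad_u : ∀ i, HasWeakGradient T (fun t x => u t x i) (Du i)
  sqrt_rho_grad_u : ∀ i, MemLpLq T 2 2 (fun t x => √(ρ t x) • Du i t x)
  /-- Conservation of mass in `𝒟'((0,T) × 𝕋^N)`. -/
  continuity : ∀ φ : ℝ → Torus N → ℝ, IsTestFunction T φ →
    ∫ z, (ρ z.1 z.2 * partialT φ z.1 z.2
        + ∑ j, ρ z.1 z.2 * u z.1 z.2 j * partialX j (φ z.1) z.2) ∂(spaceTime N T) = 0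
  /-- The `i`-th component of the momentum equation in `𝒟'((0,T) × 𝕋^N)`. -/
  momentum : ∀ φ : ℝ → Torus N → ℝ, IsTestFunction T φ → ∀ i : Fin N,
    ∫ z, (ρ z.1 z.2 * u z.1 z.2 i * partialT φ z.1 z.2
        + ∑ j, ρ z.1 z.2 * u z.1 z.2 i * u z.1 z.2 j * partialX j (φ z.1) z.2
        + ρ z.1 z.2 ^ γ * partialX i (φ z.1) z.2
        - ∑ j, ρ z.1 z.2 * strain Du z.1 z.2 i j * partialX j (φ z.1) z.2)
      ∂(spaceTime N T) = 0
  integrable_rho₀ : Integrable ρ₀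
  integrable_m₀ : Integrable (fun x => ρ₀ x • u₀ x)
  /-- `ρ(t) → ρ₀` in `𝒟'(𝕋^N)` as `t → 0⁺`, up to a null set of times. -/
  initial_rho : ∀ φ : Torus N → ℝ, IsSmooth φ →
    Tendsto (fun t => ∫ x, ρ t x * φ x) (𝓝[>] 0 ⊓ ae volume) (𝓝 (∫ x, ρ₀ x * φ x))
  /-- `(ρu)(t) → ρ₀u₀` in `𝒟'(𝕋^N)` as `t → 0⁺`, up to a null set of times. -/
  initial_m : ∀ φ : Torus N → ℝ, IsSmooth φ → ∀ i : Fin N,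
    Tendsto (fun t => ∫ x, ρ t x * u t x i * φ x) (𝓝[>] 0 ⊓ ae volume)
      (𝓝 (∫ x, ρ₀ x * u₀ x i * φ x))

/-- `(r, v)` is a version of `(ρ, u)`, equal to it almost everywhere on `(0,T) × 𝕋^N`, for which
the density `r` and the momentum `r v` are weakly continuous from `[0,T]` to `L²(𝕋^N)`.
This fixes `r t` and `r t • v t` almost everywhere on `𝕋^N` for every `t ∈ [0,T]`. -/
structure IsWeaklyContinuousVersion (T : ℝ) (ρ : ℝ → Torus N → ℝ) (u : ℝ → Torus N → Vec N)
    (r : ℝ → Torus N → ℝ) (v : ℝ → Torus N → Vec N) : Prop where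
  ae_eq : ∀ᵐ z ∂(spaceTime N T), r z.1 z.2 = ρ z.1 z.2 ∧ v z.1 z.2 = u z.1 z.2
  memLp_rho : ∀ t ∈ Icc 0 T, MemLp (r t) 2 volume
  memLp_m : ∀ t ∈ Icc 0 T, MemLp (fun x => r t x • v t x) 2 volume
  continuous_rho : ∀ ψ : Torus N → ℝ, MemLp ψ 2 volume →
    ContinuousOn (fun t => ∫ x, r t x * ψ x) (Icc 0 T)
  continuous_m : ∀ ψ : Torus N → ℝ, MemLp ψ 2 volume → ∀ i : Fin N,
    ContinuousOn (fun t => ∫ x, r t x * v t x i * ψ x) (Icc 0 T)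

/-- The energy density `ρ|u|²/2 + ρ^γ/(γ-1)` of a density `r` and a velocity `v`. -/
def energyDensity (γ : ℝ) (r : Torus N → ℝ) (v : Torus N → Vec N) (x : Torus N) : ℝ :=
  1 / 2 * r x * ‖v x‖ ^ 2 + r x ^ γ / (γ - 1)

end

end DegenerateNS

open DegenerateNS

/-! Formally the energy law is the momentum equation tested with `u`. Two things are missing:
integrability of the convective product `ρ u ⊗ u : ∇u`, and enough regularity in time to
differentiate the energy. The proof settles the first by interpolation and avoids the second by
working with finite increments in time.

Integrability. Since the density is bounded below, `u` lies in `L^∞(L²)` and `∇u` in `L²`.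
Interpolating with `L^p(L^q)` puts `u` in `L⁴` of space-time (`MemLpLq.memLp_four`). Hence the mass
flux is in `L⁴`, the whole momentum flux is in `L²`, and every product in the formal computation is
integrable.

Increments. Between two times the increments of `ρ` and of `m = ρu` are minus the divergences of the
time-integrated fluxes (`wDiv_timeInt`), and can be tested with functions having square integrable
gradients. The identity `ρ_s u_s² - ρ_t u_t² = (m_s - m_t)(u_s + u_t) - (ρ_s - ρ_t) u_s u_t` writes
the kinetic increment through increments of `m` and `ρ` only (`kinetic_increment`), while convexity
of `x ↦ x^γ` encloses the potential increment between its tangents at the two times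
(`pow_increment`). Divided by the time step, integrated fluxes become Steklov averages and the
remaining factors are values or translates. The lower and the upper bound for the difference
quotient of the energy converge in `L¹` to the same limit, and its integral in space is minus the
dissipation (`integral_limitRate`).

Endpoints. Integrating the increments over time leaves averages of the energy over short windows at
`0` and at `t`, and these have to converge to the energy of the weakly continuous version at exactly
those times. The density is strongly continuous in `L²`, because its gradient is bounded in `L²`
uniformly in time; so `u(s)` converges weakly to `m(t)/r(t)`. For the kinetic energy this is
completed by the bound `C √|s-t| ‖∇u(s)‖` on the integral of `(m(s) - m(t)) u(s)`: its average over
a window shrinking to `t` vanishes, because the integral of `‖∇u‖²` over the window does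
(`tendsto_average_kinetic`). Thus equality holds at every time, and at time zero the version is
identified with the data. -/

namespace DegenerateNS

noncomputable section

/-! ### Convergence in `L^p` -/

section TendstoLp

variable {α ι : Type*} [MeasurableSpace α] {μ : Measure α} {l : Filter ι}

/-- Convergence in `L^p` of real functions that belong to `L^p`. -/
structure TendstoLp (μ : Measure α) (p : ℝ≥0∞) (l : Filter ι) (F : ι → α → ℝ) (f : α → ℝ) :
    Prop where
  memLp : ∀ i, MemLp (F i) p μ
  memLp_lim : MemLp f p μ
  tendsto : Tendsto (fun i => eLpNorm (F i - f) p μ) l (𝓝 0)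

theorem tendsto_zero_of_le_add {a b c : ι → ℝ≥0∞} (h : ∀ i, a i ≤ b i + c i)
    (hb : Tendsto b l (𝓝 0)) (hc : Tendsto c l (𝓝 0)) : Tendsto a l (𝓝 0) := by
  have h0 : Tendsto (fun i => b i + c i) l (𝓝 0) := by simpa using hb.add hc
  exact tendsto_of_tendsto_of_tendsto_of_le_of_le tendsto_const_nhds h0 (fun _ => zero_le) h

theorem TendstoLp.const {p : ℝ≥0∞} {f : α → ℝ} (hf : MemLp f p μ) :
    TendstoLp μ p l (fun _ => f) f :=
  ⟨fun _ => hf, hf, by simpa using tendsto_const_nhds⟩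

theorem TendstoLp.add {p : ℝ≥0∞} [Fact (1 ≤ p)] {F G : ι → α → ℝ} {f g : α → ℝ}
    (hF : TendstoLp μ p l F f) (hG : TendstoLp μ p l G g) :
    TendstoLp μ p l (fun i => F i + G i) (f + g) := by
  refine ⟨fun i => (hF.memLp i).add (hG.memLp i), hF.memLp_lim.add hG.memLp_lim, ?_⟩
  refine tendsto_zero_of_le_add (fun i => ?_) hF.tendsto hG.tendsto
  have : F i + G i - (f + g) = (F i - f) + (G i - g) := by ring
  rw [this]
  exact eLpNorm_add_le ((hF.memLp i).sub hF.memLp_lim).1 ((hG.memLp i).sub hG.memLp_lim).1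
    Fact.out

theorem TendstoLp.const_mul {p : ℝ≥0∞} {F : ι → α → ℝ} {f : α → ℝ}
    (hF : TendstoLp μ p l F f) (c : ℝ) :
    TendstoLp μ p l (fun i x => c * F i x) (fun x => c * f x) := by
  refine ⟨fun i => (hF.memLp i).const_mul c, hF.memLp_lim.const_mul c, ?_⟩
  have h : ∀ i, eLpNorm ((fun x => c * F i x) - fun x => c * f x) p μ
      = ‖c‖ₑ * eLpNorm (F i - f) p μ := by
    intro i
    rw [← eLpNorm_const_smul]
    congr 1
    ext x
    simp [mul_sub]
  simp_rw [h]
  simpa using ENNReal.Tendsto.const_mul hF.tendsto (Or.inr enorm_ne_top)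

theorem TendstoLp.sub {p : ℝ≥0∞} [Fact (1 ≤ p)] {F G : ι → α → ℝ} {f g : α → ℝ}
    (hF : TendstoLp μ p l F f) (hG : TendstoLp μ p l G g) :
    TendstoLp μ p l (fun i => F i - G i) (f - g) := by
  have := hF.add (hG.const_mul (-1))
  convert! this using 1
  · ext i x; simp [sub_eq_add_neg]
  · ext x; simp [sub_eq_add_neg]

theorem TendstoLp.sum {p : ℝ≥0∞} [Fact (1 ≤ p)] {κ : Type*} (s : Finset κ)
    {F : κ → ι → α → ℝ} {f : κ → α → ℝ} (h : ∀ k ∈ s, TendstoLp μ p l (F k) (f k)) :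
    TendstoLp μ p l (fun i x => ∑ k ∈ s, F k i x) (fun x => ∑ k ∈ s, f k x) := by
  classical
  induction s using Finset.induction_on with
  | empty =>
    simp only [Finset.sum_empty]
    exact TendstoLp.const MemLp.zero'
  | insert a s ha ih =>
    have h1 := (h a (Finset.mem_insert_self a s)).add
      (ih fun k hk => h k (Finset.mem_insert_of_mem hk))
    simp_rw [Finset.sum_insert ha]
    exact h1

theorem eLpNorm_mul_le {p q r : ℝ≥0∞} [ENNReal.HolderTriple p q r] {f g : α → ℝ}
    (hf : AEStronglyMeasurable f μ) (hg : AEStronglyMeasurable g μ) :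
    eLpNorm (fun x => f x * g x) r μ ≤ eLpNorm f p μ * eLpNorm g q μ := by
  have h := eLpNorm_smul_le_mul_eLpNorm (p := p) (q := q) (r := r) hg hf
  exact h

/-- Hölder's inequality applied to `FG - fg = (F - f)G + f(G - g)`; the norms of `G` stay bounded
along the filter because `G - g` tends to zero. Together with sums, this lets every multilinear
expression below pass to the limit factor by factor. -/
theorem TendstoLp.mul {p q r : ℝ≥0∞} [ENNReal.HolderTriple p q r] [Fact (1 ≤ r)]
    {F G : ι → α → ℝ} {f g : α → ℝ}
    (hF : TendstoLp μ p l F f) (hG : TendstoLp μ q l G g) [Fact (1 ≤ q)] :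
    TendstoLp μ r l (fun i x => F i x * G i x) (fun x => f x * g x) := by
  have hG0 : MemLp g q μ := hG.memLp_lim
  refine ⟨fun i => (hG.memLp i).mul (p := p) (hF.memLp i), hG0.mul (p := p) hF.memLp_lim, ?_⟩
  have hle : ∀ i, eLpNorm ((fun x => F i x * G i x) - fun x => f x * g x) r μ
      ≤ eLpNorm (F i - f) p μ * (eLpNorm (G i - g) q μ + eLpNorm g q μ)
        + eLpNorm f p μ * eLpNorm (G i - g) q μ := by
    intro i
    have e : ((fun x => F i x * G i x) - fun x => f x * g x)
        = (fun x => (F i - f) x * G i x) + fun x => f x * (G i - g) x := by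
      ext x; simp; ring
    rw [e]
    have m1 := ((hF.memLp i).sub hF.memLp_lim)
    have m2 := ((hG.memLp i).sub hG0)
    refine (eLpNorm_add_le (m1.1.mul (hG.memLp i).1) (hF.memLp_lim.1.mul m2.1) Fact.out).trans ?_
    refine add_le_add ((eLpNorm_mul_le (p := p) (q := q) m1.1 (hG.memLp i).1).trans ?_)
      (eLpNorm_mul_le (p := p) (q := q) hF.memLp_lim.1 m2.1)
    gcongr
    have : G i = (G i - g) + g := by simp
    conv_lhs => rw [this]
    exact eLpNorm_add_le m2.1 hG0.1 Fact.out
  refine tendsto_zero_of_le_add hle ?_ ?_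
  · have h1 : Tendsto (fun i => eLpNorm (G i - g) q μ + eLpNorm g q μ) l
        (𝓝 (0 + eLpNorm g q μ)) := hG.tendsto.add tendsto_const_nhds
    have := ENNReal.Tendsto.mul hF.tendsto (Or.inr (by simpa using hG0.2.ne)) h1
      (Or.inr ENNReal.zero_ne_top)
    simpa using this
  · simpa using ENNReal.Tendsto.const_mul hG.tendsto (Or.inr hF.memLp_lim.2.ne)

theorem TendstoLp.integral {F : ι → α → ℝ} {f : α → ℝ} (hF : TendstoLp μ 1 l F f) :
    Tendsto (fun i => ∫ x, F i x ∂μ) l (𝓝 (∫ x, f x ∂μ)) := by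
  refine tendsto_integral_of_L1 f hF.memLp_lim.1
    (Eventually.of_forall fun i => memLp_one_iff_integrable.1 (hF.memLp i)) ?_
  simpa [eLpNorm_one_eq_lintegral_enorm] using hF.tendsto

instance holderTriple_four_four_two : ENNReal.HolderTriple 4 4 2 := by
  constructor
  have h : (4 : ℝ≥0∞) = 2 * 2 := by norm_num
  rw [h, ENNReal.mul_inv (by simp) (by simp), ← mul_add, ENNReal.inv_two_add_inv_two, mul_one]

instance : Fact ((1 : ℝ≥0∞) ≤ 4) := ⟨by norm_num⟩

end TendstoLp

/-! ### Averages of translates -/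

section Average

theorem eLpNorm_rpow_toReal {X : Type*} [MeasurableSpace X] {m : Measure X} {p : ℝ≥0∞}
    (hp0 : p ≠ 0) (hp' : p ≠ ⊤) {g : X → ℝ} :
    eLpNorm g p m ^ p.toReal = ∫⁻ z, ‖g z‖ₑ ^ p.toReal ∂m := by
  rw [eLpNorm_eq_lintegral_rpow_enorm_toReal hp0 hp', ← ENNReal.rpow_mul,
    one_div_mul_cancel (ENNReal.toReal_pos hp0 hp').ne', ENNReal.rpow_one]

/-- Jensen's inequality for the average in one variable of a function of two variables. -/
theorem eLpNorm_integral_le {X Y : Type*} [MeasurableSpace X] [MeasurableSpace Y]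
    {μ : Measure X} {ν : Measure Y} [SFinite μ] [IsProbabilityMeasure ν] {p : ℝ≥0∞}
    (hp : 1 ≤ p) (hp' : p ≠ ⊤) {f : X → Y → ℝ}
    (hf : AEStronglyMeasurable (Function.uncurry f) (μ.prod ν)) :
    eLpNorm (fun x => ∫ y, f x y ∂ν) p μ ^ p.toReal
      ≤ ∫⁻ y, eLpNorm (fun x => f x y) p μ ^ p.toReal ∂ν := by
  have hp0 : p ≠ 0 := (one_pos.trans_le hp).ne'
  simp_rw [eLpNorm_rpow_toReal hp0 hp']
  rw [← lintegral_lintegral_swap (f := fun x y => ‖f x y‖ₑ ^ p.toReal)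
    (hf.enorm.pow_const _)]
  refine lintegral_mono_ae ?_
  filter_upwards [hf.prodMk_left] with x hx
  have h1 : ‖∫ y, f x y ∂ν‖ₑ ≤ eLpNorm (f x) p ν := by
    refine (enorm_integral_le_lintegral_enorm _).trans ?_
    rw [← eLpNorm_one_eq_lintegral_enorm]
    exact eLpNorm_le_eLpNorm_of_exponent_le hp hx
  calc _ ≤ eLpNorm (f x) p ν ^ p.toReal := by gcongr
    _ = _ := eLpNorm_rpow_toReal hp0 hp'

variable {G : Type*} [AddCommGroup G] [TopologicalSpace G] [IsTopologicalAddGroup G]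
  [SecondCountableTopology G] [MeasurableSpace G] [BorelSpace G] {μ : Measure G} [SFinite μ]
  [μ.IsAddRightInvariant]

/-- The average of the translates of `f` with weight `P`. -/
def avg (P : Measure G) (f : G → ℝ) (x : G) : ℝ := ∫ y, f (x + y) ∂P

/-- For each fixed `y` the section of the preimage of a null set is a translate of that null set.
Only s-finiteness of `P` is used, so Dirac masses and measures carried by a line are allowed, as
time shifts and Steklov averages require. -/
theorem quasiMeasurePreserving_add (P : Measure G) [SFinite P] :
    Measure.QuasiMeasurePreserving (fun z : G × G => z.1 + z.2) (μ.prod P) μ := by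
  refine ⟨measurable_add, Measure.AbsolutelyContinuous.mk fun s hs h0 => ?_⟩
  rw [Measure.map_apply measurable_add hs, Measure.prod_apply_symm (measurable_add hs)]
  refine (lintegral_congr fun y => ?_).trans lintegral_zero
  simpa [preimage_preimage] using h0

theorem aestronglyMeasurable_translates {P : Measure G} [SFinite P] {f : G → ℝ}
    (hf : AEStronglyMeasurable f μ) :
    AEStronglyMeasurable (Function.uncurry fun x y => f (x + y)) (μ.prod P) :=
  hf.comp_quasiMeasurePreserving (quasiMeasurePreserving_add P)

theorem eLpNorm_translate {p : ℝ≥0∞} {f : G → ℝ} (hf : AEStronglyMeasurable f μ) (y : G) :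
    eLpNorm (fun x => f (x + y)) p μ = eLpNorm f p μ :=
  eLpNorm_comp_measurePreserving hf (measurePreserving_add_right μ y)

theorem memLp_avg {p : ℝ≥0∞} (hp : 1 ≤ p) (hp' : p ≠ ⊤) {P : Measure G}
    [IsProbabilityMeasure P] {f : G → ℝ} (hf : MemLp f p μ) : MemLp (avg P f) p μ := by
  have hr : 0 < p.toReal := ENNReal.toReal_pos (one_pos.trans_le hp).ne' hp'
  have hm := aestronglyMeasurable_translates (P := P) hf.1
  refine ⟨hm.integral_prod_right', ?_⟩
  have h := eLpNorm_integral_le hp hp' hm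
  simp_rw [eLpNorm_translate hf.1] at h
  rw [lintegral_const, measure_univ, mul_one] at h
  exact ((ENNReal.rpow_le_rpow_iff hr).1 h).trans_lt hf.2

variable [LocallyCompactSpace G] [IsLocallyFiniteMeasure μ] [μ.InnerRegularCompactLTTop]

/-- Continuity of translations in `L^p`. -/
theorem tendsto_eLpNorm_translate_sub {p : ℝ≥0∞} (hp : 1 ≤ p) (hp' : p ≠ ⊤) {f : G → ℝ}
    (hf : MemLp f p μ) :
    Tendsto (fun y => eLpNorm ((fun x => f (x + y)) - f) p μ) (𝓝 0) (𝓝 0) := by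
  have : Fact (1 ≤ p) := ⟨hp⟩
  -- Translations form a family of measure preserving maps that is continuous for the compact-open
  -- topology, and composition in `L^p` with finite `p` is continuous along such a family.
  let g : C(G, C(G, G)) :=
    (ContinuousMap.mk (fun z : G × G => z.2 + z.1) (continuous_snd.add continuous_fst)).curry
  have hg : ∀ y, MeasurePreserving (g y) μ μ := fun y => measurePreserving_add_right μ y
  have h1 := Filter.Tendsto.compMeasurePreservingLp (l := 𝓝 (0 : G)) (p := p)
    (f := fun _ => hf.toLp f) (f₀ := hf.toLp f) (g := g) (g₀ := g 0) tendsto_const_nhds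
    (g.continuous.tendsto 0) hg (hg 0) hp'
  rw [tendsto_iff_edist_tendsto_0] at h1
  refine h1.congr fun y => ?_
  rw [Lp.toLp_compMeasurePreserving hf (hg y), Lp.toLp_compMeasurePreserving hf (hg 0),
    Lp.edist_toLp_toLp]
  congr 1
  ext x
  simp [g]

/-- Averages of translates converge in `L^p` if the translations tend to zero. -/
theorem tendstoLp_avg {ι : Type*} {l : Filter ι} {p : ℝ≥0∞} (hp : 1 ≤ p) (hp' : p ≠ ⊤)
    {P : ι → Measure G}
    [∀ i, IsProbabilityMeasure (P i)] (hP : ∀ U ∈ 𝓝 (0 : G), ∀ᶠ i in l, ∀ᵐ y ∂(P i), y ∈ U)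
    {f : G → ℝ} (hf : MemLp f p μ) :
    TendstoLp μ p l (fun i => avg (P i) f) f := by
  have hr : 0 < p.toReal := ENNReal.toReal_pos (one_pos.trans_le hp).ne' hp'
  refine ⟨fun i => memLp_avg hp hp' hf, hf, ?_⟩
  rw [ENNReal.tendsto_nhds_zero]
  intro ε hε
  have hU := (ENNReal.tendsto_nhds_zero.1 (tendsto_eLpNorm_translate_sub hp hp' hf)) ε hε
  filter_upwards [hP _ hU] with i hi
  have hm := aestronglyMeasurable_translates (P := P i) hf.1
  have hm' : AEStronglyMeasurable (Function.uncurry fun x y => f (x + y) - f x)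
      (μ.prod (P i)) := hm.sub hf.1.comp_fst
  -- Tonelli gives integrability of `y ↦ f (x + y)` for almost every `x`, so `f x` can be brought
  -- under the average. Jensen then bounds the error by an average of translation errors, each at
  -- most `ε`.
  have hint : ∀ᵐ x ∂μ, Integrable (fun y => f (x + y)) (P i) := by
    have hfin : ∫⁻ x, ∫⁻ y, ‖f (x + y)‖ₑ ^ p.toReal ∂(P i) ∂μ < ⊤ := by
      rw [lintegral_lintegral_swap (f := fun x y => ‖f (x + y)‖ₑ ^ p.toReal)
        (hm.enorm.pow_const _)]
      have : ∀ y, ∫⁻ x, ‖f (x + y)‖ₑ ^ p.toReal ∂μ = ∫⁻ x, ‖f x‖ₑ ^ p.toReal ∂μ := fun y =>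
        lintegral_add_right_eq_self (fun x => ‖f x‖ₑ ^ p.toReal) y
      simp only [this, lintegral_const, measure_univ, mul_one]
      exact lintegral_rpow_enorm_lt_top_of_eLpNorm_lt_top (one_pos.trans_le hp).ne' hp' hf.2
    filter_upwards [hm.prodMk_left, ae_lt_top' ((hm.enorm.pow_const
      p.toReal).lintegral_prod_right') hfin.ne] with x hx1 hx2
    have : MemLp (fun y => f (x + y)) p (P i) := by
      refine ⟨hx1, ?_⟩
      rw [eLpNorm_lt_top_iff_lintegral_rpow_enorm_lt_top (one_pos.trans_le hp).ne' hp']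
      exact hx2
    exact memLp_one_iff_integrable.1 (this.mono_exponent hp)
  have heq : avg (P i) f - f =ᵐ[μ] fun x => ∫ y, (f (x + y) - f x) ∂(P i) := by
    filter_upwards [hint] with x hx
    rw [integral_sub hx (integrable_const _)]
    simp [avg]
  rw [eLpNorm_congr_ae heq]
  have h := eLpNorm_integral_le hp hp' hm'
  refine (ENNReal.rpow_le_rpow_iff hr).1 (h.trans ?_)
  calc _ ≤ ∫⁻ _, ε ^ p.toReal ∂(P i) := by
        refine lintegral_mono_ae ?_
        filter_upwards [hi] with y hy
        exact ENNReal.rpow_le_rpow hy hr.le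
    _ = _ := by simp

end Average

/-! ### Calculus on the torus -/

section Torus

variable {N : ℕ}

instance : IsProbabilityMeasure (volume : Measure UnitAddCircle) :=
  ⟨by rw [AddCircle.measure_univ]; simp⟩

instance : IsProbabilityMeasure (volume : Measure (Torus N)) := by
  rw [volume_pi]; infer_instance

theorem cover_add (y z : Fin N → ℝ) : cover (y + z) = cover y + cover z := by
  ext i; simp [cover]

theorem cover_zero : cover (0 : Fin N → ℝ) = 0 := by
  ext i; simp [cover]

theorem cover_single (i : Fin N) (s : ℝ) :
    cover (Pi.single i s) = Pi.single i (s : UnitAddCircle) := by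
  ext j
  by_cases h : j = i
  · subst h; simp [cover]
  · simp [cover, h]

theorem isOpenQuotientMap_cover : IsOpenQuotientMap (cover : (Fin N → ℝ) → Torus N) := by
  have h : IsOpenQuotientMap ((↑) : ℝ → UnitAddCircle) := QuotientAddGroup.isOpenQuotientMap_mk
  exact IsOpenQuotientMap.piMap fun _ : Fin N => h

theorem continuous_cover : Continuous (cover : (Fin N → ℝ) → Torus N) :=
  isOpenQuotientMap_cover.continuous

theorem exists_cover (x : Torus N) : ∃ y, cover y = x := isOpenQuotientMap_cover.surjective x

theorem IsSmooth.continuous {φ : Torus N → ℝ} (h : IsSmooth φ) : Continuous φ :=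
  isOpenQuotientMap_cover.isQuotientMap.continuous_iff.2 (ContDiff.continuous h)

theorem IsSmooth.hasDerivAt {φ : Torus N → ℝ} (h : IsSmooth φ) (i : Fin N) (y : Fin N → ℝ)
    (s : ℝ) : HasDerivAt (fun s : ℝ => φ (cover y + Pi.single i (s : UnitAddCircle)))
      (fderiv ℝ (fun y => φ (cover y)) (y + Pi.single i s) (Pi.single i 1)) s := by
  have h1 := ((ContDiff.differentiable h (by simp)) (y + Pi.single i s)).hasFDerivAt
  have h2 : HasDerivAt (fun s : ℝ => y + Pi.single i s) (Pi.single i 1) s :=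
    (hasDerivAt_single i s).const_add y
  have h3 := h1.comp_hasDerivAt s h2
  refine h3.congr_of_eventuallyEq (Eventually.of_forall fun r => ?_)
  simp [cover_add, cover_single, Function.comp]

theorem IsSmooth.partialX_cover {φ : Torus N → ℝ} (h : IsSmooth φ) (i : Fin N)
    (y : Fin N → ℝ) :
    partialX i φ (cover y) = fderiv ℝ (fun y => φ (cover y)) y (Pi.single i 1) := by
  have := (h.hasDerivAt i y 0).deriv
  simpa [partialX] using this

theorem IsSmooth.hasDerivAt_partialX {φ : Torus N → ℝ} (h : IsSmooth φ) (i : Fin N)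
    (x : Torus N) (s : ℝ) :
    HasDerivAt (fun s : ℝ => φ (x + Pi.single i (s : UnitAddCircle)))
      (partialX i φ (x + Pi.single i (s : UnitAddCircle))) s := by
  obtain ⟨y, rfl⟩ := exists_cover x
  have h1 := h.hasDerivAt i y s
  rwa [← h.partialX_cover, cover_add, cover_single] at h1

theorem IsSmooth.partialX {φ : Torus N → ℝ} (h : IsSmooth φ) (i : Fin N) :
    IsSmooth (partialX i φ) := by
  have h1 : ContDiff ℝ ∞ (fun y => fderiv ℝ (fun y => φ (cover y)) y (Pi.single i 1)) :=
    (ContDiff.fderiv_right h (by simp)).clm_apply contDiff_const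
  have h2 : (fun y => DegenerateNS.partialX i φ (cover y))
      = fun y => fderiv ℝ (fun y => φ (cover y)) y (Pi.single i 1) :=
    funext fun y => h.partialX_cover i y
  rw [IsSmooth, h2]
  exact h1

theorem IsSmooth.const (c : ℝ) : IsSmooth (fun _ : Torus N => c) := contDiff_const

theorem IsSmooth.mul {φ ψ : Torus N → ℝ} (h : IsSmooth φ) (h' : IsSmooth ψ) :
    IsSmooth (fun x => φ x * ψ x) := ContDiff.mul h h'

theorem IsSmooth.sub {φ ψ : Torus N → ℝ} (h : IsSmooth φ) (h' : IsSmooth ψ) :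
    IsSmooth (fun x => φ x - ψ x) := ContDiff.sub h h'

theorem IsSmooth.translate {φ : Torus N → ℝ} (h : IsSmooth φ) (z : Torus N) :
    IsSmooth (fun x => φ (x + z)) := by
  obtain ⟨w, rfl⟩ := exists_cover z
  have h1 : ContDiff ℝ ∞ (fun y : Fin N → ℝ => φ (cover (y + w))) :=
    ContDiff.comp (g := fun y : Fin N → ℝ => φ (cover y)) h (contDiff_id.add contDiff_const)
  simpa only [IsSmooth, cover_add] using h1

theorem partialX_translate (φ : Torus N → ℝ) (z : Torus N) (i : Fin N) (x : Torus N) :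
    partialX i (fun x => φ (x + z)) x = partialX i φ (x + z) := by
  unfold partialX
  simp only [add_right_comm]

theorem IsSmooth.hasDerivAt_zero {φ : Torus N → ℝ} (h : IsSmooth φ) (i : Fin N)
    (x : Torus N) :
    HasDerivAt (fun s : ℝ => φ (x + Pi.single i (s : UnitAddCircle))) (DegenerateNS.partialX i φ x) 0 := by
  simpa using h.hasDerivAt_partialX i x 0

theorem partialX_mul {φ ψ : Torus N → ℝ} (h : IsSmooth φ) (h' : IsSmooth ψ) (i : Fin N)
    (x : Torus N) :
    partialX i (fun x => φ x * ψ x) x = partialX i φ x * ψ x + φ x * partialX i ψ x := by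
  have := ((h.hasDerivAt_zero i x).fun_mul (h'.hasDerivAt_zero i x)).deriv
  simpa [partialX] using this

theorem partialX_comp {φ : Torus N → ℝ} {F F' : ℝ → ℝ} (h : IsSmooth φ)
    (hF : ∀ x, HasDerivAt F (F' (φ x)) (φ x)) (i : Fin N) (x : Torus N) :
    partialX i (fun x => F (φ x)) x = F' (φ x) * partialX i φ x := by
  have h1 : HasDerivAt F (F' (φ x))
      ((fun s : ℝ => φ (x + Pi.single i (s : UnitAddCircle))) 0) := by simpa using hF x
  exact (h1.comp (0 : ℝ) (h.hasDerivAt_zero i x)).deriv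

theorem memLp_of_continuous {φ : Torus N → ℝ} (h : Continuous φ) (p : ℝ≥0∞) :
    MemLp φ p volume := by
  obtain ⟨C, hC⟩ := (isCompact_range h).isBounded.exists_norm_le
  exact MemLp.of_bound h.aestronglyMeasurable C
    (Eventually.of_forall fun x => hC _ (mem_range_self x))

theorem IsSmooth.memLp {φ : Torus N → ℝ} (h : IsSmooth φ) (p : ℝ≥0∞) : MemLp φ p volume :=
  memLp_of_continuous h.continuous p

theorem IsSmooth.integrable {φ : Torus N → ℝ} (h : IsSmooth φ) : Integrable φ :=
  memLp_one_iff_integrable.1 (h.memLp 1)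

theorem IsSmooth.exists_bound {φ : Torus N → ℝ} (h : IsSmooth φ) : ∃ C, ∀ x, ‖φ x‖ ≤ C := by
  obtain ⟨C, hC⟩ := (isCompact_range h.continuous).isBounded.exists_norm_le
  exact ⟨C, fun x => hC _ (mem_range_self x)⟩

theorem Integrable.mul_isSmooth {f φ : Torus N → ℝ} (hf : Integrable f) (h : IsSmooth φ) :
    Integrable (fun x => f x * φ x) := by
  obtain ⟨C, hC⟩ := h.exists_bound
  exact hf.mul_bdd (c := C) h.continuous.aestronglyMeasurable (Eventually.of_forall hC)

/-- Translation invariance makes the integral of `x ↦ φ (x + s eᵢ)` constant in `s`; its derivative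
at `s = 0`, taken under the integral sign, is the integral in question. -/
theorem integral_partialX {φ : Torus N → ℝ} (h : IsSmooth φ) (i : Fin N) :
    ∫ x, partialX i φ x = 0 := by
  obtain ⟨C, hC⟩ := (h.partialX i).exists_bound
  have m1 : ∀ᶠ s : ℝ in 𝓝 0, AEStronglyMeasurable
      (fun x : Torus N => φ (x + Pi.single i (s : UnitAddCircle))) volume :=
    Eventually.of_forall fun s => (h.translate _).continuous.aestronglyMeasurable
  have m2 : Integrable (fun x : Torus N => φ (x + Pi.single i ((0 : ℝ) : UnitAddCircle))) :=
    (h.translate _).integrable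
  have m3 : AEStronglyMeasurable
      (fun x : Torus N => partialX i φ (x + Pi.single i ((0 : ℝ) : UnitAddCircle))) volume :=
    ((h.partialX i).translate _).continuous.aestronglyMeasurable
  have m4 : ∀ᵐ x : Torus N, ∀ s ∈ (univ : Set ℝ),
      ‖partialX i φ (x + Pi.single i (s : UnitAddCircle))‖ ≤ C :=
    ae_of_all _ fun x s _ => hC (x + Pi.single i (s : UnitAddCircle))
  have m5 : ∀ᵐ x : Torus N, ∀ s ∈ (univ : Set ℝ),
      HasDerivAt (fun s : ℝ => φ (x + Pi.single i (s : UnitAddCircle)))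
        (partialX i φ (x + Pi.single i (s : UnitAddCircle))) s :=
    ae_of_all _ fun x s _ => h.hasDerivAt_partialX i x s
  have hd := (hasDerivAt_integral_of_dominated_loc_of_deriv_le univ_mem m1 m2 m3 m4
    (integrable_const C) m5).2
  have hc : (fun s : ℝ => ∫ x : Torus N, φ (x + Pi.single i (s : UnitAddCircle)))
      = fun _ => ∫ x, φ x := by
    ext s
    exact integral_add_right_eq_self φ _
  rw [hc] at hd
  have := hd.unique (hasDerivAt_const (0 : ℝ) _)
  simpa using this

/-- `g` is the gradient of `f` in `𝒟'(𝕋^N)`. -/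
def WGrad (f : Torus N → ℝ) (g : Fin N → Torus N → ℝ) : Prop :=
  ∀ φ : Torus N → ℝ, IsSmooth φ → ∀ i, ∫ x, f x * partialX i φ x = - ∫ x, g i x * φ x

theorem IsSmooth.wGrad {φ : Torus N → ℝ} (h : IsSmooth φ) :
    WGrad φ fun i => DegenerateNS.partialX i φ := by
  intro ψ hψ i
  have h0 := integral_partialX (h.mul hψ) i
  simp_rw [partialX_mul h hψ] at h0
  rw [integral_add ((h.partialX i).mul hψ).integrable (h.mul (hψ.partialX i)).integrable] at h0
  linarith

end Torus

/-! ### Mollification on the torus -/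

section Mollification

variable {N : ℕ}

theorem measurePreserving_cover (a : Fin N → ℝ) :
    MeasurePreserving (cover : (Fin N → ℝ) → Torus N)
      (volume.restrict (univ.pi fun i => Ioc (a i) (a i + 1))) volume := by
  have h := measurePreserving_pi (fun i => (volume : Measure ℝ).restrict (Ioc (a i) (a i + 1)))
    (fun _ => (volume : Measure UnitAddCircle)) (fun i => AddCircle.measurePreserving_mk 1 (a i))
  rw [volume_pi, Measure.restrict_pi_pi, volume_pi]
  exact h

theorem box_mem_nhds (y : Fin N → ℝ) :
    (univ.pi fun i => Ioc (y i - 1 / 2) (y i - 1 / 2 + 1)) ∈ 𝓝 y :=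
  set_pi_mem_nhds finite_univ fun i _ => Ioc_mem_nhds (by linarith) (by linarith)

/-- Around every point there is a unit box on which the covering map preserves measure, so preimages
of null sets are locally null. -/
theorem quasiMeasurePreserving_cover :
    Measure.QuasiMeasurePreserving (cover : (Fin N → ℝ) → Torus N) volume volume := by
  refine ⟨continuous_cover.measurable, Measure.AbsolutelyContinuous.mk fun s hs h0 => ?_⟩
  rw [Measure.map_apply continuous_cover.measurable hs]
  refine measure_null_of_locally_null _ fun y _ => ?_
  refine ⟨_ ∩ cover ⁻¹' s, inter_mem (mem_nhdsWithin_of_mem_nhds (box_mem_nhds y))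
    self_mem_nhdsWithin, ?_⟩
  have h1 := (measurePreserving_cover fun i => y i - 1 / 2).measure_preimage
    hs.nullMeasurableSet
  rw [Measure.restrict_apply (continuous_cover.measurable hs), h0] at h1
  rwa [inter_comm]

theorem locallyIntegrable_comp_cover {f : Torus N → ℝ} (hf : Integrable f) :
    LocallyIntegrable (fun y => f (cover y)) (volume : Measure (Fin N → ℝ)) := fun y =>
  ⟨_, box_mem_nhds y, (measurePreserving_cover fun i => y i - 1 / 2).integrable_comp_of_integrable
    hf⟩

/-- Smooth bump functions on `ℝ^N` concentrating at the origin. -/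
def bump (N n : ℕ) : ContDiffBump (0 : Fin N → ℝ) :=
  ⟨1 / (2 * ((n : ℝ) + 1)), 1 / ((n : ℝ) + 1), by positivity,
    by rw [one_div_lt_one_div (by positivity) (by positivity)]
       have : (0 : ℝ) ≤ n := n.cast_nonneg
       linarith⟩

/-- The density of the mollifier on `ℝ^N`. -/
def kernel (N n : ℕ) : (Fin N → ℝ) → ℝ := (bump N n).normed volume

/-- The smooth probability density `kernel N n` on `ℝ^N` as a measure. -/
def kernelMeasure (N n : ℕ) : Measure (Fin N → ℝ) :=
  volume.withDensity fun y => ENNReal.ofReal (kernel N n y)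

theorem kernel_nonneg (N n : ℕ) (y : Fin N → ℝ) : 0 ≤ kernel N n y := (bump N n).nonneg_normed y

theorem continuous_kernel (N n : ℕ) : Continuous (kernel N n) :=
  ((bump N n).contDiff_normed (n := 0)).continuous

instance (N n : ℕ) : IsProbabilityMeasure (kernelMeasure N n) := by
  refine ⟨?_⟩
  rw [kernelMeasure, withDensity_apply _ MeasurableSet.univ, Measure.restrict_univ,
    ← ofReal_integral_eq_lintegral_ofReal (f := kernel N n) (bump N n).integrable_normed
      (Eventually.of_forall (kernel_nonneg N n)), kernel, (bump N n).integral_normed]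
  simp

/-- The mollifier on the torus. -/
def mollifier (N n : ℕ) : Measure (Torus N) := (kernelMeasure N n).map cover

instance (N n : ℕ) : IsProbabilityMeasure (mollifier N n) :=
  Measure.isProbabilityMeasure_map continuous_cover.aemeasurable

theorem mollifier_absolutelyContinuous (N n : ℕ) : mollifier N n ≪ volume :=
  ((withDensity_absolutelyContinuous _ _).map continuous_cover.measurable).trans
    quasiMeasurePreserving_cover.absolutelyContinuous

theorem mollifier_concentrates (U : Set (Torus N)) (hU : U ∈ 𝓝 (0 : Torus N)) :
    ∀ᶠ n in atTop, ∀ᵐ y ∂(mollifier N n), y ∈ U := by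
  obtain ⟨V, hVU, hV, h0⟩ := mem_nhds_iff.1 hU
  have h1 : cover ⁻¹' V ∈ 𝓝 (0 : Fin N → ℝ) :=
    continuous_cover.continuousAt.preimage_mem_nhds (by rw [cover_zero]; exact hV.mem_nhds h0)
  obtain ⟨ε, hε, hb⟩ := Metric.mem_nhds_iff.1 h1
  filter_upwards [(tendsto_one_div_add_atTop_nhds_zero_nat (𝕜 := ℝ)).eventually_lt_const hε]
    with n hn
  refine (ae_map_iff continuous_cover.aemeasurable hV.measurableSet).2 ?_ |>.mono hVU
  rw [kernelMeasure, ae_withDensity_iff (continuous_kernel N n).measurable.ennreal_ofReal]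
  refine Eventually.of_forall fun y hy => hb ?_
  have hy' : y ∈ Function.support (kernel N n) := fun h => hy (by simp [h])
  rw [kernel, (bump N n).support_normed_eq] at hy'
  exact Metric.ball_subset_ball hn.le hy'

/-- Mollification of a function on the torus. -/
def moll (n : ℕ) (f : Torus N → ℝ) : Torus N → ℝ := avg (mollifier N n) f

theorem tendstoLp_moll {p : ℝ≥0∞} (hp : 1 ≤ p) (hp' : p ≠ ⊤) {f : Torus N → ℝ}
    (hf : MemLp f p volume) : TendstoLp volume p atTop (fun n => moll n f) f :=
  tendstoLp_avg hp hp' mollifier_concentrates hf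

theorem quasiMeasurePreserving_add_left_mollifier (n : ℕ) (x : Torus N) :
    Measure.QuasiMeasurePreserving (fun y => x + y) (mollifier N n) volume :=
  (measurePreserving_add_left volume x).quasiMeasurePreserving.mono_left
    (mollifier_absolutelyContinuous N n)

/-- The mollifier is absolutely continuous, so the bound survives at every `x`, not just almost
everywhere. This matters when a mollification is composed with a function that is smooth only near
`[a, b]`. -/
theorem moll_mem_Icc {f : Torus N → ℝ} (hf : AEStronglyMeasurable f volume) {a b : ℝ}
    (h : ∀ᵐ x, f x ∈ Icc a b) (n : ℕ) (x : Torus N) : moll n f x ∈ Icc a b := by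
  have hq := quasiMeasurePreserving_add_left_mollifier n x
  have h1 : ∀ᵐ y ∂(mollifier N n), f (x + y) ∈ Icc a b := hq.ae h
  have h2 : AEStronglyMeasurable (fun y => f (x + y)) (mollifier N n) :=
    hf.comp_quasiMeasurePreserving hq
  have hi : Integrable (fun y => f (x + y)) (mollifier N n) := by
    refine Integrable.of_bound h2 (max |a| |b|) (h1.mono fun y hy => ?_)
    exact abs_le_max_abs_abs hy.1 hy.2
  constructor
  · have := integral_mono_ae (integrable_const a) hi (h1.mono fun y hy => hy.1)
    simpa [moll, avg] using this
  · have := integral_mono_ae hi (integrable_const b) (h1.mono fun y hy => hy.2)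
    simpa [moll, avg] using this

/-- Lifted to `ℝ^N`, the mollification is the convolution of a smooth bump with the periodic lift of
`f`; evenness of the bump reconciles `x + y` with `x - y`. -/
theorem isSmooth_moll {f : Torus N → ℝ} (hf : Integrable f) (n : ℕ) : IsSmooth (moll n f) := by
  have h1 := HasCompactSupport.contDiff_convolution_left (n := ⊤) (ContinuousLinearMap.mul ℝ ℝ)
    (μ := (volume : Measure (Fin N → ℝ)))
    ((bump N n).hasCompactSupport_normed (μ := volume))
    ((bump N n).contDiff_normed (μ := volume) (n := ⊤))
    (locallyIntegrable_comp_cover hf)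
  rw [IsSmooth]
  convert! h1 using 1
  ext y
  have hm : AEStronglyMeasurable (fun z => f (cover y + z)) (mollifier N n) :=
    hf.1.comp_quasiMeasurePreserving (quasiMeasurePreserving_add_left_mollifier n _)
  rw [moll, avg, mollifier, integral_map continuous_cover.aemeasurable hm, kernelMeasure,
    integral_withDensity_eq_integral_toReal_smul
      (continuous_kernel N n).measurable.ennreal_ofReal (by simp), convolution_def,
    ← integral_neg_eq_self]
  refine integral_congr_ae (Eventually.of_forall fun z => ?_)
  simp only [ENNReal.toReal_ofReal (kernel_nonneg N n _), ContinuousLinearMap.mul_apply',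
    smul_eq_mul]
  rw [kernel, (bump N n).normed_neg, ← cover_add, sub_eq_add_neg]

/-- Fubini and a translation move the mollifier onto the test function. -/
theorem integral_moll_mul {f φ : Torus N → ℝ} (hf : Integrable f) (hφ : IsSmooth φ) (n : ℕ) :
    ∫ x, moll n f x * φ x = ∫ y, ∫ x, f x * φ (x + -y) ∂volume ∂(mollifier N n) := by
  have hm := aestronglyMeasurable_translates (P := mollifier N n) hf.1
  have hi : Integrable (Function.uncurry fun x y => f (x + y))
      ((volume : Measure (Torus N)).prod (mollifier N n)) := by
    refine ⟨hm, ?_⟩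
    rw [hasFiniteIntegral_iff_enorm, lintegral_prod_symm _ hm.enorm]
    have : ∀ y, ∫⁻ x, ‖f (x + y)‖ₑ = ∫⁻ x, ‖f x‖ₑ := fun y =>
      lintegral_add_right_eq_self (fun x => ‖f x‖ₑ) y
    simp only [Function.uncurry, this, lintegral_const, measure_univ, mul_one]
    exact hf.2
  obtain ⟨C, hC⟩ := hφ.exists_bound
  have hi' : Integrable (Function.uncurry fun x y => f (x + y) * φ x)
      ((volume : Measure (Torus N)).prod (mollifier N n)) :=
    hi.mul_bdd (c := C) hφ.continuous.aestronglyMeasurable.comp_fst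
      (Eventually.of_forall fun z => hC _)
  calc _ = ∫ x, ∫ y, f (x + y) * φ x ∂(mollifier N n) := by
        refine integral_congr_ae (Eventually.of_forall fun x => ?_)
        simp only [moll, avg]
        rw [integral_mul_const]
    _ = ∫ y, ∫ x, f (x + y) * φ x ∂volume ∂(mollifier N n) := integral_integral_swap hi'
    _ = _ := by
        refine integral_congr_ae (Eventually.of_forall fun y => ?_)
        have := integral_add_right_eq_self (μ := (volume : Measure (Torus N)))
          (fun x => f x * φ (x + -y)) y
        simp only [← this, add_neg_cancel_right]

theorem ae_eq_zero_of_isSmooth {D : Torus N → ℝ} (hD : IsSmooth D)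
    (h : ∫ x, D x * D x = 0) : D =ᵐ[volume] 0 := by
  have h1 := (integral_eq_zero_iff_of_nonneg (fun x => mul_self_nonneg (D x))
    (hD.mul hD).integrable).1 h
  filter_upwards [h1] with x hx
  simpa using hx

/-- The difference of the two functions is smooth and orthogonal to all smooth functions, hence to
itself. -/
theorem partialX_moll {f : Torus N → ℝ} {g : Fin N → Torus N → ℝ} (hf : Integrable f)
    (hg : ∀ i, Integrable (g i)) (h : WGrad f g) (n : ℕ) (i : Fin N) :
    partialX i (moll n f) =ᵐ[volume] moll n (g i) := by
  have sf := isSmooth_moll hf n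
  have sg := isSmooth_moll (hg i) n
  have hD := (sf.partialX i).sub sg
  have key : ∀ φ, IsSmooth φ → ∫ x, (partialX i (moll n f) x - moll n (g i) x) * φ x = 0 := by
    intro φ hφ
    simp_rw [sub_mul]
    rw [integral_sub ((sf.partialX i).mul hφ).integrable (sg.mul hφ).integrable]
    have h1 := sf.wGrad φ hφ i
    have h2 := integral_moll_mul hf (hφ.partialX i) n
    have h3 := integral_moll_mul (hg i) hφ n
    have h4 : ∀ y, ∫ x, f x * partialX i φ (x + -y) = - ∫ x, g i x * φ (x + -y) := by
      intro y
      have := h _ (hφ.translate (-y)) i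
      simpa [partialX_translate] using this
    simp_rw [h4, integral_neg] at h2
    linarith
  filter_upwards [ae_eq_zero_of_isSmooth hD (key _ hD)] with x hx
  simpa [sub_eq_zero] using hx

/-- An integrable function that is orthogonal to all smooth functions vanishes. -/
theorem ae_eq_zero_of_forall_isSmooth {f : Torus N → ℝ} (hf : Integrable f)
    (h : ∀ φ, IsSmooth φ → ∫ x, f x * φ x = 0) : f =ᵐ[volume] 0 := by
  -- Each mollification is smooth and, once the mollifier is moved onto the second factor,
  -- orthogonal to itself; so all mollifications vanish, and they converge to `f` in `L¹`.
  have h0 : ∀ n, moll n f =ᵐ[volume] 0 := fun n => by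
    have s := isSmooth_moll hf n
    refine ae_eq_zero_of_isSmooth s ?_
    rw [integral_moll_mul hf s]
    simp [h _ (s.translate _)]
  have h1 := (tendstoLp_moll le_rfl (by simp) (memLp_one_iff_integrable.2 hf)).tendsto
  have h2 : ∀ n, eLpNorm (moll n f - f) 1 volume = eLpNorm f 1 volume := fun n => by
    rw [← eLpNorm_neg f]
    refine eLpNorm_congr_ae ?_
    filter_upwards [h0 n] with x hx
    simp [hx]
  simp_rw [h2] at h1
  exact (eLpNorm_eq_zero_iff hf.1 (by simp)).1 (tendsto_nhds_unique tendsto_const_nhds h1)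

end Mollification

/-! ### Weak derivatives on the torus tested with Sobolev functions -/

section WeakDerivatives

variable {N : ℕ}

/-- `a = -div B` in `𝒟'(𝕋^N)`. -/
def WDiv (B : Fin N → Torus N → ℝ) (a : Torus N → ℝ) : Prop :=
  ∀ φ : Torus N → ℝ, IsSmooth φ → ∫ x, a x * φ x = ∫ x, ∑ j, B j x * partialX j φ x

theorem integrable_of_memLp_two {f : Torus N → ℝ} (hf : MemLp f 2 volume) : Integrable f :=
  hf.integrable one_le_two

theorem integrable_mul_two {α : Type*} [MeasurableSpace α] {μ : Measure α} {f g : α → ℝ}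
    (hf : MemLp f 2 μ) (hg : MemLp g 2 μ) : Integrable (fun x => f x * g x) μ :=
  memLp_one_iff_integrable.1 (hg.mul (p := 2) hf)

theorem memLp_two_mul {α : Type*} [MeasurableSpace α] {μ : Measure α} {f g : α → ℝ}
    (hf : MemLp f 4 μ) (hg : MemLp g 4 μ) : MemLp (fun x => f x * g x) 2 μ :=
  hg.mul (p := 4) hf

/-- Mollify `φ`: the mollifications are admissible tests, and they converge in `L²` along with their
gradients, which are the mollified `g`. -/
theorem WDiv.integral_eq {B g : Fin N → Torus N → ℝ} {a φ : Torus N → ℝ} (h : WDiv B a)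
    (ha : MemLp a 2 volume) (hB : ∀ j, MemLp (B j) 2 volume) (hφ : MemLp φ 2 volume)
    (hg : ∀ j, MemLp (g j) 2 volume) (hw : WGrad φ g) :
    ∫ x, a x * φ x = ∫ x, ∑ j, B j x * g j x := by
  have t1 := ((TendstoLp.const (l := atTop) (ι := ℕ) ha).mul (r := 1)
    (tendstoLp_moll one_le_two (by simp) hφ)).integral
  have t2 := (TendstoLp.sum (p := 1) Finset.univ fun j _ =>
    (TendstoLp.const (l := atTop) (ι := ℕ) (hB j)).mul (r := 1)
      (tendstoLp_moll one_le_two (by simp) (hg j))).integral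
  refine tendsto_nhds_unique t1 (t2.congr fun n => ?_)
  rw [h _ (isSmooth_moll (integrable_of_memLp_two hφ) n)]
  refine integral_congr_ae ?_
  have := ae_all_iff.2 fun j => partialX_moll (integrable_of_memLp_two hφ)
    (fun i => integrable_of_memLp_two (hg i)) hw n j
  filter_upwards [this] with x hx
  simp [hx]

theorem memLp_two_of_four {f : Torus N → ℝ} (hf : MemLp f 4 volume) : MemLp f 2 volume :=
  hf.mono_exponent (by norm_num)

/-- Both factors are mollified separately and the product rule is applied to the smooth pair. The
exponents are `4, 4, 2` for flux, undifferentiated factor and gradient; the product `φψ` itself need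
not have a square integrable gradient. This serves to test the mass equation with the product of
velocities at two times. -/
theorem WDiv.integral_mul_eq {B g g' : Fin N → Torus N → ℝ} {a φ ψ : Torus N → ℝ}
    (h : WDiv B a) (ha : MemLp a 2 volume) (hB : ∀ j, MemLp (B j) 4 volume)
    (hφ : MemLp φ 4 volume) (hψ : MemLp ψ 4 volume) (hg : ∀ j, MemLp (g j) 2 volume)
    (hg' : ∀ j, MemLp (g' j) 2 volume) (hw : WGrad φ g) (hw' : WGrad ψ g') :
    ∫ x, a x * (φ x * ψ x) = ∫ x, ∑ j, (B j x * ψ x * g j x + B j x * φ x * g' j x) := by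
  have hφ2 := integrable_of_memLp_two (memLp_two_of_four hφ)
  have hψ2 := integrable_of_memLp_two (memLp_two_of_four hψ)
  have tφ := tendstoLp_moll (p := 4) (by norm_num) (by simp) hφ
  have tψ := tendstoLp_moll (p := 4) (by norm_num) (by simp) hψ
  have t1 := ((TendstoLp.const (l := atTop) (ι := ℕ) ha).mul (r := 1)
    (tφ.mul (r := 2) tψ)).integral
  have t2 := (TendstoLp.sum (p := 1) Finset.univ fun j _ =>
    (((TendstoLp.const (l := atTop) (ι := ℕ) (hB j)).mul (r := 2) tψ).mul (r := 1)
      (tendstoLp_moll one_le_two (by simp) (hg j))).add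
    (((TendstoLp.const (l := atTop) (ι := ℕ) (hB j)).mul (r := 2) tφ).mul (r := 1)
      (tendstoLp_moll one_le_two (by simp) (hg' j)))).integral
  refine tendsto_nhds_unique t1 (t2.congr fun n => ?_)
  have sφ := isSmooth_moll hφ2 n
  have sψ := isSmooth_moll hψ2 n
  rw [h _ (sφ.mul sψ)]
  refine integral_congr_ae ?_
  have h1 := ae_all_iff.2 fun j => partialX_moll hφ2
    (fun i => integrable_of_memLp_two (hg i)) hw n j
  have h2 := ae_all_iff.2 fun j => partialX_moll hψ2
    (fun i => integrable_of_memLp_two (hg' i)) hw' n j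
  filter_upwards [h1, h2] with x hx hx'
  refine Finset.sum_congr rfl fun j _ => ?_
  rw [partialX_mul sφ sψ, hx, hx']
  simp only [Pi.add_apply]
  ring

/-! ### Composition with functions smooth near a compact interval -/

theorem contDiffAt_deriv {F : ℝ → ℝ} {x : ℝ} (hF : ContDiffAt ℝ ∞ F x) :
    ContDiffAt ℝ ∞ (deriv F) x := by
  have h : ContDiffAt ℝ ∞ (fun y => fderiv ℝ F y 1) x :=
    (hF.fderiv_right (by simp)).clm_apply contDiffAt_const
  have e : deriv F = fun y => fderiv ℝ F y 1 := funext fun y => by simp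
  rwa [e]

theorem exists_lipschitz_of_contDiffAt {F : ℝ → ℝ} {a b : ℝ}
    (hF : ∀ x ∈ Icc a b, ContDiffAt ℝ ∞ F x) :
    ∃ L, ∀ x ∈ Icc a b, ∀ y ∈ Icc a b, |F y - F x| ≤ L * |y - x| := by
  have hc : ContinuousOn (deriv F) (Icc a b) := fun x hx =>
    (contDiffAt_deriv (hF x hx)).continuousAt.continuousWithinAt
  obtain ⟨C, hC⟩ := isCompact_Icc.exists_bound_of_continuousOn hc
  exact ⟨C, fun x hx y hy => (convex_Icc a b).norm_image_sub_le_of_norm_deriv_le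
    (fun z hz => (hF z hz).differentiableAt (by simp)) hC hx hy⟩

theorem memLp_comp_of_contDiffAt {α : Type*} [MeasurableSpace α] {μ : Measure α}
    [IsFiniteMeasure μ] {F : ℝ → ℝ} {a b : ℝ}
    (hF : ∀ x ∈ Icc a b, ContDiffAt ℝ ∞ F x) (hm : Measurable F) {R : α → ℝ}
    (hR : AEStronglyMeasurable R μ) (hRI : ∀ᵐ x ∂μ, R x ∈ Icc a b) (p : ℝ≥0∞) :
    MemLp (fun x => F (R x)) p μ := by
  obtain ⟨C, hC⟩ := isCompact_Icc.exists_bound_of_continuousOn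
    (fun x hx => (hF x hx).continuousAt.continuousWithinAt)
  exact MemLp.of_bound (hm.comp_aemeasurable hR.aemeasurable).aestronglyMeasurable C
    (hRI.mono fun x hx => hC _ hx)

/-- On `[a, b]` the function `F` is Lipschitz, so composition with it is Lipschitz in `L^p` among
functions with values there. -/
theorem TendstoLp.comp_contDiffAt {α ι : Type*} [MeasurableSpace α] {μ : Measure α}
    [IsFiniteMeasure μ] {l : Filter ι} {F : ℝ → ℝ} {a b : ℝ}
    (hF : ∀ x ∈ Icc a b, ContDiffAt ℝ ∞ F x) (hm : Measurable F) {p : ℝ≥0∞} {R : ι → α → ℝ}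
    {R₀ : α → ℝ} (h : TendstoLp μ p l R R₀) (hR : ∀ i, ∀ᵐ x ∂μ, R i x ∈ Icc a b)
    (hR₀ : ∀ᵐ x ∂μ, R₀ x ∈ Icc a b) :
    TendstoLp μ p l (fun i x => F (R i x)) (fun x => F (R₀ x)) := by
  obtain ⟨L, hL⟩ := exists_lipschitz_of_contDiffAt hF
  refine ⟨fun i => memLp_comp_of_contDiffAt hF hm (h.memLp i).1 (hR i) p,
    memLp_comp_of_contDiffAt hF hm h.memLp_lim.1 hR₀ p, ?_⟩
  have hle : ∀ i, eLpNorm ((fun x => F (R i x)) - fun x => F (R₀ x)) p μ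
      ≤ ENNReal.ofReal L * eLpNorm (R i - R₀) p μ := fun i => by
    refine eLpNorm_le_mul_eLpNorm_of_ae_le_mul ?_ p
    filter_upwards [hR i, hR₀] with x h1 h2
    exact hL _ h2 _ h1
  refine tendsto_of_tendsto_of_tendsto_of_le_of_le tendsto_const_nhds ?_ (fun _ => zero_le) hle
  simpa using ENNReal.Tendsto.const_mul h.tendsto (Or.inr ENNReal.ofReal_ne_top)

/-- The chain rule for a bounded Sobolev function. -/
theorem WGrad.comp {F : ℝ → ℝ} {a b : ℝ} (hF : ∀ x ∈ Icc a b, ContDiffAt ℝ ∞ F x)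
    (hm : Measurable F) {R : Torus N → ℝ} {g : Fin N → Torus N → ℝ} (hw : WGrad R g)
    (hR : AEStronglyMeasurable R volume) (hRI : ∀ᵐ x, R x ∈ Icc a b)
    (hg : ∀ j, MemLp (g j) 2 volume) :
    WGrad (fun x => F (R x)) fun j x => deriv F (R x) * g j x := by
  intro φ hφ i
  have hR2 : MemLp R 2 volume := by
    refine MemLp.of_bound hR (max |a| |b|) (hRI.mono fun x hx => ?_)
    exact abs_le_max_abs_abs hx.1 hx.2
  have hR1 := integrable_of_memLp_two hR2
  -- Mollifying keeps the values inside `[a, b]` at every point, so the classical chain rule applies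
  -- to each mollification even if `F` is singular elsewhere.
  have hn : ∀ n x, moll n R x ∈ Icc a b := fun n x => moll_mem_Icc hR hRI n x
  have tR := tendstoLp_moll one_le_two (by simp) hR2
  have t1 := ((tR.comp_contDiffAt hF hm (fun n => ae_of_all _ (hn n)) hRI).mul (r := 1)
    (TendstoLp.const ((hφ.partialX i).memLp 2))).integral
  have t2 := (((tR.comp_contDiffAt (fun x hx => contDiffAt_deriv (hF x hx)) (measurable_deriv F)
    (fun n => ae_of_all _ (hn n)) hRI).mul (r := 1)
    (((tendstoLp_moll one_le_two (by simp) (hg i)).mul (p := 2) (q := ⊤) (r := 2)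
      (TendstoLp.const (hφ.memLp ⊤))))).integral).neg
  have e : ∀ x, deriv F (R x) * g i x * φ x = deriv F (R x) * (g i x * φ x) :=
    fun x => mul_assoc _ _ _
  simp_rw [e]
  refine tendsto_nhds_unique t1 (t2.congr fun n => ?_)
  have sR := isSmooth_moll hR1 n
  have sF : IsSmooth fun x => F (moll n R x) := by
    refine contDiff_iff_contDiffAt.2 fun y => ?_
    exact (hF _ (hn n (cover y))).comp y (ContDiff.contDiffAt sR)
  rw [sF.wGrad φ hφ i]
  congr 1
  refine integral_congr_ae ?_
  filter_upwards [partialX_moll hR1 (fun i => integrable_of_memLp_two (hg i)) hw n i] with x hx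
  rw [← hx, partialX_comp sR (F' := deriv F)
    (fun x => ((hF _ (hn n x)).differentiableAt (by simp)).hasDerivAt)]
  ring

/-! ### A countable family of test functions -/

theorem exists_dense_isSmooth (N : ℕ) : ∃ d : ℕ → Torus N → ℝ, (∀ n, IsSmooth (d n)) ∧
    ∀ φ, IsSmooth φ → ∀ ε > 0, ∃ n, (∀ x, |d n x - φ x| ≤ ε) ∧
      ∀ i x, |partialX i (d n) x - partialX i φ x| ≤ ε := by
  -- A smooth function is recorded with its first derivatives in a separable metric space. Every
  -- subset of such a space has a countable dense subset of its own, so the approximants can be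
  -- taken among smooth functions.
  let J : {φ : Torus N → ℝ // IsSmooth φ} → C(Torus N, ℝ) × (Fin N → C(Torus N, ℝ)) := fun φ =>
    (⟨φ.1, φ.2.continuous⟩, fun i => ⟨partialX i φ.1, (φ.2.partialX i).continuous⟩)
  obtain ⟨c, hcs, hc, hd⟩ := (TopologicalSpace.IsSeparable.of_separableSpace
    (range J)).exists_countable_dense_subset
  have hne : c.Nonempty := by
    have : J ⟨fun _ => 0, IsSmooth.const 0⟩ ∈ closure c := hd (mem_range_self _)
    exact closure_nonempty_iff.1 ⟨_, this⟩
  obtain ⟨e, he⟩ := hc.exists_eq_range hne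
  have hx : ∀ n, ∃ φ, J φ = e n := fun n => hcs (he ▸ mem_range_self n)
  choose d hdJ using hx
  refine ⟨fun n => (d n).1, fun n => (d n).2, fun φ hφ ε hε => ?_⟩
  obtain ⟨z, hz, hdist⟩ := Metric.mem_closure_iff.1 (hd (mem_range_self ⟨φ, hφ⟩)) ε hε
  rw [he] at hz
  obtain ⟨n, rfl⟩ := hz
  rw [← hdJ n, dist_comm, Prod.dist_eq, max_lt_iff] at hdist
  refine ⟨n, fun x => ?_, fun i x => ?_⟩
  · exact (ContinuousMap.dist_apply_le_dist x).trans hdist.1.le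
  · exact (ContinuousMap.dist_apply_le_dist x).trans
      ((dist_le_pi_dist (J (d n)).2 (J ⟨φ, hφ⟩).2 i).trans hdist.2.le)

/-- A countable family of smooth functions on the torus that is dense for the `C¹` norm. -/
def denseSmooth (N : ℕ) : ℕ → Torus N → ℝ := (exists_dense_isSmooth N).choose

theorem isSmooth_denseSmooth (n : ℕ) : IsSmooth (denseSmooth N n) :=
  (exists_dense_isSmooth N).choose_spec.1 n

theorem exists_denseSmooth {φ : Torus N → ℝ} (hφ : IsSmooth φ) {ε : ℝ} (hε : 0 < ε) :
    ∃ n, (∀ x, |denseSmooth N n x - φ x| ≤ ε) ∧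
      ∀ i x, |partialX i (denseSmooth N n) x - partialX i φ x| ≤ ε :=
  (exists_dense_isSmooth N).choose_spec.2 φ hφ ε hε

theorem tendsto_integral_mul_of_uniform {f : Torus N → ℝ} (hf : Integrable f)
    {F : ℕ → Torus N → ℝ} {φ : Torus N → ℝ} (hF : ∀ n, Continuous (F n)) (hφ : Continuous φ)
    {ε : ℕ → ℝ} (hε : Tendsto ε atTop (𝓝 0)) (h : ∀ n x, |F n x - φ x| ≤ ε n) :
    Tendsto (fun n => ∫ x, f x * F n x) atTop (𝓝 (∫ x, f x * φ x)) := by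
  have t : TendstoLp volume ⊤ atTop F φ := by
    refine ⟨fun n => memLp_of_continuous (hF n) ⊤, memLp_of_continuous hφ ⊤, ?_⟩
    have hle : ∀ n, eLpNorm (F n - φ) ⊤ volume ≤ ENNReal.ofReal (ε n) := fun n => by
      have := eLpNorm_le_of_ae_bound (p := ⊤) (μ := (volume : Measure (Torus N)))
        (f := F n - φ) (C := ε n) (ae_of_all _ fun x => h n x)
      simpa using this
    have h0 : Tendsto (fun n => ENNReal.ofReal (ε n)) atTop (𝓝 0) := by
      simpa using ENNReal.tendsto_ofReal hε
    exact tendsto_of_tendsto_of_tendsto_of_le_of_le tendsto_const_nhds h0 (fun _ => zero_le) hle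
  have : Fact ((1 : ℝ≥0∞) ≤ ⊤) := ⟨le_top⟩
  exact ((TendstoLp.const (memLp_one_iff_integrable.2 hf)).mul (r := 1) t).integral

theorem wDiv_of_denseSmooth {B : Fin N → Torus N → ℝ} {a : Torus N → ℝ} (ha : Integrable a)
    (hB : ∀ j, Integrable (B j)) (h : ∀ n, ∫ x, a x * denseSmooth N n x
      = ∑ j, ∫ x, B j x * partialX j (denseSmooth N n) x) : WDiv B a := by
  intro φ hφ
  have hε : ∀ k : ℕ, (0 : ℝ) < 1 / ((k : ℝ) + 1) := fun k => by positivity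
  choose n hn hn' using fun k : ℕ => exists_denseSmooth hφ (hε k)
  have h0 := tendsto_one_div_add_atTop_nhds_zero_nat (𝕜 := ℝ)
  have t1 := tendsto_integral_mul_of_uniform ha (fun k => (isSmooth_denseSmooth (n k)).continuous)
    hφ.continuous h0 hn
  have t2 := tendsto_finsetSum Finset.univ fun j _ => tendsto_integral_mul_of_uniform (hB j)
    (fun k => ((isSmooth_denseSmooth (n k)).partialX j).continuous)
    (hφ.partialX j).continuous h0 fun k x => hn' k j x
  rw [integral_finsetSum _ fun j _ => Integrable.mul_isSmooth (hB j) (hφ.partialX j)]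
  exact tendsto_nhds_unique t1 (t2.congr fun k => (h (n k)).symm)

/-- Both sides are continuous in the test function for the `C¹` norm. With countably many tests, the
exceptional times can be collected into one null set. -/
theorem wGrad_of_denseSmooth {g : Fin N → Torus N → ℝ} {f : Torus N → ℝ} (hf : Integrable f)
    (hg : ∀ j, Integrable (g j)) (h : ∀ n j, ∫ x, f x * partialX j (denseSmooth N n) x
      = - ∫ x, g j x * denseSmooth N n x) : WGrad f g := by
  intro φ hφ i
  have hε : ∀ k : ℕ, (0 : ℝ) < 1 / ((k : ℝ) + 1) := fun k => by positivity
  choose n hn hn' using fun k : ℕ => exists_denseSmooth hφ (hε k)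
  have h0 := tendsto_one_div_add_atTop_nhds_zero_nat (𝕜 := ℝ)
  have t1 := tendsto_integral_mul_of_uniform (hg i)
    (fun k => (isSmooth_denseSmooth (n k)).continuous) hφ.continuous h0 hn
  have t2 := tendsto_integral_mul_of_uniform hf
    (fun k => ((isSmooth_denseSmooth (n k)).partialX i).continuous)
    (hφ.partialX i).continuous h0 fun k x => hn' k i x
  exact tendsto_nhds_unique t2 (t1.neg.congr fun k => (h (n k) i).symm)

/-- Mollify first, then approximate the mollification uniformly; the torus has mass one, so a
uniform bound is an `L²` bound. -/
theorem exists_denseSmooth_two {ψ : Torus N → ℝ} (hψ : MemLp ψ 2 volume) {ε : ℝ≥0∞}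
    (hε : ε ≠ 0) : ∃ n, eLpNorm (ψ - denseSmooth N n) 2 volume ≤ ε := by
  have h2 : ε / 2 ≠ 0 := by simp [hε]
  have t := (tendstoLp_moll one_le_two (by simp) hψ).tendsto
  obtain ⟨k, hk⟩ := (ENNReal.tendsto_nhds_zero.1 t (ε / 2) h2.bot_lt).exists
  have sk := isSmooth_moll (integrable_of_memLp_two hψ) k
  obtain ⟨δ, hδ, hδε⟩ : ∃ δ : ℝ, 0 < δ ∧ ENNReal.ofReal δ ≤ ε / 2 := by
    obtain ⟨r, hr, hr'⟩ := ENNReal.lt_iff_exists_nnreal_btwn.1 (pos_iff_ne_zero.2 h2)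
    exact ⟨r, by exact_mod_cast hr, by simpa using hr'.le⟩
  obtain ⟨n, hn, -⟩ := exists_denseSmooth sk hδ
  refine ⟨n, ?_⟩
  have e : ψ - denseSmooth N n = -(moll k ψ - ψ) + (moll k ψ - denseSmooth N n) := by ring
  have sn := isSmooth_denseSmooth (N := N) n
  rw [e]
  refine (eLpNorm_add_le ((sk.memLp 2).sub hψ).neg.1 ((sk.memLp 2).sub (sn.memLp 2)).1
    one_le_two).trans ?_
  rw [eLpNorm_neg, ← ENNReal.add_halves ε]
  refine add_le_add hk (le_trans ?_ hδε)
  have := eLpNorm_le_of_ae_bound (p := 2) (μ := (volume : Measure (Torus N)))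
    (f := moll k ψ - denseSmooth N n) (C := δ) (ae_of_all _ fun x => by
      rw [← norm_neg]; simpa using hn x)
  simpa using this

end WeakDerivatives

/-! ### Equations in `𝒟'((0,T) × 𝕋^N)` on time slices -/

section Slices

variable {N : ℕ} {T : ℝ}

/-- Smooth functions of time with compact support in `(0,T)`. -/
structure IsTimeTest (T : ℝ) (η : ℝ → ℝ) : Prop where
  contDiff : ContDiff ℝ ∞ η
  compact : HasCompactSupport η
  support : tsupport η ⊆ Ioo 0 T

theorem IsTimeTest.exists_Icc {η : ℝ → ℝ} (hT : 0 < T) (h : IsTimeTest T η) :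
    ∃ a b, 0 < a ∧ b < T ∧ a ≤ b ∧ ∀ t, t ∉ Icc a b → η t = 0 := by
  rcases (tsupport η).eq_empty_or_nonempty with he | hne
  · exact ⟨T / 2, T / 2, by linarith, by linarith, le_rfl, fun t _ =>
      image_eq_zero_of_notMem_tsupport (by simp [he])⟩
  · have hK : IsCompact (tsupport η) := h.compact
    obtain ⟨a, ha, ha'⟩ := hK.exists_isLeast hne
    obtain ⟨b, hb, hb'⟩ := hK.exists_isGreatest hne
    refine ⟨a, b, (h.support ha).1, (h.support hb).2, ha' hb, fun t ht => ?_⟩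
    exact image_eq_zero_of_notMem_tsupport fun hm => ht ⟨ha' hm, hb' hm⟩

theorem isTimeTest_of_Icc {η : ℝ → ℝ} (hη : ContDiff ℝ ∞ η) {a b : ℝ} (ha : 0 < a) (hb : b < T)
    (h : ∀ t, t ∉ Icc a b → η t = 0) : IsTimeTest T η := by
  have hs : tsupport η ⊆ Icc a b :=
    closure_minimal (fun t ht => by_contra fun hn => ht (h t hn)) isClosed_Icc
  exact ⟨hη, isCompact_Icc.of_isClosed_subset (isClosed_tsupport η) hs,
    hs.trans fun t ht => ⟨ha.trans_le ht.1, ht.2.trans_lt hb⟩⟩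

theorem IsTimeTest.integral_eq {η : ℝ → ℝ} (hT : 0 < T) (h : IsTimeTest T η) (f : ℝ → ℝ) :
    ∫ t, η t * f t = ∫ t in (0 : ℝ)..T, η t * f t := by
  rw [intervalIntegral.integral_of_le hT.le, integral_Ioc_eq_integral_Ioo,
    setIntegral_eq_integral_of_forall_compl_eq_zero]
  intro t ht
  rw [image_eq_zero_of_notMem_tsupport fun hm => ht (h.support hm), zero_mul]

/-- The primitive from `0` vanishes before the support of `ζ`, and after it because the total
integral is zero. -/
theorem IsTimeTest.exists_primitive {ζ : ℝ → ℝ} (hT : 0 < T) (h : IsTimeTest T ζ)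
    (h0 : ∫ t in (0 : ℝ)..T, ζ t = 0) : ∃ η, IsTimeTest T η ∧ deriv η = ζ := by
  obtain ⟨a, b, ha, hb, hab, hs⟩ := h.exists_Icc hT
  have hc : Continuous ζ := h.contDiff.continuous
  have hd : ∀ t, HasDerivAt (fun t => ∫ s in (0 : ℝ)..t, ζ s) (ζ t) t := fun t =>
    hc.integral_hasStrictDerivAt 0 t |>.hasDerivAt
  have hde : deriv (fun t => ∫ s in (0 : ℝ)..t, ζ s) = ζ := funext fun t => (hd t).deriv
  refine ⟨fun t => ∫ s in (0 : ℝ)..t, ζ s, isTimeTest_of_Icc ?_ ha hb ?_, hde⟩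
  · rw [contDiff_infty_iff_deriv, hde]
    exact ⟨fun t => (hd t).differentiableAt, h.contDiff⟩
  · intro t ht
    rw [mem_Icc, not_and_or, not_le, not_le] at ht
    have hz : ∀ u v, (∀ s ∈ uIcc u v, s ∉ Icc a b ∨ s = a ∨ s = b) →
        ∫ s in u..v, ζ s = 0 := by
      intro u v huv
      refine intervalIntegral.integral_zero_ae ?_
      have : ∀ᵐ s : ℝ, s ≠ a ∧ s ≠ b := by
        have e1 : ∀ᵐ s : ℝ, s ≠ a := by simp [ae_iff]
        have e2 : ∀ᵐ s : ℝ, s ≠ b := by simp [ae_iff]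
        exact e1.and e2
      filter_upwards [this] with s hs1 hs2
      rcases huv s (uIoc_subset_uIcc hs2) with h1 | h1 | h1
      · exact hs s h1
      · exact absurd h1 hs1.1
      · exact absurd h1 hs1.2
    rcases ht with ht | ht
    · refine hz 0 t fun s hs' => Or.inl fun hsI => ?_
      rcases mem_uIcc.1 hs' with h1 | h1
      · linarith [hsI.1, h1.2]
      · linarith [hsI.1, h1.2]
    · have h1 : ∫ s in t..T, ζ s = 0 := by
        refine hz t T fun s hs' => Or.inl fun hsI => ?_
        rcases mem_uIcc.1 hs' with h1 | h1
        · linarith [hsI.2, h1.1]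
        · linarith [hsI.2, h1.1]
      have h2 := intervalIntegral.integral_add_adjacent_intervals
        (hc.intervalIntegrable (μ := volume) 0 t) (hc.intervalIntegrable (μ := volume) t T)
      linarith

/-- The du Bois-Reymond lemma. -/
theorem exists_const_add_integral (hT : 0 < T) {a b : ℝ → ℝ} (ha : IntegrableOn a (Ioo 0 T))
    (hb : IntegrableOn b (Ioo 0 T))
    (h : ∀ η, IsTimeTest T η → ∫ t in Ioo 0 T, (a t * deriv η t + b t * η t) = 0) :
    ∃ c, ∀ᵐ t ∂(volume.restrict (Ioo 0 T)), a t = c + ∫ s in (0 : ℝ)..t, b s := by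
  have hbi : IntervalIntegrable b volume 0 T :=
    (intervalIntegrable_iff_integrableOn_Ioo_of_le hT.le).2 hb
  have hai : IntervalIntegrable a volume 0 T :=
    (intervalIntegrable_iff_integrableOn_Ioo_of_le hT.le).2 ha
  -- Subtracting a primitive of `b` reduces the claim to this: a function that annihilates the
  -- derivatives of all test functions is constant.
  set β : ℝ → ℝ := fun t => ∫ s in (0 : ℝ)..t, b s with hβ
  have hβc : ContinuousOn β (uIcc 0 T) := intervalIntegral.continuousOn_primitive_interval
    (by rw [uIcc_of_le hT.le, integrableOn_Icc_iff_integrableOn_Ioo]; exact hb)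
  have hβi : IntervalIntegrable β volume 0 T := hβc.intervalIntegrable
  have hβac : AbsolutelyContinuousOnInterval β 0 T :=
    hbi.absolutelyContinuousOnInterval_intervalIntegral (by simp)
  have key : ∀ η, IsTimeTest T η → ∫ t in (0 : ℝ)..T, deriv η t * (a t - β t) = 0 := by
    intro η hη
    have hηd : ContDiff ℝ ∞ (deriv η) := (contDiff_infty_iff_deriv.1 hη.contDiff).2
    have h1 := h η hη
    rw [← integral_Ioc_eq_integral_Ioo, ← intervalIntegral.integral_of_le hT.le] at h1
    have i1 : IntervalIntegrable (fun t => a t * deriv η t) volume 0 T :=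
      hai.mul_continuousOn hηd.continuous.continuousOn
    have i2 : IntervalIntegrable (fun t => b t * η t) volume 0 T :=
      hbi.mul_continuousOn hη.contDiff.continuous.continuousOn
    have i3 : IntervalIntegrable (fun t => deriv η t * a t) volume 0 T :=
      hai.continuousOn_mul hηd.continuous.continuousOn
    have i4 : IntervalIntegrable (fun t => deriv η t * β t) volume 0 T :=
      hβi.continuousOn_mul hηd.continuous.continuousOn
    rw [intervalIntegral.integral_add i1 i2] at h1
    have hηac : AbsolutelyContinuousOnInterval η 0 T :=
      (hη.contDiff.of_le (by simp)).contDiffOn.absolutelyContinuousOnInterval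
    have h2 := hηac.integral_mul_deriv_eq_deriv_mul hβac
    have z0 : η 0 = 0 := image_eq_zero_of_notMem_tsupport fun hm => lt_irrefl _ (hη.support hm).1
    have zT : η T = 0 := image_eq_zero_of_notMem_tsupport fun hm => lt_irrefl _ (hη.support hm).2
    have h3 : ∫ t in (0 : ℝ)..T, η t * deriv β t = ∫ t in (0 : ℝ)..T, b t * η t := by
      refine intervalIntegral.integral_congr_ae ?_
      filter_upwards [hbi.ae_hasDerivAt_integral] with t ht htI
      rw [(ht (uIoc_subset_uIcc htI) 0 (by simp)).deriv, mul_comm]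
    simp_rw [mul_sub]
    rw [intervalIntegral.integral_sub i3 i4]
    simp_rw [mul_comm (deriv η _) (a _)]
    rw [h3, z0, zT] at h2
    linarith
  -- A fixed test function of unit mass; the sought constant is the pairing of `a - β` with it.
  obtain ⟨ξ, hξ, hξ1⟩ : ∃ ξ, IsTimeTest T ξ ∧ ∫ t in (0 : ℝ)..T, ξ t = 1 := by
    let f : ContDiffBump (T / 2) := ⟨T / 8, T / 4, by linarith, by linarith⟩
    have hξ : IsTimeTest T (f.normed volume) := by
      refine isTimeTest_of_Icc (a := T / 4) (b := 3 * T / 4) f.contDiff_normed (by linarith)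
        (by linarith) fun t ht => ?_
      by_contra hne
      have : t ∈ Function.support (f.normed volume) := hne
      rw [f.support_normed_eq, Real.ball_eq_Ioo] at this
      refine ht ⟨?_, ?_⟩
      · have h1 : T / 2 - T / 4 < t := this.1
        linarith
      · have h1 : t < T / 2 + T / 4 := this.2
        linarith
    refine ⟨_, hξ, ?_⟩
    have := hξ.integral_eq hT (fun _ => 1)
    simp only [mul_one] at this
    rw [← this, f.integral_normed]
  set c := ∫ t in (0 : ℝ)..T, ξ t * (a t - β t) with hcdef
  refine ⟨c, ?_⟩
  have hai' := hai.sub hβi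
  have hloc : LocallyIntegrableOn (fun t => a t - β t - c) (Ioo 0 T) volume := by
    have : IntegrableOn (fun t => a t - β t - c) (Ioo 0 T) :=
      (intervalIntegrable_iff_integrableOn_Ioo_of_le hT.le).1 (hai'.sub intervalIntegrable_const)
    exact this.locallyIntegrableOn
  have hz := isOpen_Ioo.ae_eq_zero_of_integral_contDiff_smul_eq_zero hloc (fun g hg1 hg2 hg3 => by
    have hg : IsTimeTest T g := ⟨hg1, hg2, hg3⟩
    set m := ∫ t in (0 : ℝ)..T, g t with hm
    -- Removing `m` times the unit bump leaves a test function of mean zero, which is the derivative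
    -- of another one.
    have hζ : IsTimeTest T (fun t => g t - m * ξ t) := by
      obtain ⟨a1, b1, h1, h2, -, h3⟩ := hg.exists_Icc hT
      obtain ⟨a2, b2, h1', h2', -, h3'⟩ := hξ.exists_Icc hT
      refine isTimeTest_of_Icc (a := min a1 a2) (b := max b1 b2)
        (hg1.sub (contDiff_const.mul hξ.contDiff)) (lt_min h1 h1') (max_lt h2 h2') fun t ht => ?_
      rw [h3 t fun hh => ht ⟨(min_le_left _ _).trans hh.1, hh.2.trans (le_max_left _ _)⟩,
        h3' t fun hh => ht ⟨(min_le_right _ _).trans hh.1, hh.2.trans (le_max_right _ _)⟩]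
      simp
    have cg := hg1.continuous
    have cξ := hξ.contDiff.continuous
    obtain ⟨η, hη, hηd⟩ := hζ.exists_primitive hT (by
      rw [intervalIntegral.integral_sub (cg.intervalIntegrable _ _)
        ((cξ.intervalIntegrable _ _).const_mul m), intervalIntegral.integral_const_mul,
        hξ1, ← hm]
      ring)
    have h1 := key η hη
    rw [hηd] at h1
    have i1 : IntervalIntegrable (fun t => g t * (a t - β t)) volume 0 T :=
      hai'.continuousOn_mul cg.continuousOn
    have i2 : IntervalIntegrable (fun t => ξ t * (a t - β t)) volume 0 T :=
      hai'.continuousOn_mul cξ.continuousOn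
    simp_rw [sub_mul, mul_assoc] at h1
    rw [intervalIntegral.integral_sub i1 (i2.const_mul m), intervalIntegral.integral_const_mul,
      ← hcdef] at h1
    simp only [smul_eq_mul]
    rw [hg.integral_eq hT]
    simp_rw [mul_sub (g _) _ c]
    rw [intervalIntegral.integral_sub i1 ((cg.intervalIntegrable _ _).mul_const c),
      intervalIntegral.integral_mul_const, ← hm]
    exact h1)
  rw [ae_restrict_iff' measurableSet_Ioo]
  filter_upwards [hz] with t ht htI
  have := ht htI
  linarith

/-! ### Test functions that split into a time and a space factor -/

theorem isTestFunction_mul (hT : 0 < T) {η : ℝ → ℝ} (hη : IsTimeTest T η) {ψ : Torus N → ℝ}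
    (hψ : IsSmooth ψ) : IsTestFunction T (fun t x => η t * ψ x) := by
  refine ⟨(hη.contDiff.comp contDiff_fst).mul
    (ContDiff.comp (g := fun y : Fin N → ℝ => ψ (cover y)) hψ contDiff_snd), ?_⟩
  obtain ⟨a, b, ha, hb, -, h⟩ := hη.exists_Icc hT
  exact ⟨a, b, ha, hb, fun t ht x => by rw [h t ht, zero_mul]⟩

theorem partialX_const_mul (c : ℝ) {ψ : Torus N → ℝ} (hψ : IsSmooth ψ) (i : Fin N)
    (x : Torus N) : partialX i (fun x => c * ψ x) x = c * partialX i ψ x :=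
  ((hψ.hasDerivAt_zero i x).const_mul c).deriv

theorem partialT_mul {η : ℝ → ℝ} (hη : ContDiff ℝ ∞ η) (ψ : Torus N → ℝ) (t : ℝ) (x : Torus N) :
    partialT (fun t x => η t * ψ x) t x = deriv η t * ψ x :=
  ((hη.differentiable (by simp) t).hasDerivAt.mul_const (ψ x)).deriv

instance : IsFiniteMeasure (spaceTime N T) := by unfold spaceTime; infer_instance

theorem integrable_slice_mul {f : ℝ → Torus N → ℝ}
    (hf : Integrable (Function.uncurry f) (spaceTime N T)) {ψ : Torus N → ℝ} (hψ : IsSmooth ψ) :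
    Integrable (fun z : ℝ × Torus N => f z.1 z.2 * ψ z.2) (spaceTime N T) := by
  obtain ⟨C, hC⟩ := hψ.exists_bound
  exact hf.mul_bdd (c := C) hψ.continuous.aestronglyMeasurable.comp_snd
    (Eventually.of_forall fun z => hC z.2)

theorem integral_test_mul {f : ℝ → Torus N → ℝ}
    (hf : Integrable (Function.uncurry f) (spaceTime N T)) {ψ : Torus N → ℝ} (hψ : IsSmooth ψ)
    {η : ℝ → ℝ} (hη : Continuous η) (hb : ∃ C, ∀ t, ‖η t‖ ≤ C) :
    Integrable (fun z : ℝ × Torus N => f z.1 z.2 * (η z.1 * ψ z.2)) (spaceTime N T) ∧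
    ∫ z, f z.1 z.2 * (η z.1 * ψ z.2) ∂(spaceTime N T)
      = ∫ t in Ioo 0 T, η t * ∫ x, f t x * ψ x := by
  obtain ⟨C, hC⟩ := hb
  have h1 : Integrable (fun z : ℝ × Torus N => f z.1 z.2 * ψ z.2 * η z.1) (spaceTime N T) :=
    (integrable_slice_mul hf hψ).mul_bdd (c := C) hη.aestronglyMeasurable.comp_fst
      (Eventually.of_forall fun z => hC z.1)
  have e : (fun z : ℝ × Torus N => f z.1 z.2 * (η z.1 * ψ z.2))
      = fun z => f z.1 z.2 * ψ z.2 * η z.1 := by ext z; ring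
  rw [e]
  refine ⟨h1, ?_⟩
  rw [spaceTime, integral_prod _ h1]
  simp_rw [integral_mul_const, mul_comm]

theorem IsTimeTest.bounded {η : ℝ → ℝ} (h : IsTimeTest T η) : ∃ C, ∀ t, ‖η t‖ ≤ C :=
  h.compact.exists_bound_of_continuous h.contDiff.continuous

theorem IsTimeTest.deriv {η : ℝ → ℝ} (h : IsTimeTest T η) : IsTimeTest T (deriv η) :=
  ⟨(contDiff_infty_iff_deriv.1 h.contDiff).2, h.compact.deriv,
    (tsupport_deriv_subset (f := η)).trans h.support⟩

theorem integrable_slice {f : ℝ → Torus N → ℝ}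
    (hf : Integrable (Function.uncurry f) (spaceTime N T)) {ψ : Torus N → ℝ} (hψ : IsSmooth ψ) :
    IntegrableOn (fun t => ∫ x, f t x * ψ x) (Ioo 0 T) :=
  (integrable_slice_mul hf hψ).integral_prod_left

/-- A conservation law in `𝒟'((0,T) × 𝕋^N)`, tested with a function of space. -/
theorem exists_slice_of_div (hT : 0 < T) {F : ℝ → Torus N → ℝ} {G : Fin N → ℝ → Torus N → ℝ}
    (hF : Integrable (Function.uncurry F) (spaceTime N T))
    (hG : ∀ j, Integrable (Function.uncurry (G j)) (spaceTime N T))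
    (h : ∀ φ, IsTestFunction T φ → ∫ z, (F z.1 z.2 * partialT φ z.1 z.2
      + ∑ j, G j z.1 z.2 * partialX j (φ z.1) z.2) ∂(spaceTime N T) = 0)
    {ψ : Torus N → ℝ} (hψ : IsSmooth ψ) :
    ∃ c, ∀ᵐ t ∂(volume.restrict (Ioo 0 T)), ∫ x, F t x * ψ x
      = c + ∫ s in (0 : ℝ)..t, ∑ j, ∫ x, G j s x * partialX j ψ x := by
  refine exists_const_add_integral hT (integrable_slice hF hψ)
    (integrable_finsetSum _ fun j _ => integrable_slice (hG j) (hψ.partialX j)) fun η hη => ?_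
  have h1 := h _ (isTestFunction_mul hT hη hψ)
  simp_rw [partialT_mul hη.contDiff, partialX_const_mul _ hψ] at h1
  obtain ⟨iF, eF⟩ := integral_test_mul hF hψ hη.deriv.contDiff.continuous hη.deriv.bounded
  have hGj := fun j => integral_test_mul (hG j) (hψ.partialX j) hη.contDiff.continuous hη.bounded
  rw [integral_add iF (integrable_finsetSum _ fun j _ => (hGj j).1),
    integral_finsetSum _ fun j _ => (hGj j).1, eF] at h1
  simp_rw [fun j => (hGj j).2] at h1
  obtain ⟨C, hC⟩ := hη.bounded
  obtain ⟨C', hC'⟩ := hη.deriv.bounded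
  have i1 : IntegrableOn (fun t => (∫ x, F t x * ψ x) * _root_.deriv η t) (Ioo 0 T) :=
    (integrable_slice hF hψ).mul_bdd hη.deriv.contDiff.continuous.aestronglyMeasurable
      (Eventually.of_forall hC')
  have i2 : ∀ j, IntegrableOn (fun t => (∫ x, G j t x * partialX j ψ x) * η t) (Ioo 0 T) :=
    fun j => (integrable_slice (hG j) (hψ.partialX j)).mul_bdd
      hη.contDiff.continuous.aestronglyMeasurable (Eventually.of_forall hC)
  simp_rw [Finset.sum_mul]
  rw [integral_add i1 (integrable_finsetSum _ fun j _ => i2 j), integral_finsetSum _ fun j _ => i2 j]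
  simp_rw [mul_comm _ (η _), mul_comm _ (_root_.deriv η _)]
  exact h1

/-- A spatial gradient in `𝒟'((0,T) × 𝕋^N)` is a gradient on almost every time slice. -/
theorem wGrad_slice (hT : 0 < T) {f : ℝ → Torus N → ℝ} {g : Fin N → ℝ → Torus N → ℝ}
    (hf : Integrable (Function.uncurry f) (spaceTime N T))
    (hg : ∀ j, Integrable (Function.uncurry (g j)) (spaceTime N T))
    (h : ∀ φ, IsTestFunction T φ → ∀ i, ∫ z, f z.1 z.2 * partialX i (φ z.1) z.2 ∂(spaceTime N T)
      = - ∫ z, g i z.1 z.2 * φ z.1 z.2 ∂(spaceTime N T)) :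
    ∀ᵐ t ∂(volume.restrict (Ioo 0 T)), WGrad (f t) fun j => g j t := by
  have key : ∀ ψ : Torus N → ℝ, IsSmooth ψ → ∀ i, ∀ᵐ t ∂(volume.restrict (Ioo 0 T)),
      ∫ x, f t x * partialX i ψ x = - ∫ x, g i t x * ψ x := by
    intro ψ hψ i
    have i1 := integrable_slice hf (hψ.partialX i)
    have i2 := integrable_slice (hg i) hψ
    have hz := isOpen_Ioo.ae_eq_zero_of_integral_contDiff_smul_eq_zero
      (IntegrableOn.locallyIntegrableOn (i1.add i2)) fun η h1 h2 h3 => by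
        have hη : IsTimeTest T η := ⟨h1, h2, h3⟩
        have h4 := h _ (isTestFunction_mul hT hη hψ) i
        simp_rw [partialX_const_mul _ hψ] at h4
        rw [(integral_test_mul hf (hψ.partialX i) h1.continuous hη.bounded).2,
          (integral_test_mul (hg i) hψ h1.continuous hη.bounded).2] at h4
        rw [← setIntegral_eq_integral_of_forall_compl_eq_zero (s := Ioo 0 T) fun t ht => by
          rw [image_eq_zero_of_notMem_tsupport fun hm => ht (h3 hm), zero_smul]]
        obtain ⟨C, hC⟩ := hη.bounded
        have j1 : IntegrableOn (fun t => η t * ∫ x, f t x * partialX i ψ x) (Ioo 0 T) :=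
          i1.bdd_mul h1.continuous.aestronglyMeasurable (Eventually.of_forall hC)
        have j2 : IntegrableOn (fun t => η t * ∫ x, g i t x * ψ x) (Ioo 0 T) :=
          i2.bdd_mul h1.continuous.aestronglyMeasurable (Eventually.of_forall hC)
        simp only [Pi.add_apply, smul_eq_mul, mul_add]
        rw [integral_add j1 j2, h4]
        ring
    rw [ae_restrict_iff' measurableSet_Ioo]
    filter_upwards [hz] with t ht htI
    have := ht htI
    simp only [Pi.add_apply] at this
    linarith
  have h1 : ∀ᵐ t ∂(volume.restrict (Ioo 0 T)), ∀ n j, ∫ x, f t x * partialX j (denseSmooth N n) x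
      = - ∫ x, g j t x * denseSmooth N n x :=
    ae_all_iff.2 fun n => ae_all_iff.2 fun j => key _ (isSmooth_denseSmooth n) j
  have h2 : ∀ᵐ t ∂(volume.restrict (Ioo 0 T)), Integrable (f t) := hf.prod_right_ae
  have h3 : ∀ᵐ t ∂(volume.restrict (Ioo 0 T)), ∀ j, Integrable (g j t) :=
    ae_all_iff.2 fun j => (hg j).prod_right_ae
  filter_upwards [h1, h2, h3] with t ht1 ht2 ht3
  exact wGrad_of_denseSmooth ht2 ht3 ht1

end Slices

/-! ### Weakly continuous curves in `L²` -/

section WeakCurves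

variable {N : ℕ} {T : ℝ}

theorem abs_integral_mul_le {α : Type*} [MeasurableSpace α] {μ : Measure α} {f g : α → ℝ}
    (hf : MemLp f 2 μ) (hg : MemLp g 2 μ) :
    |∫ x, f x * g x ∂μ| ≤ (eLpNorm f 2 μ).toReal * (eLpNorm g 2 μ).toReal := by
  have h1 := enorm_integral_le_lintegral_enorm (μ := μ) fun x => f x * g x
  rw [← eLpNorm_one_eq_lintegral_enorm] at h1
  have h2 := h1.trans (eLpNorm_mul_le (p := 2) (q := 2) hf.1 hg.1)
  have h3 := ENNReal.toReal_mono (ENNReal.mul_ne_top hf.2.ne hg.2.ne) h2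
  rwa [ENNReal.toReal_mul, toReal_enorm] at h3

/-- Times in `(0,T)` near `t`, up to null sets. -/
def nearTimes (T t : ℝ) : Filter ℝ := 𝓝[Ioo 0 T] t ⊓ ae volume

/-- An open neighbourhood of `t` meets `(0, T)` in a nonempty open set, which has positive measure.
The endpoints are included because they lie in the closure; limits along this filter are how
almost-everywhere information reaches each single time. -/
theorem nearTimes_neBot (hT : 0 < T) {t : ℝ} (ht : t ∈ Icc 0 T) : (nearTimes T t).NeBot := by
  rw [nearTimes, inf_neBot_iff]
  intro s hs s' hs'
  obtain ⟨U, hU, htU, hUs⟩ := mem_nhdsWithin.1 hs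
  have hne : (U ∩ Ioo 0 T).Nonempty := by
    have : t ∈ closure (Ioo 0 T) := by rwa [closure_Ioo hT.ne]
    exact mem_closure_iff.1 this U hU htU
  have hpos := (hU.inter isOpen_Ioo).measure_pos volume hne
  by_contra hempty
  have hsub : s ⊆ s'ᶜ := fun x hx hx' => hempty ⟨x, hx, hx'⟩
  have : volume (U ∩ Ioo 0 T) ≤ 0 := (measure_mono (hUs.trans hsub)).trans (le_of_eq hs')
  exact absurd hpos (not_lt.2 this)

theorem eventually_nearTimes {p : ℝ → Prop} (h : ∀ᵐ s ∂(volume.restrict (Ioo 0 T)), p s) (t : ℝ) :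
    ∀ᶠ s in nearTimes T t, p s := by
  rw [ae_restrict_iff' measurableSet_Ioo] at h
  have h1 : ∀ᶠ s in nearTimes T t, s ∈ Ioo 0 T :=
    (eventually_mem_nhdsWithin (a := t) (s := Ioo 0 T)).filter_mono inf_le_left
  filter_upwards [h1, h.filter_mono inf_le_right] with s hs1 hs2
  exact hs2 hs1

theorem tendsto_nearTimes {X : Type*} [TopologicalSpace X] {f : ℝ → X}
    (h : ContinuousOn f (Icc 0 T)) {t : ℝ} (ht : t ∈ Icc 0 T) :
    Tendsto f (nearTimes T t) (𝓝 (f t)) :=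
  ((h t ht).mono Ioo_subset_Icc_self).tendsto.mono_left inf_le_left

/-- Replacing `ψ` by a nearby member of the dense family changes the moment by at most `C` times
their `L²` distance, uniformly in time. -/
theorem continuousOn_of_denseSmooth {W : ℝ → Torus N → ℝ} {C : ℝ} (hC : 0 ≤ C)
    (hW : ∀ t ∈ Icc 0 T, MemLp (W t) 2 volume)
    (hWC : ∀ t ∈ Icc 0 T, eLpNorm (W t) 2 volume ≤ ENNReal.ofReal C)
    (h : ∀ n, ContinuousOn (fun t => ∫ x, W t x * denseSmooth N n x) (Icc 0 T))
    {ψ : Torus N → ℝ} (hψ : MemLp ψ 2 volume) :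
    ContinuousOn (fun t => ∫ x, W t x * ψ x) (Icc 0 T) := by
  refine continuousOn_of_uniform_approx_of_continuousOn fun U hU => ?_
  obtain ⟨ε, hε, hεU⟩ := Metric.mem_uniformity_dist.1 hU
  obtain ⟨n, hn⟩ := exists_denseSmooth_two hψ (ε := ENNReal.ofReal (ε / (2 * (C + 1))))
    (by simpa using by positivity)
  refine ⟨_, h n, fun t ht => hεU ?_⟩
  have hd := (isSmooth_denseSmooth (N := N) n).memLp 2
  rw [Real.dist_eq, ← integral_sub (integrable_mul_two (hW t ht) hψ)
    (integrable_mul_two (hW t ht) hd)]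
  simp_rw [← mul_sub]
  refine (abs_integral_mul_le (hW t ht) (hψ.sub hd)).trans_lt ?_
  have h1 : (eLpNorm (W t) 2 volume).toReal ≤ C := ENNReal.toReal_le_of_le_ofReal hC (hWC t ht)
  have h2 : (eLpNorm (ψ - denseSmooth N n) 2 volume).toReal ≤ ε / (2 * (C + 1)) :=
    ENNReal.toReal_le_of_le_ofReal (by positivity) hn
  calc _ ≤ C * (ε / (2 * (C + 1))) := mul_le_mul h1 h2 ENNReal.toReal_nonneg hC
    _ < ε := by
      rw [← mul_div_assoc, div_lt_iff₀ (by positivity)]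
      nlinarith

/-- An element of `L²` obtained as a weak limit. -/
theorem exists_weak_limit {ι : Type*} {l : Filter ι} [l.NeBot] {w : ι → Torus N → ℝ} {C : ℝ}
    (hC : 0 ≤ C) (hw : ∀ᶠ s in l, MemLp (w s) 2 volume)
    (hwC : ∀ᶠ s in l, eLpNorm (w s) 2 volume ≤ ENNReal.ofReal C) {m : ℕ → ℝ}
    (hm : ∀ n, Tendsto (fun s => ∫ x, w s x * denseSmooth N n x) l (𝓝 (m n))) :
    ∃ W : Torus N → ℝ, MemLp W 2 volume ∧ eLpNorm W 2 volume ≤ ENNReal.ofReal C ∧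
      ∀ n, ∫ x, W x * denseSmooth N n x = m n := by
  classical
  let H := Lp ℝ 2 (volume : Measure (Torus N))
  let e : ι → H := fun s => if h : MemLp (w s) 2 volume then h.toLp (w s) else 0
  -- By Riesz, the family becomes functionals that eventually lie in a closed ball, which is weak-*
  -- compact. An ultrafilter finer than `l` therefore has a limit, and the prescribed moments
  -- determine its values on the dense family.
  let ℓ : ι → WeakDual ℝ H := fun s => StrongDual.toWeakDual (InnerProductSpace.toDual ℝ H (e s))
  have hinner : ∀ (a b : Torus N → ℝ) (ha : MemLp a 2 volume) (hb : MemLp b 2 volume),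
      inner ℝ (ha.toLp a) (hb.toLp b) = ∫ x, a x * b x := by
    intro a b ha hb
    rw [L2.inner_def]
    refine integral_congr_ae ?_
    filter_upwards [ha.coeFn_toLp, hb.coeFn_toLp] with x h1 h2
    rw [h1, h2]
    simp [mul_comm]
  let V := Ultrafilter.of l
  have hV : (V : Filter ι) ≤ l := Ultrafilter.of_le l
  have hcomp := WeakDual.isCompact_closedBall (𝕜 := ℝ) (E := H) 0 C
  have hmem : ∀ᶠ s in l, ℓ s ∈ WeakDual.toStrongDual ⁻¹' Metric.closedBall (0 : StrongDual ℝ H) C := by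
    filter_upwards [hw, hwC] with s h1 h2
    have : ‖InnerProductSpace.toDual ℝ H (e s)‖ ≤ C := by
      rw [LinearIsometryEquiv.norm_map]
      rw [show e s = h1.toLp (w s) from dif_pos h1, Lp.norm_toLp]
      exact ENNReal.toReal_le_of_le_ofReal hC h2
    simpa [ℓ] using this
  obtain ⟨L, hL, hVL⟩ := isCompact_iff_ultrafilter_le_nhds.1 hcomp (V.map ℓ)
    (by rw [le_principal_iff]; exact hV hmem)
  have hLt : Tendsto ℓ V (𝓝 L) := hVL
  set W : H := (InnerProductSpace.toDual ℝ H).symm (WeakDual.toStrongDual L) with hWdef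
  refine ⟨W, Lp.memLp W, ?_, fun n => ?_⟩
  · have h1 : ‖W‖ ≤ C := by
      rw [hWdef, LinearIsometryEquiv.norm_map]
      simpa using hL
    rw [Lp.norm_def] at h1
    exact (ENNReal.le_ofReal_iff_toReal_le (Lp.eLpNorm_ne_top W) hC).2 h1
  · have hd := (isSmooth_denseSmooth (N := N) n).memLp 2
    have h1 : Tendsto (fun s => ℓ s (hd.toLp _)) V (𝓝 (L (hd.toLp _))) :=
      ((WeakDual.eval_continuous _).tendsto L).comp hLt
    have h2 : Tendsto (fun s => ℓ s (hd.toLp _)) V (𝓝 (m n)) := by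
      refine ((hm n).mono_left hV).congr' (hV ?_)
      filter_upwards [hw] with s hs
      have : ℓ s (hd.toLp _) = inner ℝ (e s) (hd.toLp _) := rfl
      rw [this]
      simp only [e, dif_pos hs]
      exact (hinner _ _ hs hd).symm
    have h3 := tendsto_nhds_unique h2 h1
    have h4 : L (hd.toLp _) = inner ℝ W (hd.toLp _) := by
      rw [hWdef, InnerProductSpace.toDual_symm_apply]
      rfl
    rw [h3, h4, ← hinner _ _ (Lp.memLp W) hd, Lp.toLp_coeFn]

theorem ae_eq_of_denseSmooth {f g : Torus N → ℝ} (hf : MemLp f 2 volume) (hg : MemLp g 2 volume)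
    (h : ∀ n, ∫ x, f x * denseSmooth N n x = ∫ x, g x * denseSmooth N n x) :
    f =ᵐ[volume] g := by
  have hfg := integrable_of_memLp_two (hf.sub hg)
  have hd := fun n => (isSmooth_denseSmooth (N := N) n).memLp 2
  -- With zero flux, this says exactly that `f - g` is orthogonal to every smooth function.
  have hw : WDiv (fun _ _ => 0) (f - g) := by
    refine wDiv_of_denseSmooth hfg (fun j => integrable_zero _ _ _) fun n => ?_
    simp only [Pi.sub_apply, sub_mul, zero_mul, integral_zero, Finset.sum_const_zero]
    rw [integral_sub (integrable_mul_two hf (hd n)) (integrable_mul_two hg (hd n)), h n, sub_self]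
  have := ae_eq_zero_of_forall_isSmooth hfg fun φ hφ => by simpa using hw φ hφ
  filter_upwards [this] with x hx
  simpa [sub_eq_zero] using hx

/-- A bounded curve in `L²` with continuous moments agrees almost everywhere with a weakly
continuous curve. -/
theorem exists_weak_curve (hT : 0 < T) {w : ℝ → Torus N → ℝ} {C : ℝ} (hC : 0 ≤ C)
    (hw : ∀ᵐ t ∂(volume.restrict (Ioo 0 T)), MemLp (w t) 2 volume)
    (hwC : ∀ᵐ t ∂(volume.restrict (Ioo 0 T)), eLpNorm (w t) 2 volume ≤ ENNReal.ofReal C)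
    {m : ℕ → ℝ → ℝ} (hm : ∀ n, ContinuousOn (m n) (Icc 0 T))
    (h : ∀ n, ∀ᵐ t ∂(volume.restrict (Ioo 0 T)), ∫ x, w t x * denseSmooth N n x = m n t) :
    ∃ W : ℝ → Torus N → ℝ, (∀ t ∈ Icc 0 T, MemLp (W t) 2 volume) ∧
      (∀ ψ : Torus N → ℝ, MemLp ψ 2 volume →
        ContinuousOn (fun t => ∫ x, W t x * ψ x) (Icc 0 T)) ∧
      ∀ᵐ t ∂(volume.restrict (Ioo 0 T)), w t =ᵐ[volume] W t := by
  have key : ∀ t, ∃ W : Torus N → ℝ, t ∈ Icc 0 T → (MemLp W 2 volume ∧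
      eLpNorm W 2 volume ≤ ENNReal.ofReal C ∧ ∀ n, ∫ x, W x * denseSmooth N n x = m n t) := by
    intro t
    by_cases ht : t ∈ Icc 0 T
    · have := nearTimes_neBot hT ht
      obtain ⟨W, hW⟩ := exists_weak_limit hC (eventually_nearTimes hw t)
        (eventually_nearTimes hwC t) (m := fun n => m n t) fun n =>
          (tendsto_nearTimes (hm n) ht).congr' (by
            filter_upwards [eventually_nearTimes (h n) t] with s hs using hs.symm)
      exact ⟨W, fun _ => hW⟩
    · exact ⟨0, fun h => absurd h ht⟩
  choose W hW using key
  refine ⟨W, fun t ht => (hW t ht).1, fun ψ hψ => ?_, ?_⟩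
  · exact continuousOn_of_denseSmooth hC (fun t ht => (hW t ht).1) (fun t ht => (hW t ht).2.1)
      (fun n => (hm n).congr fun t ht => (hW t ht).2.2 n) hψ
  · filter_upwards [hw, ae_all_iff.2 h, ae_restrict_mem measurableSet_Ioo] with t h1 h2 h3
    have h4 := hW t (Ioo_subset_Icc_self h3)
    exact ae_eq_of_denseSmooth h1 h4.1 fun n => (h2 n).trans (h4.2.2 n).symm

/-- Bounds at almost every time persist at every time for weakly continuous curves. -/
theorem ae_mem_Icc_of_weak (hT : 0 < T) {W : ℝ → Torus N → ℝ} {a b : ℝ}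
    (hW : ∀ t ∈ Icc 0 T, MemLp (W t) 2 volume)
    (hc : ∀ ψ : Torus N → ℝ, MemLp ψ 2 volume →
        ContinuousOn (fun t => ∫ x, W t x * ψ x) (Icc 0 T))
    (hab : ∀ᵐ t ∂(volume.restrict (Ioo 0 T)), ∀ᵐ x, W t x ∈ Icc a b) {t : ℝ}
    (ht : t ∈ Icc 0 T) : ∀ᵐ x, W t x ∈ Icc a b := by
  have hne := nearTimes_neBot hT ht
  -- Testing with indicators: integrals over a fixed measurable set pass to the limit in time, and
  -- bounds on all of them give pointwise bounds.
  have hset : ∀ s : Set (Torus N), MeasurableSet s →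
      a * volume.real s ≤ ∫ x in s, W t x ∧ ∫ x in s, W t x ≤ b * volume.real s := by
    intro s hs
    have hψ : MemLp (s.indicator fun _ => (1 : ℝ)) 2 (volume : Measure (Torus N)) :=
      memLp_indicator_const 2 hs 1 (Or.inr (measure_ne_top _ _))
    have e : ∀ τ, ∫ x, W τ x * s.indicator (fun _ => (1 : ℝ)) x = ∫ x in s, W τ x := by
      intro τ
      rw [← integral_indicator hs]
      congr 1
      ext x
      by_cases hx : x ∈ s <;> simp [hx]
    have h1 := tendsto_nearTimes (hc _ hψ) ht
    simp_rw [e] at h1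
    have h2 : ∀ᶠ τ in nearTimes T t, τ ∈ Ioo 0 T :=
      eventually_nearTimes (ae_restrict_mem measurableSet_Ioo) t
    have h3 : ∀ c : ℝ, ∫ _ in s, c = c * volume.real s := fun c => by
      rw [setIntegral_const, smul_eq_mul, mul_comm]
    constructor
    · refine ge_of_tendsto h1 ?_
      filter_upwards [eventually_nearTimes hab t, h2] with τ h4 h5
      rw [← h3]
      exact setIntegral_mono_ae (integrable_const a).integrableOn
        (integrable_of_memLp_two (hW τ (Ioo_subset_Icc_self h5))).integrableOn
        (h4.mono fun x hx => hx.1)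
    · refine le_of_tendsto h1 ?_
      filter_upwards [eventually_nearTimes hab t, h2] with τ h4 h5
      rw [← h3]
      exact setIntegral_mono_ae
        (integrable_of_memLp_two (hW τ (Ioo_subset_Icc_self h5))).integrableOn
        (integrable_const b).integrableOn (h4.mono fun x hx => hx.2)
  have hi := integrable_of_memLp_two (hW t ht)
  have l1 := ae_le_of_forall_setIntegral_le (integrable_const a) hi fun s hs _ => by
    rw [setIntegral_const, smul_eq_mul, mul_comm]
    exact (hset s hs).1
  have l2 := ae_le_of_forall_setIntegral_le hi (integrable_const b) fun s hs _ => by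
    rw [setIntegral_const, smul_eq_mul, mul_comm]
    exact (hset s hs).2
  filter_upwards [l1, l2] with x h1 h2 using ⟨h1, h2⟩

end WeakCurves

/-! ### Mixed Lebesgue spaces -/

section Mixed

variable {N : ℕ} {T : ℝ} {E : Type*} [NormedAddCommGroup E]

theorem lintegral_rpow_eLpNorm {X : Type*} [MeasurableSpace X] {μ : Measure X} {f : X → E} {p : ℝ}
    (hp : 0 < p) : eLpNorm f (ENNReal.ofReal p) μ ^ p = ∫⁻ x, ‖f x‖ₑ ^ p ∂μ := by
  rw [eLpNorm_eq_lintegral_rpow_enorm_toReal (by simpa using hp) ENNReal.ofReal_ne_top,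
    ENNReal.toReal_ofReal hp.le, ← ENNReal.rpow_mul, one_div_mul_cancel hp.ne', ENNReal.rpow_one]

theorem memLp_spaceTime_iff {f : ℝ → Torus N → E} {p : ℝ} (hp : 0 < p)
    (hf : AEStronglyMeasurable (Function.uncurry f) (spaceTime N T)) :
    MemLp (Function.uncurry f) (ENNReal.ofReal p) (spaceTime N T) ↔
      ∫⁻ t in Ioo 0 T, eLpNorm (f t) (ENNReal.ofReal p) volume ^ p < ⊤ := by
  simp_rw [lintegral_rpow_eLpNorm hp]
  have h : ∫⁻ t in Ioo 0 T, ∫⁻ x, ‖f t x‖ₑ ^ p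
      = ∫⁻ z, ‖Function.uncurry f z‖ₑ ^ p ∂(spaceTime N T) :=
    (lintegral_prod _ (hf.enorm.pow_const p)).symm
  rw [h, ← lintegral_rpow_eLpNorm hp, ENNReal.rpow_lt_top_iff_of_pos hp]
  exact ⟨fun h => h.2, fun h => ⟨hf, h⟩⟩

theorem aemeasurable_eLpNorm_slice {f : ℝ → Torus N → E} {p : ℝ} (hp : 0 < p)
    (hf : AEStronglyMeasurable (Function.uncurry f) (spaceTime N T)) :
    AEMeasurable (fun t => eLpNorm (f t) (ENNReal.ofReal p) volume) (volume.restrict (Ioo 0 T)) := by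
  have h : AEMeasurable (fun t => ∫⁻ x, ‖f t x‖ₑ ^ p) (volume.restrict (Ioo 0 T)) :=
    (hf.enorm.pow_const p).lintegral_prod_right'
  have h2 := h.pow_const (1 / p)
  refine h2.congr (Eventually.of_forall fun t => ?_)
  simp only
  rw [← lintegral_rpow_eLpNorm hp, ← ENNReal.rpow_mul, mul_one_div_cancel hp.ne', ENNReal.rpow_one]

theorem MemLpLq.exists_bound {f : ℝ → Torus N → E} {q : ℝ≥0∞} (hf : MemLpLq T ⊤ q f) :
    ∃ C, 0 ≤ C ∧ ∀ᵐ t ∂(volume.restrict (Ioo 0 T)), eLpNorm (f t) q volume ≤ ENNReal.ofReal C := by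
  refine ⟨(eLpNorm (fun t => eLpNorm (f t) q volume) ⊤ (volume.restrict (Ioo 0 T))).toReal,
    ENNReal.toReal_nonneg, ?_⟩
  rw [ENNReal.ofReal_toReal hf.2.ne, eLpNorm_exponent_top]
  filter_upwards [enorm_ae_le_eLpNormEssSup (fun t => eLpNorm (f t) q volume)
    (volume.restrict (Ioo 0 T))] with t ht
  simpa using ht

theorem MemLpLq.memLp_two {f : ℝ → Torus N → E} (hf : MemLpLq T 2 2 f) :
    MemLp (Function.uncurry f) 2 (spaceTime N T) := by
  have e : (2 : ℝ≥0∞) = ENNReal.ofReal 2 := by simp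
  rw [e, memLp_spaceTime_iff two_pos hf.1]
  have h := hf.2
  rw [e, eLpNorm_lt_top_iff_lintegral_rpow_enorm_lt_top (by simp) (by simp)] at h
  simpa using h

theorem ae_aestronglyMeasurable_slice {f : ℝ → Torus N → E}
    (hf : AEStronglyMeasurable (Function.uncurry f) (spaceTime N T)) :
    ∀ᵐ t ∂(volume.restrict (Ioo 0 T)), AEStronglyMeasurable (f t) volume :=
  AEStronglyMeasurable.prodMk_left hf

/-- Interpolation between `L²` and `L^{2r/(r-2)}` for `2 < r < 4`. -/
theorem eLpNorm_four_rpow_le {X : Type*} [MeasurableSpace X] {μ : Measure X} {f : X → E}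
    (hf : AEStronglyMeasurable f μ) {r : ℝ} (h2 : 2 < r) (h4 : r < 4) :
    eLpNorm f (ENNReal.ofReal 4) μ ^ (4 : ℝ) ≤ eLpNorm f (ENNReal.ofReal 2) μ ^ (4 - r)
      * eLpNorm f (ENNReal.ofReal (2 * r / (r - 2))) μ ^ r := by
  have hr2 : 0 < r - 2 := by linarith
  have hr4 : 0 < 4 - r := by linarith
  have hq : 0 < 2 * r / (r - 2) := by positivity
  -- Hölder is applied to `|f|⁴ = |f|^(4-r) |f|^r`. The first exponent turns the first factor into
  -- `|f|²`, and the conjugate one leaves the other norm with power exactly `r`, the power that is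
  -- integrable in time when `f` is in `L^r` of time.
  have hconj : (2 / (4 - r)).HolderConjugate (2 / (r - 2)) := by
    rw [Real.holderConjugate_iff]
    refine ⟨by rw [lt_div_iff₀ hr4]; linarith, ?_⟩
    rw [inv_div, inv_div]; ring
  have h := ENNReal.lintegral_mul_le_Lp_mul_Lq μ hconj (hf.enorm.pow_const (4 - r))
    (hf.enorm.pow_const r)
  rw [lintegral_rpow_eLpNorm (by norm_num : (0 : ℝ) < 4)]
  have e1 : ∀ x, ‖f x‖ₑ ^ (4 : ℝ) = ((fun x => ‖f x‖ₑ ^ (4 - r)) * fun x => ‖f x‖ₑ ^ r) x := by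
    intro x
    rw [Pi.mul_apply, ← ENNReal.rpow_add_of_nonneg _ _ hr4.le (by linarith)]
    congr 1; ring
  simp_rw [e1]
  refine h.trans (le_of_eq ?_)
  have a1 : (4 - r) * (2 / (4 - r)) = 2 := by field_simp
  have a2 : r * (2 / (r - 2)) = 2 * r / (r - 2) := by ring
  simp_rw [← ENNReal.rpow_mul, a1, a2]
  rw [← lintegral_rpow_eLpNorm two_pos, ← lintegral_rpow_eLpNorm hq, ← ENNReal.rpow_mul,
    ← ENNReal.rpow_mul]
  congr 2
  · field_simp
  · field_simp

/-- If `p ≥ 4`, finite measure and `q ≥ 6` already give the claim. If `p < 4`, then `1/p ≤ 5/12`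
forces `p > 2`, and `1/p + 1/q ≤ 5/12 ≤ 1/2` gives `q ≥ 2p/(p-2)`, the exponent that complements
`L²` in the interpolation. The `L²` norm enters with power `4 - p` and is bounded in time, the `L^q`
norm with power `p`. -/
theorem MemLpLq.memLp_four {f : ℝ → Torus N → E} {p q : ℝ≥0∞} (hpq : p⁻¹ + q⁻¹ ≤ 5 / 12)
    (hq : 6 ≤ q) (hf : MemLpLq T p q f) (hf2 : MemLpLq T ⊤ 2 f) :
    MemLp (Function.uncurry f) 4 (spaceTime N T) := by
  have e4 : (4 : ℝ≥0∞) = ENNReal.ofReal 4 := by simp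
  have hm := ae_aestronglyMeasurable_slice hf.1
  rw [e4, memLp_spaceTime_iff (by norm_num) hf.1]
  by_cases hp4 : 4 ≤ p
  · have h1 : eLpNorm (fun t => eLpNorm (f t) (ENNReal.ofReal 4) volume) p
        (volume.restrict (Ioo 0 T)) < ⊤ := by
      refine (eLpNorm_mono_enorm_ae ?_).trans_lt hf.2
      filter_upwards [hm] with t ht
      simp only [enorm_eq_self]
      refine eLpNorm_le_eLpNorm_of_exponent_le ?_ ht
      rw [← e4]
      exact le_trans (by norm_num) hq
    have h2 := eLpNorm_le_eLpNorm_mul_rpow_measure_univ hp4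
      (aemeasurable_eLpNorm_slice (by norm_num : (0 : ℝ) < 4) hf.1).aestronglyMeasurable
    have h3 : eLpNorm (fun t => eLpNorm (f t) (ENNReal.ofReal 4) volume) 4
        (volume.restrict (Ioo 0 T)) < ⊤ := by
      refine h2.trans_lt (ENNReal.mul_lt_top h1 ?_)
      refine (ENNReal.rpow_ne_top_of_nonneg ?_ (measure_ne_top _ _)).lt_top
      rcases eq_or_ne p ⊤ with rfl | hp
      · simp
      · have : (4 : ℝ≥0∞).toReal ≤ p.toReal := (ENNReal.toReal_le_toReal (by simp) hp).2 hp4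
        exact sub_nonneg.2 (one_div_le_one_div_of_le (by simp) this)
    rw [eLpNorm_lt_top_iff_lintegral_rpow_enorm_lt_top (by simp) (by simp)] at h3
    simpa using h3
  · push Not at hp4
    have hp' : p ≠ ⊤ := hp4.ne_top
    have h512 : p⁻¹ ≤ 5 / 12 := le_self_add.trans hpq
    have hp0 : p ≠ 0 := by
      rintro rfl
      rw [ENNReal.inv_zero, top_le_iff] at h512
      exact (ENNReal.div_ne_top (by simp) (by simp)) h512
    set r := p.toReal with hr
    have hr0 : 0 < r := ENNReal.toReal_pos hp0 hp'
    have hr4 : r < 4 := by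
      have := (ENNReal.toReal_lt_toReal hp' (by simp)).2 hp4
      simpa using this
    have hq0 : q ≠ 0 := fun h => by simp [h] at hq
    have hsum : r⁻¹ + q⁻¹.toReal ≤ 5 / 12 := by
      have h1 := ENNReal.toReal_mono (ENNReal.div_ne_top (by simp) (by simp)) hpq
      rw [ENNReal.toReal_add (by simpa using hp0) (by simpa using hq0), ENNReal.toReal_inv] at h1
      simpa using h1
    have hr2 : 2 < r := by
      have h1 : r⁻¹ ≤ 5 / 12 := by linarith [ENNReal.toReal_nonneg (a := q⁻¹)]
      rw [inv_le_comm₀ hr0 (by norm_num)] at h1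
      norm_num at h1
      linarith
    have hr2' : 0 < r - 2 := by linarith
    have hqr : ENNReal.ofReal (2 * r / (r - 2)) ≤ q := by
      rw [← ENNReal.inv_le_inv, ← ENNReal.ofReal_inv_of_pos (by positivity),
        ENNReal.le_ofReal_iff_toReal_le (by simpa using hq0) (by positivity)]
      have : (2 * r / (r - 2))⁻¹ = 1 / 2 - r⁻¹ := by field_simp
      rw [this]
      linarith
    obtain ⟨C, hC, hfC⟩ := hf2.exists_bound
    have hfin : ∫⁻ t in Ioo 0 T, eLpNorm (f t) q volume ^ r < ⊤ := by
      have := hf.2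
      rw [eLpNorm_lt_top_iff_lintegral_rpow_enorm_lt_top hp0 hp'] at this
      simpa using this
    calc _ ≤ ∫⁻ t in Ioo 0 T, ENNReal.ofReal C ^ (4 - r) * eLpNorm (f t) q volume ^ r := by
          refine lintegral_mono_ae ?_
          filter_upwards [hm, hfC] with t h1 h2
          refine (eLpNorm_four_rpow_le h1 hr2 hr4).trans ?_
          have e2 : ENNReal.ofReal 2 = 2 := by simp
          rw [e2]
          refine mul_le_mul' (ENNReal.rpow_le_rpow h2 (by linarith))
            (ENNReal.rpow_le_rpow (eLpNorm_le_eLpNorm_of_exponent_le hqr h1) hr0.le)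
      _ = ENNReal.ofReal C ^ (4 - r) * ∫⁻ t in Ioo 0 T, eLpNorm (f t) q volume ^ r :=
          lintegral_const_mul' _ _ (ENNReal.rpow_ne_top_of_nonneg (by linarith)
            ENNReal.ofReal_ne_top)
      _ < ⊤ := ENNReal.mul_lt_top (ENNReal.rpow_lt_top_of_nonneg (by linarith)
            ENNReal.ofReal_ne_top) hfin

end Mixed

/-! ### The flow on time slices -/

section Flow

variable {N : ℕ} {T γ a b : ℝ}

/-- The momentum flux `ρuᵢuⱼ + ρ^γ δᵢⱼ - ρ(𝔻u)ᵢⱼ`, where `D i j = ∂ⱼuᵢ`. -/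
def flux (γ : ℝ) (ρ : ℝ → Torus N → ℝ) (u : Fin N → ℝ → Torus N → ℝ)
    (D : Fin N → Fin N → ℝ → Torus N → ℝ) (i j : Fin N) (t : ℝ) (x : Torus N) : ℝ :=
  ρ t x * (u i t x * u j t x) + (if i = j then ρ t x ^ γ else 0)
    - ρ t x * ((D i j t x + D j i t x) / 2)

/-- A flow with density between `a > 0` and `b`, velocity components `u i` in `L⁴`, their
gradients `D i`, and the gradient `g` of `√ρ`; the equations hold on time slices. -/
structure IsFlow (T γ a b C : ℝ) (ρ : ℝ → Torus N → ℝ) (u : Fin N → ℝ → Torus N → ℝ)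
    (D : Fin N → Fin N → ℝ → Torus N → ℝ) (g : Fin N → ℝ → Torus N → ℝ) : Prop where
  pos : 0 < a
  nonneg : 0 ≤ C
  meas_rho : AEStronglyMeasurable (Function.uncurry ρ) (spaceTime N T)
  bound : ∀ᵐ z ∂(spaceTime N T), ρ z.1 z.2 ∈ Icc a b
  memLp_u : ∀ i, MemLp (Function.uncurry (u i)) 4 (spaceTime N T)
  memLp_D : ∀ i j, MemLp (Function.uncurry (D i j)) 2 (spaceTime N T)
  memLp_g : ∀ j, MemLp (Function.uncurry (g j)) 2 (spaceTime N T)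
  bound_u : ∀ᵐ t ∂(volume.restrict (Ioo 0 T)), ∀ i, eLpNorm (u i t) 2 volume ≤ ENNReal.ofReal C
  bound_g : ∀ᵐ t ∂(volume.restrict (Ioo 0 T)), ∀ j, eLpNorm (g j t) 2 volume ≤ ENNReal.ofReal C
  wGrad_u : ∀ᵐ t ∂(volume.restrict (Ioo 0 T)), ∀ i, WGrad (u i t) fun j => D i j t
  wGrad_sqrt : ∀ᵐ t ∂(volume.restrict (Ioo 0 T)), WGrad (fun x => √(ρ t x)) fun j => g j t
  mass : ∀ ψ : Torus N → ℝ, IsSmooth ψ → ∃ c, ∀ᵐ t ∂(volume.restrict (Ioo 0 T)),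
    ∫ x, ρ t x * ψ x
      = c + ∫ s in (0 : ℝ)..t, ∑ j, ∫ x, ρ s x * u j s x * partialX j ψ x
  momentum : ∀ ψ : Torus N → ℝ, IsSmooth ψ → ∀ i, ∃ c, ∀ᵐ t ∂(volume.restrict (Ioo 0 T)),
    ∫ x, ρ t x * u i t x * ψ x
      = c + ∫ s in (0 : ℝ)..t, ∑ j, ∫ x, flux γ ρ u D i j s x * partialX j ψ x

theorem measurable_rpow_const (α : ℝ) : Measurable fun x : ℝ => x ^ α := by fun_prop

theorem contDiffAt_rpow {a b : ℝ} (ha : 0 < a) (α : ℝ) :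
    ∀ x ∈ Icc a b, ContDiffAt ℝ ∞ (fun x : ℝ => x ^ α) x := fun _ hx =>
  Real.contDiffAt_rpow_const_of_ne (ha.trans_le hx.1).ne'

theorem memLp_top_of_mem_Icc {α : Type*} [MeasurableSpace α] {μ : Measure α} {f : α → ℝ}
    (hf : AEStronglyMeasurable f μ) (h : ∀ᵐ x ∂μ, f x ∈ Icc a b) : MemLp f ⊤ μ :=
  memLp_top_of_bound hf (max |a| |b|) (h.mono fun _ hx => abs_le_max_abs_abs hx.1 hx.2)

theorem memLp_top_mul {α : Type*} [MeasurableSpace α] {μ : Measure α} {p : ℝ≥0∞} {f g : α → ℝ}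
    (hf : MemLp f ⊤ μ) (hg : MemLp g p μ) : MemLp (fun x => f x * g x) p μ :=
  hg.mul (p := ⊤) hf

theorem ae_slice {p : ℝ → Torus N → Prop} (h : ∀ᵐ z ∂(spaceTime N T), p z.1 z.2) :
    ∀ᵐ t ∂(volume.restrict (Ioo 0 T)), ∀ᵐ x, p t x :=
  Measure.ae_ae_of_ae_prod h

/-- The convective part `R U V` is why velocities in `L⁴` are wanted: it then has the same square
integrability as the viscous part. The pressure is bounded because `R` ranges in `[a, b]` with `a >
0`. -/
theorem memLp_flux {X : Type*} [MeasurableSpace X] {μ : Measure X} [IsFiniteMeasure μ]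
    (ha : 0 < a) {R U V D D' : X → ℝ} (hR : AEStronglyMeasurable R μ)
    (hb : ∀ᵐ x ∂μ, R x ∈ Icc a b) (hU : MemLp U 4 μ) (hV : MemLp V 4 μ) (hD : MemLp D 2 μ)
    (hD' : MemLp D' 2 μ) (P : Prop) [Decidable P] :
    MemLp (fun x => R x * (U x * V x) + (if P then R x ^ γ else 0) - R x * ((D x + D' x) / 2))
      2 μ := by
  have hRt := memLp_top_of_mem_Icc hR hb
  have h1 : MemLp (fun x => if P then R x ^ γ else 0) 2 μ := by
    by_cases hP : P
    · simp only [hP, if_true]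
      exact memLp_comp_of_contDiffAt (contDiffAt_rpow ha γ) (measurable_rpow_const γ) hR hb 2
    · simp only [hP, if_false]
      exact MemLp.zero'
  have h2 : MemLp (fun x => (D x + D' x) / 2) 2 μ := by
    have := (hD.add hD').const_mul (1 / 2)
    refine this.congr_norm ?_ (ae_of_all _ fun x => ?_)
    · exact (hD.1.add hD'.1).div₀ aestronglyMeasurable_const
    · simp only [Pi.add_apply]; congr 1; ring
  exact ((memLp_top_mul hRt (memLp_two_mul hU hV)).add h1).sub (memLp_top_mul hRt h2)

variable {C : ℝ} {ρ : ℝ → Torus N → ℝ} {u : Fin N → ℝ → Torus N → ℝ}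
  {D : Fin N → Fin N → ℝ → Torus N → ℝ} {g : Fin N → ℝ → Torus N → ℝ}

theorem IsFlow.memLp_flux (h : IsFlow T γ a b C ρ u D g) (i j : Fin N) :
    MemLp (Function.uncurry (flux γ ρ u D i j)) 2 (spaceTime N T) :=
  DegenerateNS.memLp_flux h.pos h.meas_rho h.bound (h.memLp_u i) (h.memLp_u j) (h.memLp_D i j)
    (h.memLp_D j i) (i = j)

theorem IsFlow.memLp_mass_flux (h : IsFlow T γ a b C ρ u D g) (j : Fin N) :
    MemLp (Function.uncurry fun t x => ρ t x * u j t x) 4 (spaceTime N T) :=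
  memLp_top_mul (memLp_top_of_mem_Icc h.meas_rho h.bound) (h.memLp_u j)

/-! ### From weak solutions to flows -/

theorem component_aestronglyMeasurable {X : Type*} [MeasurableSpace X] {μ : Measure X}
    {f : X → Vec N} (hf : AEStronglyMeasurable f μ) (i : Fin N) :
    AEStronglyMeasurable (fun x => f x i) μ :=
  (EuclideanSpace.proj (𝕜 := ℝ) i).continuous.comp_aestronglyMeasurable hf

theorem memLp_component {X : Type*} [MeasurableSpace X] {μ : Measure X} {p : ℝ≥0∞}
    {f : X → Vec N} (hf : MemLp f p μ) (i : Fin N) : MemLp (fun x => f x i) p μ :=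
  hf.of_le (component_aestronglyMeasurable hf.1 i)
    (Eventually.of_forall fun x => PiLp.norm_apply_le (f x) i)

theorem eLpNorm_component_le {X : Type*} [MeasurableSpace X] {μ : Measure X} {p : ℝ≥0∞}
    (f : X → Vec N) (i : Fin N) : eLpNorm (fun x => f x i) p μ ≤ eLpNorm f p μ :=
  eLpNorm_mono fun x => PiLp.norm_apply_le (f x) i

theorem norm_le_sqrt_smul {E : Type*} [NormedAddCommGroup E] [NormedSpace ℝ E] {r : ℝ}
    (ha : 0 < a) (hr : a ≤ r) (v : E) : ‖v‖ ≤ (√a)⁻¹ * ‖√r • v‖ := by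
  rw [norm_smul, Real.norm_of_nonneg (Real.sqrt_nonneg r), ← mul_assoc]
  refine le_mul_of_one_le_left (norm_nonneg v) ?_
  rw [inv_mul_eq_div, one_le_div (Real.sqrt_pos.2 ha)]
  exact Real.sqrt_le_sqrt hr

theorem aestronglyMeasurable_of_sqrt_smul {X E : Type*} [MeasurableSpace X] {μ : Measure X}
    [NormedAddCommGroup E] [NormedSpace ℝ E] {r : X → ℝ} {v : X → E} (ha : 0 < a)
    (hr : AEStronglyMeasurable r μ) (hra : ∀ᵐ x ∂μ, a ≤ r x)
    (h : AEStronglyMeasurable (fun x => √(r x) • v x) μ) : AEStronglyMeasurable v μ := by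
  have h1 : AEStronglyMeasurable (fun x => (√(r x))⁻¹) μ :=
    (Real.continuous_sqrt.comp_aestronglyMeasurable hr).inv₀
  refine (h1.smul h).congr ?_
  filter_upwards [hra] with x hx
  rw [Pi.smul_apply', smul_smul, inv_mul_cancel₀ (Real.sqrt_pos.2 (ha.trans_le hx)).ne', one_smul]

/-- The lower bound on the density removes the weight `√ρ`, at the cost of the factor `1/√a`. -/
theorem memLpLq_of_sqrt_smul {p q : ℝ≥0∞} {v : ℝ → Torus N → Vec N} (ha : 0 < a)
    (hr : AEStronglyMeasurable (Function.uncurry ρ) (spaceTime N T))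
    (hra : ∀ᵐ z ∂(spaceTime N T), a ≤ ρ z.1 z.2)
    (h : MemLpLq T p q fun t x => √(ρ t x) • v t x) : MemLpLq T p q v := by
  refine ⟨aestronglyMeasurable_of_sqrt_smul ha hr hra h.1, ?_⟩
  have hra' := ae_slice (p := fun t x => a ≤ ρ t x) hra
  have hle : ∀ᵐ t ∂(volume.restrict (Ioo 0 T)), ‖eLpNorm (v t) q volume‖ₑ
      ≤ ((√a)⁻¹).toNNReal * ‖eLpNorm (fun x => √(ρ t x) • v t x) q volume‖ₑ := by
    filter_upwards [hra'] with t ht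
    simp only [enorm_eq_self]
    exact eLpNorm_le_mul_eLpNorm_of_ae_le_mul
      (ht.mono fun x hx => norm_le_sqrt_smul ha hx (v t x)) q
  exact (eLpNorm_le_mul_eLpNorm_of_ae_le_mul' hle p).trans_lt
    (ENNReal.mul_lt_top ENNReal.coe_lt_top h.2)

/-- A weak solution with bounded density and velocity in `L^p(0,T; L^q)` is a flow in the sense
of `IsFlow`. -/
theorem IsWeakSolution.exists_isFlow {v : ℝ → Torus N → Vec N} {Du : Fin N → ℝ → Torus N → Vec N}
    {ρ₀ : Torus N → ℝ} {u₀ : Torus N → Vec N} (hT : 0 < T)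
    (hsol : IsWeakSolution T γ ρ v Du ρ₀ u₀) (ha : 0 < a)
    (hbound : ∀ᵐ z ∂(spaceTime N T), a ≤ ρ z.1 z.2 ∧ ρ z.1 z.2 ≤ b)
    {p q : ℝ≥0∞} (hpq : p⁻¹ + q⁻¹ ≤ 5 / 12) (hq : 6 ≤ q) (hv : MemLpLq T p q v) :
    ∃ C g, IsFlow T γ a b C ρ (fun i t x => v t x i) (fun i j t x => Du i t x j) g := by
  have hra : ∀ᵐ z ∂(spaceTime N T), a ≤ ρ z.1 z.2 := hbound.mono fun z hz => hz.1
  have hbd : ∀ᵐ z ∂(spaceTime N T), ρ z.1 z.2 ∈ Icc a b := hbound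
  have mρ := hsol.rho_mem.1
  have mρt : MemLp (Function.uncurry ρ) ⊤ (spaceTime N T) := memLp_top_of_mem_Icc mρ hbd
  have hv2 : MemLpLq T ⊤ 2 v := memLpLq_of_sqrt_smul ha mρ hra hsol.sqrt_rho_u
  have hv4 := hv.memLp_four hpq hq hv2
  have hD : ∀ i, MemLp (Function.uncurry (Du i)) 2 (spaceTime N T) := fun i =>
    (memLpLq_of_sqrt_smul ha mρ hra (hsol.sqrt_rho_grad_u i)).memLp_two
  obtain ⟨G, hG, hGm⟩ := hsol.grad_sqrt_rho
  obtain ⟨C₁, hC₁, hvC⟩ := hv2.exists_bound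
  obtain ⟨C₂, hC₂, hGC⟩ := hGm.exists_bound
  have u4 : ∀ i, MemLp (Function.uncurry fun t x => v t x i) 4 (spaceTime N T) := fun i =>
    memLp_component hv4 i
  have D2 : ∀ i j, MemLp (Function.uncurry fun t x => Du i t x j) 2 (spaceTime N T) := fun i j =>
    memLp_component (hD i) j
  -- On a bounded time interval, a bound in `L^∞(L²)` gives one in `L²(L²)`.
  have hGtop : MemLpLq T 2 2 G := by
    refine ⟨hGm.1, ?_⟩
    have := eLpNorm_mono_enorm_ae (p := 2) (μ := volume.restrict (Ioo 0 T))
      (f := fun t => eLpNorm (G t) 2 volume) (g := fun _ => ENNReal.ofReal C₂)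
      (hGC.mono fun t ht => by simpa using ht)
    refine this.trans_lt ?_
    rw [eLpNorm_lt_top_iff_lintegral_rpow_enorm_lt_top (by simp) (by simp)]
    simp only [enorm_eq_self, lintegral_const]
    exact ENNReal.mul_lt_top (ENNReal.rpow_lt_top_of_nonneg (by simp) (by simp))
      (measure_lt_top _ _)
  have g2 : ∀ j, MemLp (Function.uncurry fun t x => G t x j) 2 (spaceTime N T) := fun j =>
    memLp_component hGtop.memLp_two j
  have sq : MemLp (Function.uncurry fun t x => √(ρ t x)) ⊤ (spaceTime N T) :=
    memLp_top_of_mem_Icc (a := 0) (b := √b) (Real.continuous_sqrt.comp_aestronglyMeasurable mρ)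
      (hbd.mono fun z hz => ⟨Real.sqrt_nonneg _, Real.sqrt_le_sqrt hz.2⟩)
  have int4 : ∀ i, Integrable (Function.uncurry fun t x => v t x i) (spaceTime N T) := fun i =>
    (u4 i).integrable (by norm_num)
  have q4 : ∀ i, Integrable (Function.uncurry fun t x => ρ t x * v t x i) (spaceTime N T) :=
    fun i => (memLp_top_mul mρt (u4 i)).integrable (by norm_num)
  have fl : ∀ i j, Integrable (Function.uncurry (flux γ ρ (fun i t x => v t x i)
      (fun i j t x => Du i t x j) i j)) (spaceTime N T) := fun i j =>
    (DegenerateNS.memLp_flux ha mρ hbd (u4 i) (u4 j) (D2 i j) (D2 j i) (i = j)).integrable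
      one_le_two
  refine ⟨max C₁ C₂, fun j t x => G t x j, ha, hC₁.trans (le_max_left _ _), mρ, hbd, u4, D2, g2,
    ?_, ?_, ?_, ?_, ?_, ?_⟩
  · filter_upwards [hvC] with t ht i
    exact (eLpNorm_component_le _ i).trans
      (ht.trans (ENNReal.ofReal_le_ofReal (le_max_left _ _)))
  · filter_upwards [hGC] with t ht i
    exact (eLpNorm_component_le _ i).trans
      (ht.trans (ENNReal.ofReal_le_ofReal (le_max_right _ _)))
  · exact ae_all_iff.2 fun i => wGrad_slice hT (int4 i)
      (fun j => (D2 i j).integrable one_le_two) fun φ hφ j => (hsol.grad_u i).eq φ hφ j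
  · exact wGrad_slice hT (sq.integrable le_top) (fun j => (g2 j).integrable one_le_two)
      fun φ hφ j => hG.eq φ hφ j
  · intro ψ hψ
    exact exists_slice_of_div hT (mρt.integrable le_top) q4 hsol.continuity hψ
  · intro ψ hψ i
    refine exists_slice_of_div hT (q4 i) (fl i) (fun φ hφ => ?_) hψ
    rw [← hsol.momentum φ hφ i]
    refine integral_congr_ae (ae_of_all _ fun z => ?_)
    simp only [flux, strain, add_mul, sub_mul, Finset.sum_add_distrib, Finset.sum_sub_distrib,
      ite_mul, zero_mul, Finset.sum_ite_eq, Finset.mem_univ, if_true]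
    simp only [mul_assoc]
    ring

end Flow

/-! ### Weakly continuous versions -/

section Version

variable {N : ℕ} {T γ a b C : ℝ} {ρ : ℝ → Torus N → ℝ} {u : Fin N → ℝ → Torus N → ℝ}
  {D : Fin N → Fin N → ℝ → Torus N → ℝ} {g : Fin N → ℝ → Torus N → ℝ}

/-- `r` and `m` are weakly continuous versions of the density `ρ` and of the momentum `ρu`. -/
structure IsVersion (T : ℝ) (ρ : ℝ → Torus N → ℝ) (u : Fin N → ℝ → Torus N → ℝ)
    (r : ℝ → Torus N → ℝ) (m : Fin N → ℝ → Torus N → ℝ) : Prop where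
  ae_rho : ∀ᵐ t ∂(volume.restrict (Ioo 0 T)), r t =ᵐ[volume] ρ t
  ae_m : ∀ᵐ t ∂(volume.restrict (Ioo 0 T)), ∀ i, m i t =ᵐ[volume] fun x => ρ t x * u i t x
  memLp_rho : ∀ t ∈ Icc 0 T, MemLp (r t) 2 volume
  memLp_m : ∀ i, ∀ t ∈ Icc 0 T, MemLp (m i t) 2 volume
  continuous_rho : ∀ ψ : Torus N → ℝ, MemLp ψ 2 volume →
    ContinuousOn (fun t => ∫ x, r t x * ψ x) (Icc 0 T)
  continuous_m : ∀ i, ∀ ψ : Torus N → ℝ, MemLp ψ 2 volume →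
    ContinuousOn (fun t => ∫ x, m i t x * ψ x) (Icc 0 T)

theorem IsFlow.ae_bound (h : IsFlow T γ a b C ρ u D g) :
    ∀ᵐ t ∂(volume.restrict (Ioo 0 T)), ∀ᵐ x, ρ t x ∈ Icc a b :=
  ae_slice (p := fun t x => ρ t x ∈ Icc a b) h.bound

theorem IsFlow.ae_meas (h : IsFlow T γ a b C ρ u D g) :
    ∀ᵐ t ∂(volume.restrict (Ioo 0 T)), AEStronglyMeasurable (ρ t) volume :=
  ae_aestronglyMeasurable_slice h.meas_rho

theorem ae_memLp_slice {p : ℝ} (hp : 0 < p) {f : ℝ → Torus N → ℝ}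
    (hf : MemLp (Function.uncurry f) (ENNReal.ofReal p) (spaceTime N T)) :
    ∀ᵐ t ∂(volume.restrict (Ioo 0 T)), MemLp (f t) (ENNReal.ofReal p) volume := by
  have h1 := (memLp_spaceTime_iff hp hf.1).1 hf
  have h2 := (aemeasurable_eLpNorm_slice hp hf.1).pow_const p
  filter_upwards [ae_aestronglyMeasurable_slice hf.1, ae_lt_top' h2 h1.ne] with t h3 h4
  exact ⟨h3, (ENNReal.rpow_lt_top_iff_of_pos hp).1 h4⟩

theorem ae_memLp_two_slice {f : ℝ → Torus N → ℝ}
    (hf : MemLp (Function.uncurry f) 2 (spaceTime N T)) :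
    ∀ᵐ t ∂(volume.restrict (Ioo 0 T)), MemLp (f t) 2 volume := by
  have := ae_memLp_slice (p := 2) (f := f) (T := T) (by norm_num) (by simpa using hf)
  simpa using this

theorem ae_memLp_four_slice {f : ℝ → Torus N → ℝ}
    (hf : MemLp (Function.uncurry f) 4 (spaceTime N T)) :
    ∀ᵐ t ∂(volume.restrict (Ioo 0 T)), MemLp (f t) 4 volume := by
  have := ae_memLp_slice (p := 4) (f := f) (T := T) (by norm_num) (by simpa using hf)
  simpa using this

theorem continuousOn_const_add_integral (hT : 0 < T) {f : ℝ → ℝ} (hf : IntegrableOn f (Ioo 0 T))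
    (c : ℝ) : ContinuousOn (fun t => c + ∫ s in (0 : ℝ)..t, f s) (Icc 0 T) := by
  have h : ContinuousOn (fun t => ∫ s in (0 : ℝ)..t, f s) (uIcc 0 T) :=
    intervalIntegral.continuousOn_primitive_interval
      (by rw [uIcc_of_le hT.le, integrableOn_Icc_iff_integrableOn_Ioo]; exact hf)
  rw [uIcc_of_le hT.le] at h
  exact continuousOn_const.add h

theorem integrableOn_sum_slice {G : Fin N → ℝ → Torus N → ℝ}
    (hG : ∀ j, Integrable (Function.uncurry (G j)) (spaceTime N T)) {ψ : Torus N → ℝ}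
    (hψ : IsSmooth ψ) :
    IntegrableOn (fun s => ∑ j, ∫ x, G j s x * partialX j ψ x) (Ioo 0 T) :=
  integrable_finsetSum _ fun j _ => integrable_slice (hG j) (hψ.partialX j)

theorem IsFlow.integrable_mass_flux (h : IsFlow T γ a b C ρ u D g) (j : Fin N) :
    Integrable (Function.uncurry fun t x => ρ t x * u j t x) (spaceTime N T) :=
  (h.memLp_mass_flux j).integrable (by norm_num)

theorem IsFlow.integrable_flux (h : IsFlow T γ a b C ρ u D g) (i j : Fin N) :
    Integrable (Function.uncurry (flux γ ρ u D i j)) (spaceTime N T) :=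
  (h.memLp_flux i j).integrable one_le_two

/-- For almost every time the moments equal primitives of integrable functions, and these are the
continuous representatives that a weakly continuous curve must have. -/
theorem exists_weak_curve_of_slices (hT : 0 < T) {w : ℝ → Torus N → ℝ} {K : ℝ} (hK : 0 ≤ K)
    (hw : ∀ᵐ t ∂(volume.restrict (Ioo 0 T)), MemLp (w t) 2 volume)
    (hwK : ∀ᵐ t ∂(volume.restrict (Ioo 0 T)), eLpNorm (w t) 2 volume ≤ ENNReal.ofReal K)
    {G : Fin N → ℝ → Torus N → ℝ}
    (hG : ∀ j, Integrable (Function.uncurry (G j)) (spaceTime N T))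
    (h : ∀ ψ : Torus N → ℝ, IsSmooth ψ → ∃ c, ∀ᵐ t ∂(volume.restrict (Ioo 0 T)),
      ∫ x, w t x * ψ x = c + ∫ s in (0 : ℝ)..t, ∑ j, ∫ x, G j s x * partialX j ψ x) :
    ∃ W : ℝ → Torus N → ℝ, (∀ t ∈ Icc 0 T, MemLp (W t) 2 volume) ∧
      (∀ ψ : Torus N → ℝ, MemLp ψ 2 volume →
        ContinuousOn (fun t => ∫ x, W t x * ψ x) (Icc 0 T)) ∧
      ∀ᵐ t ∂(volume.restrict (Ioo 0 T)), w t =ᵐ[volume] W t := by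
  choose c hc using fun n => h _ (isSmooth_denseSmooth (N := N) n)
  exact exists_weak_curve hT hK hw hwK
    (fun n => continuousOn_const_add_integral hT
      (integrableOn_sum_slice hG (isSmooth_denseSmooth n)) (c n)) hc

theorem IsFlow.ae_bound_m (h : IsFlow T γ a b C ρ u D g) :
    ∀ᵐ t ∂(volume.restrict (Ioo 0 T)), ∀ i, MemLp (fun x => ρ t x * u i t x) 2 volume ∧
      eLpNorm (fun x => ρ t x * u i t x) 2 volume ≤ ENNReal.ofReal (max |a| |b| * C) := by
  filter_upwards [h.ae_bound, h.ae_meas, h.bound_u,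
    ae_all_iff.2 fun i => ae_memLp_four_slice (h.memLp_u i)] with t h1 h2 h3 h4 i
  refine ⟨memLp_top_mul (memLp_top_of_mem_Icc h2 h1) (memLp_two_of_four (h4 i)), ?_⟩
  have := eLpNorm_le_mul_eLpNorm_of_ae_le_mul (μ := (volume : Measure (Torus N)))
    (f := fun x => ρ t x * u i t x) (g := u i t) (c := max |a| |b|) (h1.mono fun x hx => by
      rw [norm_mul]
      exact mul_le_mul_of_nonneg_right (abs_le_max_abs_abs hx.1 hx.2) (norm_nonneg _)) 2
  rw [ENNReal.ofReal_mul (le_max_of_le_left (abs_nonneg a))]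
  exact this.trans (mul_le_mul_right (h3 i) _)

theorem IsFlow.exists_isVersion (hT : 0 < T) (h : IsFlow T γ a b C ρ u D g) :
    ∃ r m, IsVersion T ρ u r m := by
  have hK : 0 ≤ max |a| |b| := le_max_of_le_left (abs_nonneg a)
  have h1 : ∀ᵐ t ∂(volume.restrict (Ioo 0 T)), MemLp (ρ t) 2 volume := by
    filter_upwards [h.ae_bound, h.ae_meas] with t h1 h2
    exact (memLp_top_of_mem_Icc h2 h1).mono_exponent le_top
  have h2 : ∀ᵐ t ∂(volume.restrict (Ioo 0 T)),
      eLpNorm (ρ t) 2 volume ≤ ENNReal.ofReal (max |a| |b|) := by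
    filter_upwards [h.ae_bound] with t h1
    have := eLpNorm_le_of_ae_bound (p := 2) (f := ρ t) (C := max |a| |b|)
      (h1.mono fun x hx => abs_le_max_abs_abs hx.1 hx.2)
    simpa using this
  obtain ⟨r, hr1, hr2, hr3⟩ := exists_weak_curve_of_slices hT hK h1 h2 h.integrable_mass_flux h.mass
  choose m hm1 hm2 hm3 using fun i => exists_weak_curve_of_slices hT (mul_nonneg hK h.nonneg)
    (h.ae_bound_m.mono fun t ht => (ht i).1) (h.ae_bound_m.mono fun t ht => (ht i).2)
    (h.integrable_flux i) fun ψ hψ => h.momentum ψ hψ i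
  exact ⟨r, m, hr3.mono fun t ht => ht.symm, (ae_all_iff.2 hm3).mono fun t ht i => (ht i).symm,
    hr1, hm1, hr2, hm2⟩

/-! ### Increments of the density and of the momentum -/

/-- The integral of `G` over the times between `s` and `t`. -/
def timeInt (G : ℝ → Torus N → ℝ) (s t : ℝ) (x : Torus N) : ℝ := ∫ τ in s..t, G τ x

theorem spaceTime_mono {s t : ℝ} (hs : 0 ≤ s) (ht : t ≤ T) :
    (volume.restrict (Ioc s t)).prod (volume : Measure (Torus N)) ≤ spaceTime N T := by
  refine Measure.prod_mono ?_ le_rfl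
  rw [restrict_Ioo_eq_restrict_Ioc]
  exact Measure.restrict_mono (Ioc_subset_Ioc hs ht) le_rfl

/-- Jensen for the normalised measure on `(s, t]`: pulling out the length gives `(t - s)^p`, and the
normalisation gives one power back. At `p = 2` this is the factor `√(t - s)` behind all the
continuity estimates in time. -/
theorem memLp_timeInt {G : ℝ → Torus N → ℝ} {p : ℝ≥0∞} (hp : 1 ≤ p) (hp' : p ≠ ⊤)
    (hG : MemLp (Function.uncurry G) p (spaceTime N T)) {s t : ℝ} (hs : 0 ≤ s) (hst : s ≤ t)
    (ht : t ≤ T) :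
    MemLp (timeInt G s t) p volume ∧ eLpNorm (timeInt G s t) p volume ^ p.toReal
      ≤ ENNReal.ofReal (t - s) ^ (p.toReal - 1)
        * eLpNorm (Function.uncurry G) p (spaceTime N T) ^ p.toReal := by
  have hp0 : p ≠ 0 := (one_pos.trans_le hp).ne'
  have hr : 0 < p.toReal := ENNReal.toReal_pos hp0 hp'
  -- An interval of length zero cannot be normalised, so it is treated apart.
  rcases hst.eq_or_lt with rfl | hst'
  · have : timeInt G s s = fun _ => 0 := by ext x; simp [timeInt]
    rw [this]
    exact ⟨MemLp.zero', by simp [ENNReal.zero_rpow_of_pos hr]⟩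
  set κ := ENNReal.ofReal (t - s) with hκ
  have hκ0 : κ ≠ 0 := by simpa [hκ] using hst'
  have hκt : κ ≠ ⊤ := ENNReal.ofReal_ne_top
  let ν : Measure ℝ := κ⁻¹ • volume.restrict (Ioc s t)
  have hν : IsProbabilityMeasure ν := ⟨by
    simp only [ν, Measure.smul_apply, Measure.restrict_apply_univ, Real.volume_Ioc, smul_eq_mul]
    exact ENNReal.inv_mul_cancel hκ0 hκt⟩
  have hG' := hG.mono_measure (spaceTime_mono (N := N) hs ht)
  have hsm : AEStronglyMeasurable (Function.uncurry fun x τ => G τ x)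
      ((volume : Measure (Torus N)).prod (volume.restrict (Ioc s t))) := hG'.1.prod_swap
  have hsm' : AEStronglyMeasurable (Function.uncurry fun x τ => G τ x)
      ((volume : Measure (Torus N)).prod ν) := by
    rw [Measure.prod_smul_right]
    exact hsm.smul_measure _
  have hJ := eLpNorm_integral_le hp hp' hsm'
  have e1 : timeInt G s t = fun x => (t - s) * ∫ τ, G τ x ∂ν := by
    ext x
    rw [timeInt, intervalIntegral.integral_of_le hst, integral_smul_measure, ENNReal.toReal_inv, hκ,
      ENNReal.toReal_ofReal (by linarith), smul_eq_mul, ← mul_assoc,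
      mul_inv_cancel₀ (by linarith), one_mul]
  have e2 : ∫⁻ τ, eLpNorm (fun x => G τ x) p volume ^ p.toReal ∂ν
      ≤ κ⁻¹ * eLpNorm (Function.uncurry G) p (spaceTime N T) ^ p.toReal := by
    rw [lintegral_smul_measure, smul_eq_mul]
    refine mul_le_mul_right ?_ _
    refine le_trans (le_of_eq ?_) (ENNReal.rpow_le_rpow (eLpNorm_mono_measure _
      (spaceTime_mono (N := N) hs ht)) hr.le)
    simp_rw [eLpNorm_rpow_toReal hp0 hp']
    exact (lintegral_prod _ (hG'.1.enorm.pow_const _)).symm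
  have e3 : eLpNorm (timeInt G s t) p volume ^ p.toReal
      ≤ κ ^ (p.toReal - 1) * eLpNorm (Function.uncurry G) p (spaceTime N T) ^ p.toReal := by
    have : eLpNorm (timeInt G s t) p volume = κ * eLpNorm (fun x => ∫ τ, G τ x ∂ν) p volume := by
      rw [e1]
      have := eLpNorm_const_smul (t - s) (fun x => ∫ τ, G τ x ∂ν) p (volume : Measure (Torus N))
      rw [hκ, ← Real.enorm_of_nonneg (by linarith : 0 ≤ t - s), ← this]
      rfl
    rw [this, ENNReal.mul_rpow_of_nonneg _ _ hr.le]
    refine (mul_le_mul_right (hJ.trans e2) _).trans (le_of_eq ?_)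
    rw [← mul_assoc, ENNReal.rpow_sub _ _ hκ0 hκt, ENNReal.rpow_one, div_eq_mul_inv]
  refine ⟨⟨?_, ?_⟩, e3⟩
  · rw [e1]
    exact (hsm'.integral_prod_right').const_mul _
  · rw [← ENNReal.rpow_lt_top_iff_of_pos hr]
    refine e3.trans_lt (ENNReal.mul_lt_top ?_ ?_)
    · exact ENNReal.rpow_lt_top_of_nonneg
        (sub_nonneg.2 (by simpa using ENNReal.toReal_mono hp' hp)) hκt
    · exact ENNReal.rpow_lt_top_of_nonneg hr.le hG.2.ne

theorem eLpNorm_timeInt_two_le {G : ℝ → Torus N → ℝ}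
    (hG : MemLp (Function.uncurry G) 2 (spaceTime N T)) {s t : ℝ} (hs : 0 ≤ s) (hst : s ≤ t)
    (ht : t ≤ T) : (eLpNorm (timeInt G s t) 2 volume).toReal
      ≤ √(t - s) * (eLpNorm (Function.uncurry G) 2 (spaceTime N T)).toReal := by
  have h := (memLp_timeInt one_le_two (by simp) hG hs hst ht).2
  have h1 := ENNReal.toReal_mono (ENNReal.mul_ne_top
    (ENNReal.rpow_ne_top_of_nonneg (by norm_num) ENNReal.ofReal_ne_top)
    (ENNReal.rpow_ne_top_of_nonneg (by norm_num) hG.2.ne)) h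
  rw [ENNReal.toReal_mul, ← ENNReal.toReal_rpow, ← ENNReal.toReal_rpow, ← ENNReal.toReal_rpow,
    ENNReal.toReal_ofReal (by linarith)] at h1
  norm_num at h1
  refine (sq_le_sq₀ ENNReal.toReal_nonneg (by positivity)).1 ?_
  rwa [mul_pow, Real.sq_sqrt (by linarith)]

/-- The integrated equation holds at almost every time for `w`; both sides have continuous
representatives, so it holds at every time for `W`, endpoints included. Subtracting it at two times
and exchanging the integrals gives the divergence of the time-integrated flux. -/
theorem wDiv_timeInt (hT : 0 < T) {w W : ℝ → Torus N → ℝ} {G : Fin N → ℝ → Torus N → ℝ}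
    (hW : ∀ t ∈ Icc 0 T, MemLp (W t) 2 volume)
    (hWc : ∀ ψ : Torus N → ℝ, MemLp ψ 2 volume →
        ContinuousOn (fun t => ∫ x, W t x * ψ x) (Icc 0 T))
    (hWw : ∀ᵐ t ∂(volume.restrict (Ioo 0 T)), W t =ᵐ[volume] w t)
    (hG : ∀ j, Integrable (Function.uncurry (G j)) (spaceTime N T))
    (h : ∀ ψ : Torus N → ℝ, IsSmooth ψ → ∃ c, ∀ᵐ t ∂(volume.restrict (Ioo 0 T)),
      ∫ x, w t x * ψ x = c + ∫ s in (0 : ℝ)..t, ∑ j, ∫ x, G j s x * partialX j ψ x)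
    {s t : ℝ} (hs : 0 ≤ s) (hst : s ≤ t) (ht : t ≤ T) :
    WDiv (fun j => timeInt (G j) s t) fun x => W t x - W s x := by
  intro ψ hψ
  obtain ⟨c, hc⟩ := h ψ hψ
  have hint := integrableOn_sum_slice hG hψ
  have hall : ∀ τ ∈ Icc 0 T, ∫ x, W τ x * ψ x
      = c + ∫ s in (0 : ℝ)..τ, ∑ j, ∫ x, G j s x * partialX j ψ x := by
    intro τ hτ
    have := nearTimes_neBot hT hτ
    refine tendsto_nhds_unique (tendsto_nearTimes (hWc ψ (hψ.memLp 2)) hτ)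
      ((tendsto_nearTimes (continuousOn_const_add_integral hT hint c) hτ).congr' ?_)
    filter_upwards [eventually_nearTimes hc τ, eventually_nearTimes hWw τ] with σ h1 h2
    rw [← h1]
    exact integral_congr_ae (h2.mono fun x hx => by simp only [hx])
  have hsT : s ∈ Icc 0 T := ⟨hs, hst.trans ht⟩
  have htT : t ∈ Icc 0 T := ⟨hs.trans hst, ht⟩
  simp_rw [sub_mul]
  rw [integral_sub (integrable_mul_two (hW t htT) (hψ.memLp 2))
    (integrable_mul_two (hW s hsT) (hψ.memLp 2)), hall t htT, hall s hsT]
  have hii : ∀ τ ∈ Icc 0 T, IntervalIntegrable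
      (fun s => ∑ j, ∫ x, G j s x * partialX j ψ x) volume 0 τ := fun τ hτ => by
    rw [intervalIntegrable_iff_integrableOn_Ioo_of_le hτ.1]
    exact hint.mono_set (Ioo_subset_Ioo_right hτ.2)
  rw [add_sub_add_left_eq_sub, intervalIntegral.integral_interval_sub_left (hii t htT) (hii s hsT)]
  have hGj : ∀ j, Integrable (Function.uncurry fun τ x => G j τ x * partialX j ψ x)
      ((volume.restrict (Ioc s t)).prod (volume : Measure (Torus N))) := fun j =>
    (integrable_slice_mul (hG j) (hψ.partialX j)).mono_measure (spaceTime_mono hs ht)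
  have hsw : ∀ j, ∫ τ in s..t, ∫ x, G j τ x * partialX j ψ x
      = ∫ x, timeInt (G j) s t x * partialX j ψ x := fun j => by
    rw [intervalIntegral.integral_of_le hst, integral_integral_swap (hGj j)]
    refine integral_congr_ae (ae_of_all _ fun x => ?_)
    simp only [timeInt]
    rw [intervalIntegral.integral_of_le hst, integral_mul_const]
  have hib : ∀ j, Integrable fun x => timeInt (G j) s t x * partialX j ψ x := fun j => by
    refine (hGj j).integral_prod_right.congr (ae_of_all _ fun x => ?_)
    simp only [timeInt, Function.uncurry]
    rw [intervalIntegral.integral_of_le hst, integral_mul_const]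
  rw [integral_finsetSum _ fun j _ => hib j, intervalIntegral.integral_finsetSum]
  · exact Finset.sum_congr rfl fun j _ => hsw j
  · intro j _
    rw [intervalIntegrable_iff_integrableOn_Ioc_of_le hst]
    exact (hGj j).integral_prod_left

variable {r : ℝ → Torus N → ℝ} {m : Fin N → ℝ → Torus N → ℝ}

theorem IsVersion.wDiv_rho (hT : 0 < T) (h : IsFlow T γ a b C ρ u D g) (hv : IsVersion T ρ u r m)
    {s t : ℝ} (hs : 0 ≤ s) (hst : s ≤ t) (ht : t ≤ T) :
    WDiv (fun j => timeInt (fun τ x => ρ τ x * u j τ x) s t) fun x => r t x - r s x :=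
  wDiv_timeInt hT hv.memLp_rho hv.continuous_rho hv.ae_rho h.integrable_mass_flux h.mass hs hst ht

theorem IsVersion.wDiv_m (hT : 0 < T) (h : IsFlow T γ a b C ρ u D g) (hv : IsVersion T ρ u r m)
    (i : Fin N) {s t : ℝ} (hs : 0 ≤ s) (hst : s ≤ t) (ht : t ≤ T) :
    WDiv (fun j => timeInt (flux γ ρ u D i j) s t) fun x => m i t x - m i s x :=
  wDiv_timeInt hT (hv.memLp_m i) (hv.continuous_m i) (hv.ae_m.mono fun _ ht => ht i)
    (h.integrable_flux i) (fun ψ hψ => h.momentum ψ hψ i) hs hst ht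

theorem IsVersion.bound (hT : 0 < T) (h : IsFlow T γ a b C ρ u D g) (hv : IsVersion T ρ u r m)
    {t : ℝ} (ht : t ∈ Icc 0 T) : ∀ᵐ x, r t x ∈ Icc a b := by
  refine ae_mem_Icc_of_weak hT hv.memLp_rho hv.continuous_rho ?_ ht
  filter_upwards [hv.ae_rho, h.ae_bound] with t h1 h2
  filter_upwards [h1, h2] with x h3 h4
  rwa [h3]

end Version

/-! ### Good times and strong continuity of the density -/

section GoodTimes

variable {N : ℕ} {T γ a b C : ℝ} {ρ : ℝ → Torus N → ℝ} {u : Fin N → ℝ → Torus N → ℝ}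
  {D : Fin N → Fin N → ℝ → Torus N → ℝ} {g : Fin N → ℝ → Torus N → ℝ}
  {r : ℝ → Torus N → ℝ} {m : Fin N → ℝ → Torus N → ℝ}

theorem eLpNorm_two_toReal_sq {α : Type*} [MeasurableSpace α] {μ : Measure α} {f : α → ℝ}
    (hf : MemLp f 2 μ) : (eLpNorm f 2 μ).toReal ^ 2 = ∫ x, f x * f x ∂μ := by
  rw [hf.eLpNorm_eq_integral_rpow_norm (by simp) (by simp), ENNReal.toReal_ofReal (by positivity)]
  have h0 : 0 ≤ ∫ x, ‖f x‖ ^ (2 : ℝ≥0∞).toReal ∂μ := integral_nonneg fun x => by positivity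
  rw [← Real.rpow_natCast, ← Real.rpow_mul h0]
  norm_num
  exact integral_congr_ae (ae_of_all _ fun x => by simp only; ring)

theorem WGrad.congr_ae {f f' : Torus N → ℝ} {G : Fin N → Torus N → ℝ} (h : WGrad f G)
    (hf : f =ᵐ[volume] f') : WGrad f' G := fun φ hφ i => by
  rw [← h φ hφ i]
  exact integral_congr_ae (hf.mono fun x hx => by simp only [hx])

/-- The gradient of `ρ ^ β`, where `g` is the gradient of `√ρ`. -/
def gradPow (β : ℝ) (ρ : ℝ → Torus N → ℝ) (g : Fin N → ℝ → Torus N → ℝ) (j : Fin N) (t : ℝ)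
    (x : Torus N) : ℝ :=
  deriv (fun y : ℝ => y ^ (2 * β)) (√(ρ t x)) * g j t x

theorem sqrt_mem_Icc {x : ℝ} (hx : x ∈ Icc a b) : √x ∈ Icc √a √b :=
  ⟨Real.sqrt_le_sqrt hx.1, Real.sqrt_le_sqrt hx.2⟩

theorem exists_deriv_rpow_bound (ha : 0 < a) (β : ℝ) :
    ∃ K, 0 ≤ K ∧ ∀ x ∈ Icc a b, |deriv (fun y : ℝ => y ^ (2 * β)) √x| ≤ K := by
  have hc : ContinuousOn (deriv fun y : ℝ => y ^ (2 * β)) (Icc √a √b) := fun x hx =>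
    (contDiffAt_deriv (contDiffAt_rpow (Real.sqrt_pos.2 ha) (2 * β) x hx)).continuousAt
      |>.continuousWithinAt
  obtain ⟨K, hK⟩ := isCompact_Icc.exists_bound_of_continuousOn hc
  exact ⟨max K 0, le_max_right _ _, fun x hx => (hK _ (sqrt_mem_Icc hx)).trans (le_max_left _ _)⟩

theorem aestronglyMeasurable_deriv_sqrt {X : Type*} [MeasurableSpace X] {μ : Measure X} {R : X → ℝ}
    (hR : AEStronglyMeasurable R μ) (β : ℝ) :
    AEStronglyMeasurable (fun x => deriv (fun y : ℝ => y ^ (2 * β)) √(R x)) μ :=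
  ((measurable_deriv _).comp_aemeasurable
    (Real.continuous_sqrt.comp_aestronglyMeasurable hR).aemeasurable).aestronglyMeasurable

theorem memLp_gradPow {X : Type*} [MeasurableSpace X] {μ : Measure X} (ha : 0 < a) (β : ℝ)
    {R G : X → ℝ} (hR : AEStronglyMeasurable R μ) (hb : ∀ᵐ x ∂μ, R x ∈ Icc a b)
    (hG : MemLp G 2 μ) :
    MemLp (fun x => deriv (fun y : ℝ => y ^ (2 * β)) √(R x) * G x) 2 μ := by
  obtain ⟨K, -, hK⟩ := exists_deriv_rpow_bound (b := b) ha β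
  exact memLp_top_mul (memLp_top_of_bound (aestronglyMeasurable_deriv_sqrt hR β) K
    (hb.mono fun x hx => hK _ hx)) hG

/-- The properties of the flow at almost every time. -/
structure IsGood (T a b C : ℝ) (ρ : ℝ → Torus N → ℝ) (u : Fin N → ℝ → Torus N → ℝ)
    (D : Fin N → Fin N → ℝ → Torus N → ℝ) (g : Fin N → ℝ → Torus N → ℝ)
    (r : ℝ → Torus N → ℝ) (m : Fin N → ℝ → Torus N → ℝ) (t : ℝ) : Prop where
  mem : t ∈ Ioo 0 T
  eq_rho : r t =ᵐ[volume] ρ t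
  eq_m : ∀ i, m i t =ᵐ[volume] fun x => ρ t x * u i t x
  bound : ∀ᵐ x, ρ t x ∈ Icc a b
  meas : AEStronglyMeasurable (ρ t) volume
  memLp_u : ∀ i, MemLp (u i t) 4 volume
  memLp_D : ∀ i j, MemLp (D i j t) 2 volume
  memLp_g : ∀ j, MemLp (g j t) 2 volume
  bound_u : ∀ i, eLpNorm (u i t) 2 volume ≤ ENNReal.ofReal C
  bound_g : ∀ j, eLpNorm (g j t) 2 volume ≤ ENNReal.ofReal C
  wGrad_u : ∀ i, WGrad (u i t) fun j => D i j t
  wGrad_sqrt : WGrad (fun x => √(ρ t x)) fun j => g j t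

theorem ae_isGood (h : IsFlow T γ a b C ρ u D g) (hv : IsVersion T ρ u r m) :
    ∀ᵐ t ∂(volume.restrict (Ioo 0 T)), IsGood T a b C ρ u D g r m t := by
  filter_upwards [ae_restrict_mem measurableSet_Ioo, hv.ae_rho, hv.ae_m, h.ae_bound, h.ae_meas,
    ae_all_iff.2 fun i => ae_memLp_four_slice (h.memLp_u i),
    ae_all_iff.2 fun i => ae_all_iff.2 fun j => ae_memLp_two_slice (h.memLp_D i j),
    ae_all_iff.2 fun j => ae_memLp_two_slice (h.memLp_g j), h.bound_u, h.bound_g, h.wGrad_u,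
    h.wGrad_sqrt] with t h1 h2 h3 h4 h5 h6 h7 h8 h9 h10 h11 h12
  exact ⟨h1, h2, h3, h4, h5, h6, h7, h8, h9, h10, h11, h12⟩

variable {s t : ℝ}

/-! ### Regularity at a good time -/

theorem IsGood.mem_Icc (h : IsGood T a b C ρ u D g r m t) : t ∈ Icc 0 T := Ioo_subset_Icc_self h.mem

theorem IsGood.memLp_rho (h : IsGood T a b C ρ u D g r m t) (p : ℝ≥0∞) : MemLp (ρ t) p volume :=
  (memLp_top_of_mem_Icc h.meas h.bound).mono_exponent le_top

theorem IsGood.memLp_u_two (h : IsGood T a b C ρ u D g r m t) (i : Fin N) :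
    MemLp (u i t) 2 volume := memLp_two_of_four (h.memLp_u i)

theorem IsGood.memLp_gradPow (ha : 0 < a) (h : IsGood T a b C ρ u D g r m t) (β : ℝ) (j : Fin N) :
    MemLp (gradPow β ρ g j t) 2 volume :=
  DegenerateNS.memLp_gradPow ha β h.meas h.bound (h.memLp_g j)

theorem IsGood.memLp_pow (ha : 0 < a) (h : IsGood T a b C ρ u D g r m t) (β : ℝ) (p : ℝ≥0∞) :
    MemLp (fun x => ρ t x ^ β) p volume :=
  memLp_comp_of_contDiffAt (contDiffAt_rpow ha β) (measurable_rpow_const β) h.meas h.bound p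

theorem sqrt_rpow_two_mul {x : ℝ} (hx : 0 ≤ x) (β : ℝ) : √x ^ (2 * β) = x ^ β := by
  rw [Real.sqrt_eq_rpow, ← Real.rpow_mul hx]
  congr 1
  ring

/-- Write `ρ^β` as `(√ρ)^(2β)`: the chain rule is applied to `√ρ`, whose gradient is the given one,
on an interval away from zero. -/
theorem IsGood.wGrad_pow (ha : 0 < a) (h : IsGood T a b C ρ u D g r m t) (β : ℝ) :
    WGrad (fun x => ρ t x ^ β) fun j => gradPow β ρ g j t := by
  have h1 := h.wGrad_sqrt.comp (contDiffAt_rpow (Real.sqrt_pos.2 ha) (b := √b) (2 * β))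
    (measurable_rpow_const _) (Real.continuous_sqrt.comp_aestronglyMeasurable h.meas)
    (h.bound.mono fun x hx => sqrt_mem_Icc hx) h.memLp_g
  exact h1.congr_ae (h.bound.mono fun x hx => sqrt_rpow_two_mul (ha.le.trans hx.1) β)

theorem IsGood.wGrad_rho (ha : 0 < a) (h : IsGood T a b C ρ u D g r m t) :
    WGrad (r t) fun j => gradPow 1 ρ g j t :=
  (h.wGrad_pow ha 1).congr_ae (h.eq_rho.mono fun x hx => by simp [hx])

theorem toReal_eLpNorm_gradPow_le {β K : ℝ} (hK0 : 0 ≤ K) (hC : 0 ≤ C)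
    (hK : ∀ x ∈ Icc a b, |deriv (fun y : ℝ => y ^ (2 * β)) √x| ≤ K)
    (h : IsGood T a b C ρ u D g r m t) (j : Fin N) :
    (eLpNorm (gradPow β ρ g j t) 2 volume).toReal ≤ K * C := by
  refine ENNReal.toReal_le_of_le_ofReal (by positivity) ?_
  rw [ENNReal.ofReal_mul hK0]
  refine (eLpNorm_le_mul_eLpNorm_of_ae_le_mul (g := g j t) (c := K)
    (h.bound.mono fun x hx => ?_) 2).trans (mul_le_mul_right (h.bound_g j) _)
  rw [gradPow, norm_mul]
  exact mul_le_mul_of_nonneg_right (hK _ hx) (norm_nonneg _)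

theorem abs_integral_sum_mul_le {F G : Fin N → Torus N → ℝ} (hF : ∀ j, MemLp (F j) 2 volume)
    (hG : ∀ j, MemLp (G j) 2 volume) :
    |∫ x, ∑ j, F j x * G j x|
      ≤ ∑ j, (eLpNorm (F j) 2 volume).toReal * (eLpNorm (G j) 2 volume).toReal := by
  rw [integral_finsetSum _ fun j _ => integrable_mul_two (hF j) (hG j)]
  exact (Finset.abs_sum_le_sum_abs _ _).trans
    (Finset.sum_le_sum fun j _ => abs_integral_mul_le (hF j) (hG j))

theorem memLp_two_mass_flux (h : IsFlow T γ a b C ρ u D g) (j : Fin N) :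
    MemLp (Function.uncurry fun τ x => ρ τ x * u j τ x) 2 (spaceTime N T) :=
  (h.memLp_mass_flux j).mono_exponent (by norm_num)

/-- Hölder continuity in time of the density, between good times. -/
theorem exists_sq_rho_sub_le (hT : 0 < T) (h : IsFlow T γ a b C ρ u D g)
    (hv : IsVersion T ρ u r m) :
    ∃ K, ∀ s t, IsGood T a b C ρ u D g r m s → IsGood T a b C ρ u D g r m t →
      ∫ x, (r t x - r s x) * (r t x - r s x) ≤ K * √|t - s| := by
  obtain ⟨K, hK0, hK⟩ := exists_deriv_rpow_bound (b := b) h.pos 1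
  set M : Fin N → ℝ := fun j =>
    (eLpNorm (Function.uncurry fun τ x => ρ τ x * u j τ x) 2 (spaceTime N T)).toReal with hM
  have main : ∀ s t, IsGood T a b C ρ u D g r m s → IsGood T a b C ρ u D g r m t → s ≤ t →
      ∫ x, (r t x - r s x) * (r t x - r s x) ≤ (2 * (K * C) * ∑ j, M j) * √(t - s) := by
    intro s t hs ht hst
    have hd := hv.wDiv_rho hT h hs.mem.1.le hst ht.mem.2.le
    have hB := fun j => (memLp_timeInt one_le_two (by simp) (memLp_two_mass_flux h j) hs.mem.1.le
      hst ht.mem.2.le).1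
    have hr := hv.memLp_rho t ht.mem_Icc
    have hr' := hv.memLp_rho s hs.mem_Icc
    -- The increment of the density is tested with the density at each of the two times. These have
    -- gradients in `L²` bounded independently of the time, while the integrated mass flux is of
    -- order `√(t - s)`.
    have e1 := hd.integral_eq (hr.sub hr') hB hr (ht.memLp_gradPow h.pos 1) (ht.wGrad_rho h.pos)
    have e2 := hd.integral_eq (hr.sub hr') hB hr' (hs.memLp_gradPow h.pos 1) (hs.wGrad_rho h.pos)
    have e3 : ∫ x, (r t x - r s x) * (r t x - r s x)
        = (∫ x, (r t x - r s x) * r t x) - ∫ x, (r t x - r s x) * r s x := by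
      have hdm : MemLp (fun x => r t x - r s x) 2 volume := hr.sub hr'
      rw [← integral_sub (integrable_mul_two hdm hr) (integrable_mul_two hdm hr')]
      exact integral_congr_ae (ae_of_all _ fun x => by simp only; ring)
    have bnd : ∀ τ, IsGood T a b C ρ u D g r m τ →
        |∫ x, ∑ j, timeInt (fun τ x => ρ τ x * u j τ x) s t x * gradPow 1 ρ g j τ x|
          ≤ (K * C * ∑ j, M j) * √(t - s) := by
      intro τ hτ
      refine (abs_integral_sum_mul_le hB (hτ.memLp_gradPow h.pos 1)).trans ?_
      rw [mul_comm (K * C), mul_assoc, Finset.sum_mul]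
      refine Finset.sum_le_sum fun j _ => ?_
      have l1 := eLpNorm_timeInt_two_le (memLp_two_mass_flux h j) hs.mem.1.le hst ht.mem.2.le
      have l2 := toReal_eLpNorm_gradPow_le hK0 h.nonneg hK hτ j
      calc _ ≤ (√(t - s) * M j) * (K * C) :=
            mul_le_mul l1 l2 ENNReal.toReal_nonneg (by positivity)
        _ = _ := by ring
    rw [e3, e1, e2]
    have b1 := (abs_le.1 (bnd t ht)).2
    have b2 := (abs_le.1 (bnd s hs)).1
    linarith
  refine ⟨2 * (K * C) * ∑ j, M j, fun s t hs ht => ?_⟩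
  rcases le_total s t with hst | hst
  · rw [abs_of_nonneg (by linarith)]
    exact main s t hs ht hst
  · have := main t s ht hs hst
    rw [abs_of_nonpos (by linarith), neg_sub]
    refine le_trans (le_of_eq (integral_congr_ae (ae_of_all _ fun x => ?_))) this
    simp only; ring

/-- Weak lower semicontinuity of the `L²` norm lets one of the two times be arbitrary in `[0, T]`,
where the density has no known gradient. -/
theorem exists_sq_rho_sub_le' (hT : 0 < T) (h : IsFlow T γ a b C ρ u D g)
    (hv : IsVersion T ρ u r m) :
    ∃ K, ∀ s t, IsGood T a b C ρ u D g r m s → t ∈ Icc 0 T →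
      ∫ x, (r t x - r s x) * (r t x - r s x) ≤ K * √|t - s| := by
  obtain ⟨K, hK⟩ := exists_sq_rho_sub_le hT h hv
  refine ⟨K, fun s t hs ht => ?_⟩
  have hne := nearTimes_neBot hT ht
  have hr := hv.memLp_rho t ht
  have hr' := hv.memLp_rho s hs.mem_Icc
  set w : Torus N → ℝ := fun x => r t x - r s x with hw
  have hwm : MemLp w 2 volume := hr.sub hr'
  have hcont : ContinuousOn (fun σ => (∫ x, r σ x * w x) - ∫ x, r s x * w x) (Icc 0 T) :=
    (hv.continuous_rho w hwm).sub continuousOn_const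
  have h1 := tendsto_nearTimes hcont ht
  have h2 : Tendsto (fun σ => 1 / 2 * (K * √|σ - s|) + 1 / 2 * ∫ x, w x * w x) (nearTimes T t)
      (𝓝 (1 / 2 * (K * √|t - s|) + 1 / 2 * ∫ x, w x * w x)) := by
    refine tendsto_nearTimes (f := fun σ => 1 / 2 * (K * √|σ - s|) + 1 / 2 * ∫ x, w x * w x) ?_ ht
    exact Continuous.continuousOn (by fun_prop)
  have h3 : ∀ᶠ σ in nearTimes T t, (∫ x, r σ x * w x) - ∫ x, r s x * w x
      ≤ 1 / 2 * (K * √|σ - s|) + 1 / 2 * ∫ x, w x * w x := by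
    filter_upwards [eventually_nearTimes (ae_isGood h hv) t] with σ hσ
    have hσm := hv.memLp_rho σ hσ.mem_Icc
    have hdm : MemLp (fun x => r σ x - r s x) 2 volume := hσm.sub hr'
    rw [← integral_sub (integrable_mul_two hσm hwm) (integrable_mul_two hr' hwm)]
    have h4 := hK s σ hs hσ
    calc ∫ x, (r σ x * w x - r s x * w x)
        ≤ ∫ x, (1 / 2 * ((r σ x - r s x) * (r σ x - r s x)) + 1 / 2 * (w x * w x)) := by
          refine integral_mono ((integrable_mul_two hσm hwm).sub (integrable_mul_two hr' hwm))
            (((integrable_mul_two hdm hdm).const_mul _).add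
              ((integrable_mul_two hwm hwm).const_mul _)) fun x => ?_
          simp only
          -- The inequality `2xy ≤ x² + y²`, with `y` the increment at the limit time; in the limit
          -- half of `∫ w²` is absorbed on the left.
          nlinarith [sq_nonneg (r σ x - r s x - w x)]
      _ = 1 / 2 * (∫ x, (r σ x - r s x) * (r σ x - r s x)) + 1 / 2 * ∫ x, w x * w x := by
          rw [integral_add ((integrable_mul_two hdm hdm).const_mul _)
            ((integrable_mul_two hwm hwm).const_mul _), integral_const_mul, integral_const_mul]
      _ ≤ _ := by linarith
  have h5 := le_of_tendsto_of_tendsto h1 h2 h3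
  have h6 : (∫ x, r t x * w x) - ∫ x, r s x * w x = ∫ x, w x * w x := by
    rw [← integral_sub (integrable_mul_two hr hwm) (integrable_mul_two hr' hwm)]
    exact integral_congr_ae (ae_of_all _ fun x => by simp only [hw]; ring)
  linarith

/-- Strong continuity of the density in `L²`. -/
theorem tendsto_eLpNorm_rho_sub (hT : 0 < T) (h : IsFlow T γ a b C ρ u D g)
    (hv : IsVersion T ρ u r m) (ht : t ∈ Icc 0 T) :
    Tendsto (fun s => (eLpNorm (fun x => r t x - ρ s x) 2 volume).toReal) (nearTimes T t)
      (𝓝 0) := by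
  obtain ⟨K, hK⟩ := exists_sq_rho_sub_le' hT h hv
  have h0 : Tendsto (fun s => √(K * √|t - s|)) (nearTimes T t) (𝓝 0) := by
    have := tendsto_nearTimes (T := T) (f := fun s => √(K * √|t - s|))
      (Continuous.continuousOn (by fun_prop)) ht
    simpa using this
  refine tendsto_of_tendsto_of_tendsto_of_le_of_le' tendsto_const_nhds h0
    (Eventually.of_forall fun _ => ENNReal.toReal_nonneg) ?_
  filter_upwards [eventually_nearTimes (ae_isGood h hv) t] with s hs
  have e : eLpNorm (fun x => r t x - ρ s x) 2 volume
      = eLpNorm (fun x => r t x - r s x) 2 volume :=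
    eLpNorm_congr_ae (hs.eq_rho.mono fun x hx => by simp only [hx])
  rw [e]
  refine Real.le_sqrt_of_sq_le ?_
  have hm : MemLp (fun x => r t x - r s x) 2 volume :=
    (hv.memLp_rho t ht).sub (hv.memLp_rho s hs.mem_Icc)
  rw [eLpNorm_two_toReal_sq hm]
  exact hK s t hs ht

theorem tendsto_integral_mul_of_denseSmooth {ι : Type*} {l : Filter ι} {U : ι → Torus N → ℝ}
    {U₀ : Torus N → ℝ} {K : ℝ} (hU : ∀ᶠ s in l, MemLp (U s) 2 volume ∧
      eLpNorm (U s) 2 volume ≤ ENNReal.ofReal K) (hU₀ : MemLp U₀ 2 volume)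
    (h : ∀ n, Tendsto (fun s => ∫ x, U s x * denseSmooth N n x) l
      (𝓝 (∫ x, U₀ x * denseSmooth N n x))) {ψ : Torus N → ℝ} (hψ : MemLp ψ 2 volume) :
    Tendsto (fun s => ∫ x, U s x * ψ x) l (𝓝 (∫ x, U₀ x * ψ x)) := by
  rw [Metric.tendsto_nhds]
  intro ε hε
  set L := |K| + (eLpNorm U₀ 2 volume).toReal + 1 with hL
  have hLpos : 0 < L := by positivity
  obtain ⟨n, hn⟩ := exists_denseSmooth_two hψ (ε := ENNReal.ofReal (ε / (2 * L)))
    (by simpa using by positivity)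
  have hd := (isSmooth_denseSmooth (N := N) n).memLp 2
  have hδ : (eLpNorm (ψ - denseSmooth N n) 2 volume).toReal ≤ ε / (2 * L) :=
    ENNReal.toReal_le_of_le_ofReal (by positivity) hn
  have split : ∀ V : Torus N → ℝ, MemLp V 2 volume → |(∫ x, V x * ψ x)
      - ∫ x, V x * denseSmooth N n x| ≤ (eLpNorm V 2 volume).toReal * (ε / (2 * L)) := by
    intro V hV
    rw [← integral_sub (integrable_mul_two hV hψ) (integrable_mul_two hV hd)]
    simp_rw [← mul_sub]
    exact (abs_integral_mul_le hV (hψ.sub hd)).trans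
      (mul_le_mul_of_nonneg_left hδ ENNReal.toReal_nonneg)
  have hε2 : 0 < ε / 2 := by positivity
  filter_upwards [hU, (Metric.tendsto_nhds.1 (h n)) (ε / 2) hε2] with s hs hs'
  have b1 := split _ hs.1
  have b2 := split _ hU₀
  have b3 : (eLpNorm (U s) 2 volume).toReal ≤ |K| :=
    ENNReal.toReal_le_of_le_ofReal (abs_nonneg K)
      (hs.2.trans (ENNReal.ofReal_le_ofReal (le_abs_self K)))
  rw [Real.dist_eq] at hs' ⊢
  have b4 : (eLpNorm (U s) 2 volume).toReal * (ε / (2 * L)) +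
      (eLpNorm U₀ 2 volume).toReal * (ε / (2 * L)) < ε / 2 := by
    rw [← add_mul, ← mul_div_assoc, div_lt_iff₀ (by positivity)]
    have : (eLpNorm (U s) 2 volume).toReal + (eLpNorm U₀ 2 volume).toReal < L := by
      rw [hL]; linarith
    nlinarith
  rw [abs_le] at b1 b2
  rw [abs_lt] at hs' ⊢
  constructor <;> linarith [b1.1, b1.2, b2.1, b2.2, hs'.1, hs'.2]

theorem memLp_div_of_bound {p : ℝ≥0∞} {f R : Torus N → ℝ} (ha : 0 < a) (hf : MemLp f p volume)
    (hR : AEStronglyMeasurable R volume) (hb : ∀ᵐ x, R x ∈ Icc a b) :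
    MemLp (fun x => f x / R x) p volume := by
  have h1 : MemLp (fun x => (R x)⁻¹) ⊤ volume := by
    refine memLp_top_of_bound hR.inv₀ a⁻¹ (hb.mono fun x hx => ?_)
    rw [norm_inv, Real.norm_of_nonneg (ha.le.trans hx.1)]
    exact inv_anti₀ ha hx.1
  simp_rw [div_eq_inv_mul]
  exact memLp_top_mul h1 hf

/-- Weak convergence of the velocity. -/
theorem tendsto_integral_u (hT : 0 < T) (h : IsFlow T γ a b C ρ u D g)
    (hv : IsVersion T ρ u r m) (ht : t ∈ Icc 0 T) (i : Fin N) {ψ : Torus N → ℝ}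
    (hψ : MemLp ψ 2 volume) :
    Tendsto (fun s => ∫ x, u i s x * ψ x) (nearTimes T t)
      (𝓝 (∫ x, m i t x / r t x * ψ x)) := by
  have hrb := hv.bound hT h ht
  have hrm := (hv.memLp_rho t ht).1
  have hgood := eventually_nearTimes (ae_isGood h hv) t
  refine tendsto_integral_mul_of_denseSmooth (K := C)
    (hgood.mono fun s hs => ⟨hs.memLp_u_two i, hs.bound_u i⟩)
    (memLp_div_of_bound h.pos (hv.memLp_m i t ht) hrm hrb) (fun n => ?_) hψ
  have sd := isSmooth_denseSmooth (N := N) n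
  set d := denseSmooth N n with hd
  obtain ⟨M, hM⟩ := sd.exists_bound
  have hM0 : 0 ≤ M := (norm_nonneg _).trans (hM 0)
  have hψ' : MemLp (fun x => d x / r t x) 2 volume := memLp_div_of_bound h.pos (sd.memLp 2) hrm hrb
  have t1 := tendsto_nearTimes (hv.continuous_m i _ hψ') ht
  have e0 : ∀ x, m i t x / r t x * d x = m i t x * (d x / r t x) := fun x => by ring
  simp_rw [e0]
  -- Since `m(s) = ρ(s) u(s)`, the difference is the integral of `u(s) d (r(t) - ρ(s)) / r(t)`. A
  -- bounded velocity meets a density that converges strongly, so only the weakly continuous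
  -- momentum remains, tested with `d / r(t)`.
  have t2 : Tendsto (fun s => (∫ x, u i s x * d x) - ∫ x, m i s x * (d x / r t x)) (nearTimes T t)
      (𝓝 0) := by
    have t3 := (tendsto_eLpNorm_rho_sub hT h hv ht).const_mul (C * (M / a))
    rw [mul_zero] at t3
    refine squeeze_zero_norm' ?_ t3
    filter_upwards [hgood] with s hs
    have hrs : MemLp (fun x => r t x - ρ s x) 2 volume := (hv.memLp_rho t ht).sub (hs.memLp_rho 2)
    have hle : ∀ᵐ x, ‖d x / r t x * (r t x - ρ s x)‖ ≤ M / a * ‖r t x - ρ s x‖ := by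
      filter_upwards [hrb] with x hx
      rw [norm_mul, norm_div, Real.norm_of_nonneg (h.pos.le.trans hx.1)]
      refine mul_le_mul_of_nonneg_right ?_ (norm_nonneg _)
      exact div_le_div₀ hM0 (hM x) h.pos hx.1
    have hq : MemLp (fun x => d x / r t x * (r t x - ρ s x)) 2 volume :=
      MemLp.of_le_mul hrs (hψ'.1.mul hrs.1) hle
    have hnorm : (eLpNorm (fun x => d x / r t x * (r t x - ρ s x)) 2 volume).toReal
        ≤ M / a * (eLpNorm (fun x => r t x - ρ s x) 2 volume).toReal := by
      have := eLpNorm_le_mul_eLpNorm_of_ae_le_mul hle 2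
      have h2 := ENNReal.toReal_mono (ENNReal.mul_ne_top ENNReal.ofReal_ne_top hrs.2.ne) this
      rwa [ENNReal.toReal_mul, ENNReal.toReal_ofReal (div_nonneg hM0 h.pos.le)] at h2
    have eq : (∫ x, u i s x * d x) - ∫ x, m i s x * (d x / r t x)
        = ∫ x, u i s x * (d x / r t x * (r t x - ρ s x)) := by
      rw [← integral_sub (integrable_mul_two (hs.memLp_u_two i) (sd.memLp 2))
        (integrable_mul_two (hv.memLp_m i s hs.mem_Icc) hψ')]
      refine integral_congr_ae ?_
      filter_upwards [hs.eq_m i, hrb] with x h1 h2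
      have : r t x ≠ 0 := (h.pos.trans_le h2.1).ne'
      rw [h1]
      field_simp
    rw [eq]
    refine (abs_integral_mul_le (hs.memLp_u_two i) hq).trans ?_
    rw [mul_assoc]
    exact mul_le_mul (ENNReal.toReal_le_of_le_ofReal h.nonneg (hs.bound_u i)) hnorm
      ENNReal.toReal_nonneg h.nonneg
  have t4 := t2.add t1
  rw [zero_add] at t4
  exact t4.congr fun s => by ring

end GoodTimes

/-! ### Averages in time near an endpoint -/

section TimeAverages

variable {N : ℕ} {T : ℝ}

/-- The error need not be small at each time. Its second part carries the window length, which
cancels the averaging factor and leaves `c` times the integral of `d` over the window; that tends to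
zero by absolute continuity of the integral. -/
theorem tendsto_time_average {k d : ℝ → ℝ} {L : ℝ} {α β : ℕ → ℝ}
    (hα : ∀ n, 0 ≤ α n) (hαβ : ∀ n, α n < β n) (hβ : ∀ n, β n ≤ T)
    (h0 : Tendsto (fun n => β n - α n) atTop (𝓝 0)) (hk : IntegrableOn k (Ioo 0 T))
    (hd : IntegrableOn d (Ioo 0 T))
    (h : ∀ δ > 0, ∃ c, 0 ≤ c ∧ ∀ᶠ n in atTop, ∀ᵐ s ∂(volume.restrict (Ioo (α n) (β n))),
      |k s - L| ≤ δ + (β n - α n) * (c * d s)) :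
    Tendsto (fun n => (β n - α n)⁻¹ * ∫ s in (α n)..(β n), k s) atTop (𝓝 L) := by
  have hJ : ∀ n, Ioo (α n) (β n) ⊆ Ioo 0 T := fun n => Ioo_subset_Ioo (hα n) (hβ n)
  have hdz : Tendsto (fun n => ∫ s in Ioo (α n) (β n), d s) atTop (𝓝 0) := by
    have h1 := Integrable.tendsto_setIntegral_nhds_zero hd (s := fun n => Ioo (α n) (β n))
      (l := atTop) (by
        have h2 : Tendsto (fun n => ENNReal.ofReal (β n - α n)) atTop (𝓝 0) := by
          simpa using ENNReal.tendsto_ofReal h0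
        refine tendsto_of_tendsto_of_tendsto_of_le_of_le tendsto_const_nhds h2
          (fun _ => zero_le) fun n => ?_
        simp only [Function.comp]
        refine (Measure.restrict_apply_le _ _).trans ?_
        rw [Real.volume_Ioo])
    refine h1.congr fun n => ?_
    rw [Measure.restrict_restrict measurableSet_Ioo, inter_eq_left.2 (hJ n)]
  rw [Metric.tendsto_nhds]
  intro ε hε
  obtain ⟨c, hc, hcn⟩ := h (ε / 2) (by positivity)
  have hcd : ∀ᶠ n in atTop, c * ∫ s in Ioo (α n) (β n), d s < ε / 2 := by
    have := hdz.const_mul c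
    rw [mul_zero] at this
    exact this.eventually_lt_const (by positivity)
  filter_upwards [hcn, hcd] with n h1 h2
  have hpos : 0 < β n - α n := sub_pos.2 (hαβ n)
  have ik : IntegrableOn k (Ioo (α n) (β n)) := hk.mono_set (hJ n)
  have id : IntegrableOn d (Ioo (α n) (β n)) := hd.mono_set (hJ n)
  have ic : ∀ c : ℝ, IntegrableOn (fun _ => c) (Ioo (α n) (β n)) := fun c =>
    integrableOn_const (by simp)
  have vol : ∀ c : ℝ, ∫ _ in Ioo (α n) (β n), c = (β n - α n) * c := fun c => by
    rw [setIntegral_const, smul_eq_mul, Real.volume_real_Ioo_of_le (hαβ n).le]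
  rw [Real.dist_eq, intervalIntegral.integral_of_le (hαβ n).le, integral_Ioc_eq_integral_Ioo]
  have e : (β n - α n)⁻¹ * (∫ s in Ioo (α n) (β n), k s) - L
      = (β n - α n)⁻¹ * ∫ s in Ioo (α n) (β n), (k s - L) := by
    rw [integral_sub ik (ic L), vol]
    field_simp
  rw [e, abs_mul, abs_of_pos (inv_pos.2 hpos), inv_mul_lt_iff₀ hpos]
  calc |∫ s in Ioo (α n) (β n), (k s - L)| ≤ ∫ s in Ioo (α n) (β n), |k s - L| :=
        abs_integral_le_integral_abs
    _ ≤ ∫ s in Ioo (α n) (β n), (ε / 2 + (β n - α n) * (c * d s)) :=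
        integral_mono_ae (ik.sub (ic L)).abs ((ic _).add ((id.const_mul c).const_mul _)) h1
    _ = (β n - α n) * (ε / 2 + c * ∫ s in Ioo (α n) (β n), d s) := by
        rw [integral_add (ic _) ((id.const_mul c).const_mul _), vol, integral_const_mul,
          integral_const_mul]
        ring
    _ < _ := mul_lt_mul_of_pos_left (by linarith) hpos

theorem eventually_ae_of_nearTimes {p : ℝ → Prop} {t : ℝ} (h : ∀ᶠ s in nearTimes T t, p s)
    {α β : ℕ → ℝ} (hα : ∀ n, 0 ≤ α n) (hβ : ∀ n, β n ≤ T) (hαt : ∀ n, α n ≤ t)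
    (hβt : ∀ n, t ≤ β n) (h0 : Tendsto (fun n => β n - α n) atTop (𝓝 0)) :
    ∀ᶠ n in atTop, ∀ᵐ s ∂(volume.restrict (Ioo (α n) (β n))), p s := by
  obtain ⟨U, hU, V, hV, hUV⟩ := mem_inf_iff.1 h
  obtain ⟨ε, hε, hball⟩ := Metric.mem_nhdsWithin_iff.1 hU
  filter_upwards [h0.eventually_lt_const hε] with n hn
  rw [ae_restrict_iff' measurableSet_Ioo]
  filter_upwards [hV] with s hs hsJ
  have : s ∈ U ∩ V := by
    refine ⟨hball ⟨?_, (hα n).trans_lt hsJ.1, hsJ.2.trans_le (hβ n)⟩, hs⟩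
    rw [Metric.mem_ball, Real.dist_eq, abs_lt]
    constructor <;> linarith [hsJ.1, hsJ.2, hαt n, hβt n]
  rw [← hUV] at this
  exact this

/-- Increments of a function in terms of the limit of difference quotients. -/
theorem integral_le_sub_of_increments {k α : ℝ → ℝ} {a : ℕ → ℝ → ℝ} {h : ℕ → ℝ} {β k₀ k₁ : ℝ}
    (hk : IntegrableOn k (Ioo 0 T)) (hβT : β ≤ T) (hpos : ∀ n, 0 < h n)
    (hle : ∀ n, h n ≤ β) (h0 : Tendsto h atTop (𝓝 0)) (ha : TendstoLp volume 1 atTop a α)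
    (hinc : ∀ n, ∀ᵐ t ∂(volume.restrict (Ioo 0 (T - h n))), h n * a n t ≤ k (t + h n) - k t)
    (hl : Tendsto (fun n => (h n)⁻¹ * ∫ s in (β - h n)..β, k s) atTop (𝓝 k₁))
    (hr : Tendsto (fun n => (h n)⁻¹ * ∫ s in (0 : ℝ)..(h n), k s) atTop (𝓝 k₀)) :
    ∫ t in (0 : ℝ)..β, α t ≤ k₁ - k₀ := by
  have hαi : Integrable α := memLp_one_iff_integrable.1 ha.memLp_lim
  have hai : ∀ n, Integrable (a n) := fun n => memLp_one_iff_integrable.1 (ha.memLp n)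
  have hki : ∀ x y, 0 ≤ x → x ≤ y → y ≤ T → IntervalIntegrable k volume x y := by
    intro x y hx hxy hy
    rw [intervalIntegrable_iff_integrableOn_Ioo_of_le hxy]
    exact hk.mono_set (Ioo_subset_Ioo hx hy)
  have t1 : Tendsto (fun n => ∫ t in (0 : ℝ)..(β - h n), α t) atTop (𝓝 (∫ t in (0 : ℝ)..β, α t)) := by
    have hc : Continuous fun x => ∫ t in (0 : ℝ)..x, α t :=
      intervalIntegral.continuous_primitive (fun _ _ => hαi.intervalIntegrable) 0
    have h1 : Tendsto (fun n => β - h n) atTop (𝓝 β) := by simpa using tendsto_const_nhds.sub h0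
    exact (hc.tendsto β).comp h1
  have t2 : Tendsto (fun n => (∫ t in (0 : ℝ)..(β - h n), a n t)
      - ∫ t in (0 : ℝ)..(β - h n), α t) atTop (𝓝 0) := by
    have h1 : Tendsto (fun n => (eLpNorm (a n - α) 1 volume).toReal) atTop (𝓝 0) := by
      have := (ENNReal.tendsto_toReal ENNReal.zero_ne_top).comp ha.tendsto
      rwa [ENNReal.toReal_zero] at this
    refine squeeze_zero_norm (fun n => ?_) h1
    rw [← intervalIntegral.integral_sub (hai n).intervalIntegrable hαi.intervalIntegrable,
      intervalIntegral.integral_of_le (sub_nonneg.2 (hle n))]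
    refine (norm_integral_le_integral_norm _).trans ?_
    rw [eLpNorm_one_eq_lintegral_enorm, ← integral_norm_eq_lintegral_enorm
      ((hai n).sub hαi).1]
    exact setIntegral_le_integral ((hai n).sub hαi).norm (ae_of_all _ fun _ => norm_nonneg _)
  have t3 := t2.add t1
  rw [zero_add] at t3
  refine le_of_tendsto_of_tendsto' t3 (hl.sub hr) fun n => ?_
  rw [sub_add_cancel]
  have hb : 0 ≤ β - h n := sub_nonneg.2 (hle n)
  have hp := hpos n
  have i1 := hki (h n) β hp.le (hle n) hβT
  have i2 := hki 0 (β - h n) le_rfl hb (by linarith)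
  have i3 := hki (β - h n) β hb (by linarith) hβT
  have i4 := hki 0 (h n) le_rfl hp.le ((hle n).trans hβT)
  have i5 : IntervalIntegrable (fun t => k (t + h n)) volume 0 (β - h n) := by
    have := i1.comp_add_right (h n)
    simpa using this
  -- After this shift the integrals of `k(t + h)` and `k(t)` cancel on their overlap, and only the
  -- windows of length `h` at the two ends survive.
  have e1 : ∫ t in (0 : ℝ)..(β - h n), k (t + h n) = ∫ t in (h n)..β, k t := by
    rw [intervalIntegral.integral_comp_add_right]
    simp
  have e2 := intervalIntegral.integral_add_adjacent_intervals i4 i1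
  have e3 := intervalIntegral.integral_add_adjacent_intervals i2 i3
  have h1 : ∫ t in (0 : ℝ)..(β - h n), h n * a n t
      ≤ ∫ t in (0 : ℝ)..(β - h n), (k (t + h n) - k t) := by
    rw [intervalIntegral.integral_of_le hb, intervalIntegral.integral_of_le hb,
      integral_Ioc_eq_integral_Ioo, integral_Ioc_eq_integral_Ioo]
    refine integral_mono_ae ((hai n).const_mul _).integrableOn ?_ ?_
    · exact (intervalIntegrable_iff_integrableOn_Ioo_of_le hb).1 (i5.sub i2)
    · exact ae_restrict_of_ae_restrict_of_subset (Ioo_subset_Ioo_right (by linarith)) (hinc n)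
  rw [intervalIntegral.integral_const_mul, intervalIntegral.integral_sub i5 i2, e1] at h1
  rw [← mul_sub, le_inv_mul_iff₀ hp]
  linarith

/-- Integration in space of functions that converge in `L¹` of space-time. -/
theorem TendstoLp.integral_slice {A : ℕ → ℝ × Torus N → ℝ} {A₀ : ℝ × Torus N → ℝ}
    (h : TendstoLp volume 1 atTop A A₀) :
    TendstoLp volume 1 atTop (fun n t => ∫ x, A n (t, x)) (fun t => ∫ x, A₀ (t, x)) := by
  have hi : ∀ {B : ℝ × Torus N → ℝ}, MemLp B 1 volume → Integrable B (volume.prod volume) :=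
    fun hB => memLp_one_iff_integrable.1 hB
  refine ⟨fun n => memLp_one_iff_integrable.2 (hi (h.memLp n)).integral_prod_left,
    memLp_one_iff_integrable.2 (hi h.memLp_lim).integral_prod_left, ?_⟩
  refine tendsto_of_tendsto_of_tendsto_of_le_of_le tendsto_const_nhds h.tendsto
    (fun _ => zero_le) fun n => ?_
  have hm := ((h.memLp n).sub h.memLp_lim).1
  have e : ((fun t => ∫ x, A n (t, x)) - fun t => ∫ x, A₀ (t, x))
      =ᵐ[volume] fun t => ∫ x, (A n - A₀) (t, x) := by
    filter_upwards [(hi (h.memLp n)).prod_right_ae, (hi h.memLp_lim).prod_right_ae] with t h1 h2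
    exact (integral_sub h1 h2).symm
  have := eLpNorm_integral_le (μ := (volume : Measure ℝ)) (ν := (volume : Measure (Torus N)))
    le_rfl (by simp) (f := fun t x => (A n - A₀) (t, x)) hm
  simp only [ENNReal.toReal_one, ENNReal.rpow_one] at this
  rw [eLpNorm_congr_ae e]
  refine this.trans (le_of_eq ?_)
  simp_rw [eLpNorm_one_eq_lintegral_enorm]
  exact (lintegral_prod_symm (μ := (volume : Measure ℝ)) (ν := (volume : Measure (Torus N)))
    _ hm.enorm).symm

end TimeAverages

/-! ### Translations and averages in time -/

section TimeShift

variable {N : ℕ} {T : ℝ}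

instance : Measure.IsAddHaarMeasure (volume : Measure (ℝ × Torus N)) :=
  Measure.prod.instIsAddHaarMeasure _ _

instance : Measure.Regular (volume : Measure (ℝ × Torus N)) :=
  Measure.Regular.of_sigmaCompactSpace_of_isLocallyFiniteMeasure _

/-- The extension by zero of a function on `(0,T) × 𝕋^N`. -/
def zeroExt (T : ℝ) (f : ℝ → Torus N → ℝ) : ℝ × Torus N → ℝ :=
  (Ioo 0 T ×ˢ univ).indicator (Function.uncurry f)

theorem zeroExt_apply {t : ℝ} (ht : t ∈ Ioo 0 T) (f : ℝ → Torus N → ℝ) (x : Torus N) :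
    zeroExt T f (t, x) = f t x := by
  rw [zeroExt, indicator_of_mem (by exact ⟨ht, mem_univ x⟩)]
  rfl

theorem spaceTime_eq_restrict : spaceTime N T = volume.restrict (Ioo 0 T ×ˢ univ) := by
  rw [spaceTime, Measure.volume_eq_prod, ← Measure.prod_restrict, Measure.restrict_univ]

theorem memLp_zeroExt {p : ℝ≥0∞} {f : ℝ → Torus N → ℝ}
    (hf : MemLp (Function.uncurry f) p (spaceTime N T)) : MemLp (zeroExt T f) p volume := by
  rw [spaceTime_eq_restrict] at hf
  exact (memLp_indicator_iff_restrict (measurableSet_Ioo.prod MeasurableSet.univ)).2 hf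

/-- The translation by `h` in time. -/
def shiftMeasure (N : ℕ) (h : ℝ) : Measure (ℝ × Torus N) := Measure.dirac (h, 0)

instance (h : ℝ) : IsProbabilityMeasure (shiftMeasure N h) := by
  unfold shiftMeasure; infer_instance

/-- The uniform probability measure on `(0,h) × {0}`. -/
def steklovMeasure (N : ℕ) (h : ℝ) : Measure (ℝ × Torus N) :=
  (ProbabilityTheory.cond volume (Ioc 0 h)).map fun σ => (σ, (0 : Torus N))

theorem steklovMeasure_eq (h : ℝ) :
    steklovMeasure N h = ((ENNReal.ofReal h)⁻¹ • volume.restrict (Ioc 0 h)).map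
      fun σ : ℝ => (σ, (0 : Torus N)) := by
  rw [steklovMeasure, ProbabilityTheory.cond, Real.volume_Ioc, sub_zero]

theorem isProbabilityMeasure_steklovMeasure {h : ℝ} (hh : 0 < h) :
    IsProbabilityMeasure (steklovMeasure N h) := by
  have : IsProbabilityMeasure (ProbabilityTheory.cond (volume : Measure ℝ) (Ioc 0 h)) :=
    ProbabilityTheory.cond_isProbabilityMeasure_of_finite (by simpa using hh) (by simp)
  exact Measure.isProbabilityMeasure_map (by fun_prop)

theorem avg_shiftMeasure {h t : ℝ} (ht : t + h ∈ Ioo 0 T) (f : ℝ → Torus N → ℝ) (x : Torus N) :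
    avg (shiftMeasure N h) (zeroExt T f) (t, x) = f (t + h) x := by
  rw [avg, shiftMeasure, integral_dirac, Prod.mk_add_mk, add_zero, zeroExt_apply ht]

theorem avg_steklovMeasure {h t : ℝ} (hh : 0 < h) (ht : 0 < t) (ht' : t + h < T)
    (f : ℝ → Torus N → ℝ) (x : Torus N) :
    avg (steklovMeasure N h) (zeroExt T f) (t, x) = h⁻¹ * timeInt f t (t + h) x := by
  have hemb : MeasurableEmbedding fun σ : ℝ => (σ, (0 : Torus N)) := measurableEmbedding_prod_mk_right _
  rw [avg, steklovMeasure_eq, hemb.integral_map, integral_smul_measure, ENNReal.toReal_inv,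
    ENNReal.toReal_ofReal hh.le, smul_eq_mul, timeInt,
    ← intervalIntegral.integral_of_le hh.le]
  congr 1
  have e := intervalIntegral.integral_comp_add_left (a := 0) (b := h) (fun τ => f τ x) t
  rw [add_zero] at e
  rw [← e]
  refine intervalIntegral.integral_congr fun σ hσ => ?_
  rw [uIcc_of_le hh.le] at hσ
  simp only [Prod.mk_add_mk, add_zero]
  exact zeroExt_apply ⟨by linarith [hσ.1], by linarith [hσ.2]⟩ f x

variable {h : ℕ → ℝ}

theorem eventually_shiftMeasure (h0 : Tendsto h atTop (𝓝 0)) :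
    ∀ U ∈ 𝓝 (0 : ℝ × Torus N), ∀ᶠ n in atTop, ∀ᵐ y ∂(shiftMeasure N (h n)), y ∈ U := by
  intro U hU
  have hc : Tendsto (fun n => (h n, (0 : Torus N))) atTop (𝓝 0) := h0.prodMk_nhds tendsto_const_nhds
  filter_upwards [hc.eventually hU] with n hn
  rw [shiftMeasure, ae_dirac_eq]
  exact hn

theorem eventually_steklovMeasure (h0 : Tendsto h atTop (𝓝 0)) :
    ∀ U ∈ 𝓝 (0 : ℝ × Torus N), ∀ᶠ n in atTop, ∀ᵐ y ∂(steklovMeasure N (h n)), y ∈ U := by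
  intro U hU
  have hc : Tendsto (fun σ : ℝ => (σ, (0 : Torus N))) (𝓝 0) (𝓝 0) := by
    have : Continuous fun σ : ℝ => (σ, (0 : Torus N)) := by fun_prop
    exact this.tendsto 0
  obtain ⟨ε, hε, hb⟩ := Metric.eventually_nhds_iff.1 (hc.eventually hU)
  filter_upwards [h0.eventually_lt_const hε] with n hn
  rw [steklovMeasure_eq]
  have hemb : MeasurableEmbedding fun σ : ℝ => (σ, (0 : Torus N)) := measurableEmbedding_prod_mk_right _
  rw [hemb.ae_map_iff]
  refine Measure.ae_smul_measure ?_ _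
  filter_upwards [ae_restrict_mem measurableSet_Ioc] with σ hσ
  refine hb ?_
  rw [Real.dist_eq, sub_zero, abs_of_pos hσ.1]
  linarith [hσ.2]

theorem tendstoLp_shift (h0 : Tendsto h atTop (𝓝 0)) {p : ℝ≥0∞} (hp : 1 ≤ p) (hp' : p ≠ ⊤)
    {f : ℝ → Torus N → ℝ} (hf : MemLp (Function.uncurry f) p (spaceTime N T)) :
    TendstoLp volume p atTop (fun n => avg (shiftMeasure N (h n)) (zeroExt T f)) (zeroExt T f) :=
  tendstoLp_avg hp hp' (eventually_shiftMeasure h0) (memLp_zeroExt hf)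

theorem tendstoLp_steklov (hpos : ∀ n, 0 < h n) (h0 : Tendsto h atTop (𝓝 0)) {p : ℝ≥0∞}
    (hp : 1 ≤ p) (hp' : p ≠ ⊤)
    {f : ℝ → Torus N → ℝ} (hf : MemLp (Function.uncurry f) p (spaceTime N T)) :
    TendstoLp volume p atTop (fun n => avg (steklovMeasure N (h n)) (zeroExt T f)) (zeroExt T f) :=
  have := fun n => isProbabilityMeasure_steklovMeasure (N := N) (hpos n)
  tendstoLp_avg hp hp' (eventually_steklovMeasure h0) (memLp_zeroExt hf)

end TimeShift

/-! ### Limits of the energy at the endpoints -/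

section Endpoints

variable {N : ℕ} {T γ a b C : ℝ} {ρ : ℝ → Torus N → ℝ} {u : Fin N → ℝ → Torus N → ℝ}
  {D : Fin N → Fin N → ℝ → Torus N → ℝ} {g : Fin N → ℝ → Torus N → ℝ}
  {r : ℝ → Torus N → ℝ} {m : Fin N → ℝ → Torus N → ℝ} {t : ℝ}

theorem IsFlow.memLp_pow (h : IsFlow T γ a b C ρ u D g) (β : ℝ) (p : ℝ≥0∞) :
    MemLp (Function.uncurry fun s x => ρ s x ^ β) p (spaceTime N T) :=
  memLp_comp_of_contDiffAt (contDiffAt_rpow h.pos β) (measurable_rpow_const β) h.meas_rho h.bound p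

theorem IsFlow.integrableOn_pow (h : IsFlow T γ a b C ρ u D g) (β : ℝ) :
    IntegrableOn (fun s => ∫ x, ρ s x ^ β) (Ioo 0 T) :=
  (memLp_one_iff_integrable.1 (h.memLp_pow β 1)).integral_prod_left

theorem IsFlow.integrableOn_kinetic (h : IsFlow T γ a b C ρ u D g) (i : Fin N) :
    IntegrableOn (fun s => ∫ x, ρ s x * u i s x * u i s x) (Ioo 0 T) :=
  ((memLp_two_mul (h.memLp_mass_flux i) (h.memLp_u i)).integrable one_le_two).integral_prod_left

theorem IsFlow.integrableOn_gradient (h : IsFlow T γ a b C ρ u D g) (i j : Fin N) :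
    IntegrableOn (fun s => ∫ x, D i j s x * D i j s x) (Ioo 0 T) :=
  (integrable_mul_two (h.memLp_D i j) (h.memLp_D i j)).integral_prod_left

theorem tendsto_integral_pow (hT : 0 < T) (h : IsFlow T γ a b C ρ u D g)
    (hv : IsVersion T ρ u r m) (ht : t ∈ Icc 0 T) (β : ℝ) :
    Tendsto (fun s => ∫ x, ρ s x ^ β) (nearTimes T t) (𝓝 (∫ x, r t x ^ β)) := by
  obtain ⟨L, hL⟩ := exists_lipschitz_of_contDiffAt (contDiffAt_rpow (b := b) h.pos β)
  have hrb := hv.bound hT h ht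
  have hr := hv.memLp_rho t ht
  have hrp : MemLp (fun x => r t x ^ β) 2 volume :=
    memLp_comp_of_contDiffAt (contDiffAt_rpow h.pos β) (measurable_rpow_const β) hr.1 hrb 2
  have t0 := (tendsto_eLpNorm_rho_sub hT h hv ht).const_mul |L|
  rw [mul_zero] at t0
  rw [tendsto_iff_dist_tendsto_zero]
  refine squeeze_zero' (Eventually.of_forall fun _ => dist_nonneg) ?_ t0
  filter_upwards [eventually_nearTimes (ae_isGood h hv) t] with s hs
  have hd : MemLp (fun x => r t x - ρ s x) 2 volume := hr.sub (hs.memLp_rho 2)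
  have h1 : MemLp (fun _ : Torus N => (1 : ℝ)) 2 volume := memLp_const 1
  rw [Real.dist_eq, ← integral_sub (integrable_of_memLp_two (hs.memLp_pow h.pos β 2))
    (integrable_of_memLp_two hrp)]
  have e1 : (eLpNorm (fun _ : Torus N => (1 : ℝ)) 2 volume).toReal = 1 := by
    rw [eLpNorm_const _ (by simp) (IsProbabilityMeasure.ne_zero _)]; simp
  calc |∫ x, (ρ s x ^ β - r t x ^ β)| ≤ ∫ x, |ρ s x ^ β - r t x ^ β| :=
        abs_integral_le_integral_abs
    _ ≤ ∫ x, |L| * |r t x - ρ s x| := by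
        refine integral_mono_ae ((integrable_of_memLp_two (hs.memLp_pow h.pos β 2)).sub
          (integrable_of_memLp_two hrp)).abs ((integrable_of_memLp_two hd).abs.const_mul _) ?_
        filter_upwards [hrb, hs.bound] with x h2 h3
        refine (hL _ h2 _ h3).trans ?_
        rw [abs_sub_comm]
        exact mul_le_mul_of_nonneg_right (le_abs_self L) (abs_nonneg _)
    _ = |L| * ∫ x, |r t x - ρ s x| * 1 := by rw [integral_const_mul]; simp
    _ ≤ |L| * (eLpNorm (fun x => r t x - ρ s x) 2 volume).toReal := by
        refine mul_le_mul_of_nonneg_left ?_ (abs_nonneg L)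
        have := (le_abs_self _).trans (abs_integral_mul_le hd.abs h1)
        rw [e1, mul_one] at this
        exact this.trans_eq (congrArg _ (eLpNorm_norm fun x => r t x - ρ s x))

/-- The momentum increment tested with the velocity. -/
theorem abs_integral_increment_le (hT : 0 < T) (h : IsFlow T γ a b C ρ u D g)
    (hv : IsVersion T ρ u r m) (ht : t ∈ Icc 0 T) {s ℓ : ℝ} (hs : IsGood T a b C ρ u D g r m s)
    (hℓ : |t - s| ≤ ℓ) (i : Fin N) :
    |∫ x, (m i s x - m i t x) * u i s x| ≤ ∑ j, √ℓ *
      (eLpNorm (Function.uncurry (flux γ ρ u D i j)) 2 (spaceTime N T)).toReal *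
        (eLpNorm (D i j s) 2 volume).toReal := by
  have main : ∀ σ τ, 0 ≤ σ → σ ≤ τ → τ ≤ T → |t - s| = τ - σ →
      |∫ x, (m i τ x - m i σ x) * u i s x| ≤ ∑ j, √ℓ *
        (eLpNorm (Function.uncurry (flux γ ρ u D i j)) 2 (spaceTime N T)).toReal *
          (eLpNorm (D i j s) 2 volume).toReal := by
    intro σ τ hσ hστ hτ he
    have hB := fun j => (memLp_timeInt one_le_two (by simp) (h.memLp_flux i j) hσ hστ hτ).1
    rw [(hv.wDiv_m hT h i hσ hστ hτ).integral_eq ((hv.memLp_m i τ ⟨hσ.trans hστ, hτ⟩).sub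
      (hv.memLp_m i σ ⟨hσ, hστ.trans hτ⟩)) hB (hs.memLp_u_two i) (hs.memLp_D i) (hs.wGrad_u i)]
    refine (abs_integral_sum_mul_le hB (hs.memLp_D i)).trans (Finset.sum_le_sum fun j _ => ?_)
    refine mul_le_mul_of_nonneg_right ?_ ENNReal.toReal_nonneg
    refine (eLpNorm_timeInt_two_le (h.memLp_flux i j) hσ hστ hτ).trans ?_
    exact mul_le_mul_of_nonneg_right (Real.sqrt_le_sqrt (he ▸ hℓ)) ENNReal.toReal_nonneg
  rcases le_total t s with hts | hst
  · exact main t s ht.1 hts hs.mem.2.le (by rw [abs_of_nonpos (by linarith)]; ring)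
  · have := main s t hs.mem.1.le hst ht.2 (abs_of_nonneg (by linarith))
    refine le_trans (le_of_eq ?_) this
    rw [← abs_neg, ← integral_neg]
    congr 1
    exact integral_congr_ae (ae_of_all _ fun x => by simp only; ring)

variable {α β : ℕ → ℝ}

theorem tendsto_average_pow (hT : 0 < T) (h : IsFlow T γ a b C ρ u D g)
    (hv : IsVersion T ρ u r m) (ht : t ∈ Icc 0 T) (θ : ℝ)
    (hα : ∀ n, 0 ≤ α n) (hαβ : ∀ n, α n < β n) (hβ : ∀ n, β n ≤ T) (hαt : ∀ n, α n ≤ t)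
    (hβt : ∀ n, t ≤ β n) (h0 : Tendsto (fun n => β n - α n) atTop (𝓝 0)) :
    Tendsto (fun n => (β n - α n)⁻¹ * ∫ s in (α n)..(β n), ∫ x, ρ s x ^ θ) atTop
      (𝓝 (∫ x, r t x ^ θ)) := by
  refine tendsto_time_average hα hαβ hβ h0 (h.integrableOn_pow θ)
    (integrableOn_const (C := (0 : ℝ)) (by simp)) fun δ hδ => ⟨0, le_rfl, ?_⟩
  filter_upwards [eventually_ae_of_nearTimes (Metric.tendsto_nhds.1
    (tendsto_integral_pow hT h hv ht θ) δ hδ) hα hβ hαt hβt h0] with n hn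
  filter_upwards [hn] with s hs
  simpa [Real.dist_eq] using hs.le

/-- Weak convergence of `u` alone would give only an inequality. Split the kinetic energy at `s`
into the integral of `u(s) m(t)`, which converges weakly, and that of `(m(s) - m(t)) u(s)`. The
latter is at most a sum of terms `√ℓ M ‖∇u(s)‖`, with `ℓ` the window length; Young's inequality
turns this into a small constant plus `ℓ` times an integrable function of `s`. -/
theorem tendsto_average_kinetic (hT : 0 < T) (h : IsFlow T γ a b C ρ u D g)
    (hv : IsVersion T ρ u r m) (ht : t ∈ Icc 0 T) (i : Fin N)
    (hα : ∀ n, 0 ≤ α n) (hαβ : ∀ n, α n < β n) (hβ : ∀ n, β n ≤ T) (hαt : ∀ n, α n ≤ t)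
    (hβt : ∀ n, t ≤ β n) (h0 : Tendsto (fun n => β n - α n) atTop (𝓝 0)) :
    Tendsto (fun n => (β n - α n)⁻¹ * ∫ s in (α n)..(β n), ∫ x, ρ s x * u i s x * u i s x) atTop
      (𝓝 (∫ x, m i t x / r t x * m i t x)) := by
  refine tendsto_time_average hα hαβ hβ h0 (h.integrableOn_kinetic i)
    (d := fun s => ∑ j, ∫ x, D i j s x * D i j s x)
    (integrable_finsetSum _ fun j _ => h.integrableOn_gradient i j) fun δ hδ => ?_
  set M : Fin N → ℝ := fun j =>
    (eLpNorm (Function.uncurry (flux γ ρ u D i j)) 2 (spaceTime N T)).toReal with hM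
  set S := ∑ j, M j ^ 2 with hS
  have hS0 : 0 ≤ S := Finset.sum_nonneg fun j _ => sq_nonneg _
  -- The Young parameter makes the constant part `ε S` at most `δ/2`; the `+ 1` guards against `S =
  -- 0`.
  set ε := δ / (2 * (S + 1)) with hε
  have hεpos : 0 < ε := by positivity
  have hεS : ε * S ≤ δ / 2 := by
    rw [hε, div_mul_eq_mul_div, div_le_div_iff₀ (by positivity) (by positivity)]
    nlinarith
  refine ⟨ε⁻¹, by positivity, ?_⟩
  have hmt := hv.memLp_m i t ht
  have e1 : ∀ᶠ s in nearTimes T t, |(∫ x, u i s x * m i t x) - ∫ x, m i t x / r t x * m i t x|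
      ≤ δ / 2 := by
    filter_upwards [Metric.tendsto_nhds.1 (tendsto_integral_u hT h hv ht i hmt) (δ / 2)
      (by positivity)] with s hs
    exact hs.le
  have e2 := e1.and (eventually_nearTimes (ae_isGood h hv) t)
  filter_upwards [eventually_ae_of_nearTimes e2 hα hβ hαt hβt h0] with n hn
  filter_upwards [hn, ae_restrict_mem measurableSet_Ioo] with s ⟨h1, hs⟩ hsJ
  have hms := hv.memLp_m i s hs.mem_Icc
  have hu := hs.memLp_u_two i
  have hℓ : |t - s| ≤ β n - α n :=
    abs_le.2 ⟨by linarith [hsJ.2, hαt n], by linarith [hsJ.1, hβt n]⟩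
  have h2 := abs_integral_increment_le hT h hv ht hs hℓ i
  have hdm : MemLp (fun x => m i s x - m i t x) 2 volume := hms.sub hmt
  have e3 : ∫ x, ρ s x * u i s x * u i s x
      = (∫ x, u i s x * m i t x) + ∫ x, (m i s x - m i t x) * u i s x := by
    rw [← integral_add (integrable_mul_two hu hmt) (integrable_mul_two hdm hu)]
    refine integral_congr_ae ?_
    filter_upwards [hs.eq_m i] with x hx
    rw [hx]; ring
  have hℓ0 : 0 ≤ β n - α n := (sub_pos.2 (hαβ n)).le
  have h3 : ∑ j, √(β n - α n) * M j * (eLpNorm (D i j s) 2 volume).toReal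
      ≤ ε * S + (β n - α n) * (ε⁻¹ * ∑ j, ∫ x, D i j s x * D i j s x) := by
    rw [hS, Finset.mul_sum, Finset.mul_sum, Finset.mul_sum, ← Finset.sum_add_distrib]
    refine Finset.sum_le_sum fun j _ => ?_
    rw [← eLpNorm_two_toReal_sq (hs.memLp_D i j)]
    set y := (eLpNorm (D i j s) 2 volume).toReal
    set q := √(β n - α n) with hq
    rw [← Real.sq_sqrt hℓ0, ← hq]
    -- This sum of squares, multiplied by `1/(2ε)`, is the defect in Young's inequality for `q M y`.
    have h4 : 0 ≤ (ε * M j - q * y) ^ 2 + (ε * M j) ^ 2 + (q * y) ^ 2 := by positivity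
    have h5 : ε * M j ^ 2 + q ^ 2 * (ε⁻¹ * y ^ 2) - q * M j * y
        = ε⁻¹ * (((ε * M j - q * y) ^ 2 + (ε * M j) ^ 2 + (q * y) ^ 2) / 2) := by
      field_simp
      ring
    have h6 : 0 ≤ ε⁻¹ * (((ε * M j - q * y) ^ 2 + (ε * M j) ^ 2 + (q * y) ^ 2) / 2) := by
      positivity
    linarith
  rw [e3]
  have h7 := abs_le.1 (h2.trans h3)
  rw [abs_le] at h1 ⊢
  constructor <;> linarith [h1.1, h1.2, h7.1, h7.2]

end Endpoints

/-! ### Increments of the energy -/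

section Increments

variable {N : ℕ} {T γ a b C : ℝ} {ρ : ℝ → Torus N → ℝ} {u : Fin N → ℝ → Torus N → ℝ}
  {D : Fin N → Fin N → ℝ → Torus N → ℝ} {g : Fin N → ℝ → Torus N → ℝ}
  {r : ℝ → Torus N → ℝ} {m : Fin N → ℝ → Torus N → ℝ} {s t : ℝ}

theorem integral_add_sub {X : Type*} [MeasurableSpace X] {μ : Measure X} {f₁ f₂ f₃ : X → ℝ}
    (h₁ : Integrable f₁ μ) (h₂ : Integrable f₂ μ) (h₃ : Integrable f₃ μ) :
    (∫ x, f₁ x ∂μ) + (∫ x, f₂ x ∂μ) - ∫ x, f₃ x ∂μ = ∫ x, (f₁ x + f₂ x - f₃ x) ∂μ := by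
  rw [← integral_add h₁ h₂]
  exact (integral_sub (h₁.add h₂) h₃).symm

/-- The integrand of the increment of `∫ ρuᵢ²` between the times `t` and `s`. -/
def kineticIncrement (γ : ℝ) (ρ : ℝ → Torus N → ℝ) (u : Fin N → ℝ → Torus N → ℝ)
    (D : Fin N → Fin N → ℝ → Torus N → ℝ) (i : Fin N) (t s : ℝ) (x : Torus N) : ℝ :=
  ∑ j, (timeInt (flux γ ρ u D i j) t s x * (D i j s x + D i j t x)
    - (timeInt (fun τ x => ρ τ x * u j τ x) t s x * u i t x * D i j s x
      + timeInt (fun τ x => ρ τ x * u j τ x) t s x * u i s x * D i j t x))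

/-- With `m = ρu`, the increment of `ρ u²` equals `(m_s - m_t)(u_s + u_t) - (ρ_s - ρ_t) u_s u_t`
identically. No increment of `u` appears, so the momentum equation tested with `u_s` and `u_t` and
the mass equation tested with `u_s u_t` compute it exactly. -/
theorem kinetic_increment (hT : 0 < T) (h : IsFlow T γ a b C ρ u D g) (hv : IsVersion T ρ u r m)
    (ht : IsGood T a b C ρ u D g r m t) (hs : IsGood T a b C ρ u D g r m s) (hts : t ≤ s)
    (i : Fin N) :
    Integrable (kineticIncrement γ ρ u D i t s) ∧
    (∫ x, ρ s x * u i s x * u i s x) - ∫ x, ρ t x * u i t x * u i t x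
      = ∫ x, kineticIncrement γ ρ u D i t s x := by
  have hF := fun j => (memLp_timeInt one_le_two (by simp) (h.memLp_flux i j) ht.mem.1.le hts
    hs.mem.2.le).1
  have hM := fun j => (memLp_timeInt (p := 4) (by norm_num) (by simp) (h.memLp_mass_flux j)
    ht.mem.1.le hts hs.mem.2.le).1
  have hms := hv.memLp_m i s hs.mem_Icc
  have hmt := hv.memLp_m i t ht.mem_Icc
  have hrs := hv.memLp_rho s hs.mem_Icc
  have hrt := hv.memLp_rho t ht.mem_Icc
  have us := hs.memLp_u_two i
  have ut := ht.memLp_u_two i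
  have w1 := hv.wDiv_m hT h i ht.mem.1.le hts hs.mem.2.le
  have w2 := hv.wDiv_rho hT h ht.mem.1.le hts hs.mem.2.le
  have dm : MemLp (fun x => m i s x - m i t x) 2 volume := hms.sub hmt
  have dr : MemLp (fun x => r s x - r t x) 2 volume := hrs.sub hrt
  have q1 := w1.integral_eq dm hF us (hs.memLp_D i) (hs.wGrad_u i)
  have q2 := w1.integral_eq dm hF ut (ht.memLp_D i) (ht.wGrad_u i)
  have q3 := w2.integral_mul_eq dr hM (hs.memLp_u i) (ht.memLp_u i) (hs.memLp_D i) (ht.memLp_D i)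
    (hs.wGrad_u i) (ht.wGrad_u i)
  have ks : Integrable fun x => ρ s x * u i s x * u i s x :=
    (integrable_mul_two hms us).congr ((hs.eq_m i).mono fun x hx => by simp only [hx])
  have kt : Integrable fun x => ρ t x * u i t x * u i t x :=
    (integrable_mul_two hmt ut).congr ((ht.eq_m i).mono fun x hx => by simp only [hx])
  have i1 := integrable_mul_two dm us
  have i2 := integrable_mul_two dm ut
  have i3 := integrable_mul_two dr (memLp_two_mul (hs.memLp_u i) (ht.memLp_u i))
  have e : (∫ x, ρ s x * u i s x * u i s x) - ∫ x, ρ t x * u i t x * u i t x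
      = (∫ x, (m i s x - m i t x) * u i s x) + (∫ x, (m i s x - m i t x) * u i t x)
        - ∫ x, (r s x - r t x) * (u i s x * u i t x) := by
    rw [← integral_sub ks kt, integral_add_sub i1 i2 i3]
    refine integral_congr_ae ?_
    filter_upwards [hs.eq_m i, ht.eq_m i, hs.eq_rho, ht.eq_rho] with x h1 h2 h3 h4
    rw [h1, h2, h3, h4]
    ring
  have j1 : ∀ j, Integrable fun x => timeInt (flux γ ρ u D i j) t s x * D i j s x := fun j =>
    integrable_mul_two (hF j) (hs.memLp_D i j)
  have j2 : ∀ j, Integrable fun x => timeInt (flux γ ρ u D i j) t s x * D i j t x := fun j =>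
    integrable_mul_two (hF j) (ht.memLp_D i j)
  have j3 : ∀ j, Integrable fun x => timeInt (fun τ x => ρ τ x * u j τ x) t s x * u i t x
      * D i j s x + timeInt (fun τ x => ρ τ x * u j τ x) t s x * u i s x * D i j t x := fun j =>
    (integrable_mul_two (memLp_two_mul (hM j) (ht.memLp_u i)) (hs.memLp_D i j)).add
      (integrable_mul_two (memLp_two_mul (hM j) (hs.memLp_u i)) (ht.memLp_D i j))
  refine ⟨integrable_finsetSum _ fun j _ => (((j1 j).add (j2 j)).sub (j3 j)).congr
    (ae_of_all _ fun x => by simp only [Pi.add_apply, Pi.sub_apply]; ring), ?_⟩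
  rw [e, q1, q2, q3, integral_add_sub (integrable_finsetSum _ fun j _ => j1 j)
    (integrable_finsetSum _ fun j _ => j2 j) (integrable_finsetSum _ fun j _ => j3 j)]
  refine integral_congr_ae (ae_of_all _ fun x => ?_)
  simp only [kineticIncrement]
  rw [← Finset.sum_add_distrib, ← Finset.sum_sub_distrib]
  refine Finset.sum_congr rfl fun j _ => ?_
  ring

/-- The graph of `x ↦ x^γ` lies above its tangent at `x`: Bernoulli's inequality for `y / x`,
rescaled. -/
theorem mul_sub_le_rpow_sub (hγ : 1 < γ) {x y : ℝ} (hx : 0 < x) (hy : 0 < y) :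
    γ * ((y - x) * x ^ (γ - 1)) ≤ y ^ γ - x ^ γ := by
  have hyx : 0 < y / x := div_pos hy hx
  have h1 := one_add_mul_self_le_rpow_one_add (s := y / x - 1) (by linarith) hγ.le
  rw [add_sub_cancel, Real.div_rpow hy.le hx.le, le_div_iff₀ (Real.rpow_pos_of_pos hx γ)] at h1
  have h2 : x ^ γ = x ^ (γ - 1) * x := by
    rw [← Real.rpow_add_one hx.ne']
    simp
  have h3 : (1 + γ * (y / x - 1)) * x ^ γ = x ^ γ + γ * ((y - x) * x ^ (γ - 1)) := by
    rw [h2]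
    field_simp
  linarith

/-- The tangents at the two times bound the increment from below and from above. Each bound is
linear in the increment of the density, so the mass equation tested with `ρ^(γ-1)` at one of the
times evaluates it. The bounds differ only in the time of the gradient, and this difference
disappears in the limit. -/
theorem pow_increment (hT : 0 < T) (hγ : 1 < γ) (h : IsFlow T γ a b C ρ u D g)
    (hv : IsVersion T ρ u r m) (ht : IsGood T a b C ρ u D g r m t)
    (hs : IsGood T a b C ρ u D g r m s) (hts : t ≤ s) :
    γ * ∫ x, ∑ j, timeInt (fun τ x => ρ τ x * u j τ x) t s x * gradPow (γ - 1) ρ g j t x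
        ≤ (∫ x, ρ s x ^ γ) - ∫ x, ρ t x ^ γ ∧
      (∫ x, ρ s x ^ γ) - ∫ x, ρ t x ^ γ ≤
        γ * ∫ x, ∑ j, timeInt (fun τ x => ρ τ x * u j τ x) t s x
          * gradPow (γ - 1) ρ g j s x := by
  have hM := fun j => memLp_two_of_four (memLp_timeInt (p := 4) (by norm_num) (by simp)
    (h.memLp_mass_flux j) ht.mem.1.le hts hs.mem.2.le).1
  have w := hv.wDiv_rho hT h ht.mem.1.le hts hs.mem.2.le
  have dr : MemLp (fun x => r s x - r t x) 2 volume :=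
    (hv.memLp_rho s hs.mem_Icc).sub (hv.memLp_rho t ht.mem_Icc)
  have ps := hs.memLp_pow h.pos (γ - 1) 2
  have pt := ht.memLp_pow h.pos (γ - 1) 2
  rw [← w.integral_eq dr hM pt (ht.memLp_gradPow h.pos _) (ht.wGrad_pow h.pos _),
    ← w.integral_eq dr hM ps (hs.memLp_gradPow h.pos _) (hs.wGrad_pow h.pos _),
    ← integral_sub (integrable_of_memLp_two (hs.memLp_pow h.pos γ 2))
      (integrable_of_memLp_two (ht.memLp_pow h.pos γ 2)), ← integral_const_mul,
    ← integral_const_mul]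
  have ip := (integrable_of_memLp_two (hs.memLp_pow h.pos γ 2)).sub
    (integrable_of_memLp_two (ht.memLp_pow h.pos γ 2))
  constructor
  · refine integral_mono_ae ((integrable_mul_two dr pt).const_mul _) ip ?_
    filter_upwards [hs.eq_rho, ht.eq_rho, hs.bound, ht.bound] with x h1 h2 h3 h4
    rw [h1, h2]
    exact mul_sub_le_rpow_sub hγ (h.pos.trans_le h4.1) (h.pos.trans_le h3.1)
  · refine integral_mono_ae ip ((integrable_mul_two dr ps).const_mul _) ?_
    filter_upwards [hs.eq_rho, ht.eq_rho, hs.bound, ht.bound] with x h1 h2 h3 h4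
    have := mul_sub_le_rpow_sub hγ (h.pos.trans_le h3.1) (h.pos.trans_le h4.1)
    rw [h1, h2]
    linarith

end Increments

/-! ### The rate of change of the energy -/

section EnergyRate

variable {N : ℕ} {T γ a b C : ℝ} {ρ : ℝ → Torus N → ℝ} {u : Fin N → ℝ → Torus N → ℝ}
  {D : Fin N → Fin N → ℝ → Torus N → ℝ} {g : Fin N → ℝ → Torus N → ℝ}
  {r : ℝ → Torus N → ℝ} {m : Fin N → ℝ → Torus N → ℝ} {t : ℝ}

/-- The Steklov average over the times between `t` and `t + h`. -/
def steklov (T h : ℝ) (f : ℝ → Torus N → ℝ) : ℝ × Torus N → ℝ :=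
  avg (steklovMeasure N h) (zeroExt T f)

/-- The translation by `h` in time. -/
def timeShift (T h : ℝ) (f : ℝ → Torus N → ℝ) : ℝ × Torus N → ℝ :=
  avg (shiftMeasure N h) (zeroExt T f)

/-- The integrand of the difference quotient of the energy; `G` approximates `∇ρ^(γ-1)`. -/
def energyRate (T γ h : ℝ) (ρ : ℝ → Torus N → ℝ) (u : Fin N → ℝ → Torus N → ℝ)
    (D : Fin N → Fin N → ℝ → Torus N → ℝ) (G : Fin N → ℝ × Torus N → ℝ) (z : ℝ × Torus N) : ℝ :=
  1 / 2 * (∑ i, ∑ j, (steklov T h (flux γ ρ u D i j) z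
      * (timeShift T h (D i j) z + zeroExt T (D i j) z)
      - (steklov T h (fun τ x => ρ τ x * u j τ x) z * zeroExt T (u i) z * timeShift T h (D i j) z
        + steklov T h (fun τ x => ρ τ x * u j τ x) z * timeShift T h (u i) z
          * zeroExt T (D i j) z)))
    + γ / (γ - 1) * ∑ j, steklov T h (fun τ x => ρ τ x * u j τ x) z * G j z

/-- The limit of `energyRate`. -/
def limitRate (T γ : ℝ) (ρ : ℝ → Torus N → ℝ) (u : Fin N → ℝ → Torus N → ℝ)
    (D : Fin N → Fin N → ℝ → Torus N → ℝ) (g : Fin N → ℝ → Torus N → ℝ) (z : ℝ × Torus N) : ℝ :=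
  1 / 2 * (∑ i, ∑ j, (zeroExt T (flux γ ρ u D i j) z
      * (zeroExt T (D i j) z + zeroExt T (D i j) z)
      - (zeroExt T (fun τ x => ρ τ x * u j τ x) z * zeroExt T (u i) z * zeroExt T (D i j) z
        + zeroExt T (fun τ x => ρ τ x * u j τ x) z * zeroExt T (u i) z * zeroExt T (D i j) z)))
    + γ / (γ - 1) * ∑ j, zeroExt T (fun τ x => ρ τ x * u j τ x) z
      * zeroExt T (gradPow (γ - 1) ρ g j) z

theorem IsFlow.memLp_gradPow (h : IsFlow T γ a b C ρ u D g) (β : ℝ) (j : Fin N) :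
    MemLp (Function.uncurry (gradPow β ρ g j)) 2 (spaceTime N T) :=
  DegenerateNS.memLp_gradPow h.pos β h.meas_rho h.bound (h.memLp_g j)

/-- Steklov averages and shifts converge in the space of the function averaged, so each product
converges in `L¹`: exponents `2, 2` for the momentum flux and the pressure terms, `4, 4, 2` for the
convective ones. -/
theorem tendstoLp_energyRate (h : IsFlow T γ a b C ρ u D g) {η : ℕ → ℝ} (hη : ∀ n, 0 < η n)
    (h0 : Tendsto η atTop (𝓝 0)) {G : ℕ → Fin N → ℝ × Torus N → ℝ}
    (hG : ∀ j, TendstoLp volume 2 atTop (fun n => G n j) (zeroExt T (gradPow (γ - 1) ρ g j))) :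
    TendstoLp volume 1 atTop (fun n => energyRate T γ (η n) ρ u D (G n))
      (limitRate T γ ρ u D g) := by
  have sF := fun i j => tendstoLp_steklov hη h0 one_le_two (by simp) (h.memLp_flux i j)
  have sM := fun j => tendstoLp_steklov hη h0 (p := 4) (by norm_num) (by simp)
    (h.memLp_mass_flux j)
  have sM2 := fun j => tendstoLp_steklov hη h0 one_le_two (by simp) (memLp_two_mass_flux h j)
  have tD := fun i j => tendstoLp_shift h0 one_le_two (by simp) (h.memLp_D i j)
  have tu := fun i => tendstoLp_shift h0 (p := 4) (by norm_num) (by simp) (h.memLp_u i)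
  have cD := fun i j => TendstoLp.const (l := atTop) (ι := ℕ) (memLp_zeroExt (h.memLp_D i j))
  have cu := fun i => TendstoLp.const (l := atTop) (ι := ℕ) (memLp_zeroExt (h.memLp_u i))
  exact ((TendstoLp.sum Finset.univ fun i _ => TendstoLp.sum Finset.univ fun j _ =>
    ((sF i j).mul (r := 1) ((tD i j).add (cD i j))).sub
      ((((sM j).mul (r := 2) (cu i)).mul (r := 1) (tD i j)).add
        (((sM j).mul (r := 2) (tu i)).mul (r := 1) (cD i j)))).const_mul (1 / 2)).add
    ((TendstoLp.sum Finset.univ fun j _ => (sM2 j).mul (r := 1) (hG j)).const_mul (γ / (γ - 1)))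

/-- The kinetic energy plus the potential energy. -/
def flowEnergy (γ : ℝ) (ρ : ℝ → Torus N → ℝ) (u : Fin N → ℝ → Torus N → ℝ) (t : ℝ) : ℝ :=
  1 / 2 * (∑ i, ∫ x, ρ t x * u i t x * u i t x) + 1 / (γ - 1) * ∫ x, ρ t x ^ γ

/-- At times `t` and `t + η` inside the interval, a Steklov average is the time integral divided by
`η`, and a shift is the value at `t + η`. The field `G` is left free so that the lower and the upper
bound both come from this identity. -/
theorem integral_energyRate {η : ℝ} (hT : 0 < T) (hη : 0 < η) (h : IsFlow T γ a b C ρ u D g)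
    (hv : IsVersion T ρ u r m) (ht : IsGood T a b C ρ u D g r m t)
    (hs : IsGood T a b C ρ u D g r m (t + η)) {G : Fin N → ℝ × Torus N → ℝ}
    {Γ : Fin N → Torus N → ℝ} (hG : ∀ j x, G j (t, x) = Γ j x) (hΓ : ∀ j, MemLp (Γ j) 2 volume) :
    η * ∫ x, energyRate T γ η ρ u D G (t, x)
      = 1 / 2 * (∑ i, ((∫ x, ρ (t + η) x * u i (t + η) x * u i (t + η) x)
          - ∫ x, ρ t x * u i t x * u i t x))
        + 1 / (γ - 1) * (γ * ∫ x, ∑ j, timeInt (fun τ x => ρ τ x * u j τ x) t (t + η) x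
          * Γ j x) := by
  have hle : t ≤ t + η := by linarith
  have hM := fun j => (memLp_timeInt one_le_two (by simp) (memLp_two_mass_flux h j)
    ht.mem.1.le hle hs.mem.2.le).1
  have hk := kinetic_increment hT h hv ht hs hle
  simp_rw [(hk _).2]
  rw [← integral_finsetSum _ fun i _ => (hk i).1, ← integral_const_mul, ← integral_const_mul,
    ← integral_const_mul, ← integral_const_mul, ← integral_add
      ((integrable_finsetSum _ fun i _ => (hk i).1).const_mul _)
      (((integrable_finsetSum _ fun j _ => integrable_mul_two (hM j) (hΓ j)).const_mul _).const_mul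
        _)]
  refine integral_congr_ae (ae_of_all _ fun x => ?_)
  simp only [energyRate, steklov, timeShift, avg_shiftMeasure hs.mem,
    avg_steklovMeasure hη ht.mem.1 hs.mem.2, zeroExt_apply ht.mem, hG, kineticIncrement]
  rw [mul_add, mul_left_comm, Finset.mul_sum]
  congr 1
  · congr 1
    refine Finset.sum_congr rfl fun i _ => ?_
    rw [Finset.mul_sum]
    refine Finset.sum_congr rfl fun j _ => ?_
    field_simp
  · rw [mul_left_comm, ← mul_assoc (1 / (γ - 1)), one_div_mul_eq_div]
    congr 1
    rw [Finset.mul_sum]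
    refine Finset.sum_congr rfl fun j _ => ?_
    field_simp

theorem flowEnergy_sub (s t : ℝ) :
    flowEnergy γ ρ u s - flowEnergy γ ρ u t
      = 1 / 2 * (∑ i, ((∫ x, ρ s x * u i s x * u i s x) - ∫ x, ρ t x * u i t x * u i t x))
        + 1 / (γ - 1) * ((∫ x, ρ s x ^ γ) - ∫ x, ρ t x ^ γ) := by
  rw [Finset.sum_sub_distrib, flowEnergy, flowEnergy]
  ring

theorem energyRate_le (hT : 0 < T) (hγ : 1 < γ) {η : ℝ} (hη : 0 < η)
    (h : IsFlow T γ a b C ρ u D g)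
    (hv : IsVersion T ρ u r m) (ht : IsGood T a b C ρ u D g r m t)
    (hs : IsGood T a b C ρ u D g r m (t + η)) :
    η * (∫ x, energyRate T γ η ρ u D (fun j => zeroExt T (gradPow (γ - 1) ρ g j)) (t, x))
      ≤ flowEnergy γ ρ u (t + η) - flowEnergy γ ρ u t := by
  rw [integral_energyRate hT hη h hv ht hs (fun j x => zeroExt_apply ht.mem _ x)
    (ht.memLp_gradPow h.pos (γ - 1)), flowEnergy_sub]
  have h1 : 0 ≤ 1 / (γ - 1) := one_div_nonneg.2 (by linarith)
  have := mul_le_mul_of_nonneg_left (pow_increment hT hγ h hv ht hs (by linarith)).1 h1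
  linarith

theorem le_energyRate (hT : 0 < T) (hγ : 1 < γ) {η : ℝ} (hη : 0 < η)
    (h : IsFlow T γ a b C ρ u D g)
    (hv : IsVersion T ρ u r m) (ht : IsGood T a b C ρ u D g r m t)
    (hs : IsGood T a b C ρ u D g r m (t + η)) :
    flowEnergy γ ρ u (t + η) - flowEnergy γ ρ u t ≤
      η * (∫ x, energyRate T γ η ρ u D (fun j => timeShift T η (gradPow (γ - 1) ρ g j)) (t, x)) := by
  rw [integral_energyRate (G := fun j => timeShift T η (gradPow (γ - 1) ρ g j)) hT hη h hv ht hs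
    (fun j x => avg_shiftMeasure hs.mem _ x)
    (hs.memLp_gradPow h.pos (γ - 1)), flowEnergy_sub]
  have h1 : 0 ≤ 1 / (γ - 1) := one_div_nonneg.2 (by linarith)
  have := mul_le_mul_of_nonneg_left (pow_increment hT hγ h hv ht hs (by linarith)).2 h1
  linarith

theorem ae_isGood_add (h : IsFlow T γ a b C ρ u D g) (hv : IsVersion T ρ u r m) {η : ℝ}
    (hη : 0 < η) : ∀ᵐ t ∂(volume.restrict (Ioo 0 (T - η))),
      IsGood T a b C ρ u D g r m t ∧ IsGood T a b C ρ u D g r m (t + η) := by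
  have h1 := (ae_restrict_iff' measurableSet_Ioo).1 (ae_isGood h hv)
  have h2 := (measurePreserving_add_right (volume : Measure ℝ) η).quasiMeasurePreserving.ae h1
  rw [ae_restrict_iff' measurableSet_Ioo]
  filter_upwards [h1, h2] with t g1 g2 ht
  exact ⟨g1 ⟨ht.1, by linarith [ht.2]⟩, g2 ⟨by linarith [ht.1], by linarith [ht.2]⟩⟩

/-- The dissipation density `ρ|𝔻u|²`. -/
def dissipation (ρ : ℝ → Torus N → ℝ) (D : Fin N → Fin N → ℝ → Torus N → ℝ) (t : ℝ)
    (x : Torus N) : ℝ :=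
  ρ t x * ∑ i, ∑ j, ((D i j t x + D j i t x) / 2) ^ 2

/-! ### Identification of the limit with the dissipation -/

theorem sum_sym_mul (A : Fin N → Fin N → ℝ) :
    ∑ i, ∑ j, (A i j + A j i) / 2 * A i j = ∑ i, ∑ j, ((A i j + A j i) / 2) ^ 2 := by
  have h1 : ∑ i, ∑ j, (A i j + A j i) / 2 * A i j = ∑ i, ∑ j, (A j i + A i j) / 2 * A j i :=
    Finset.sum_comm
  have h2 : ∑ i, ∑ j, (A i j + A j i) / 2 * A i j + ∑ i, ∑ j, (A j i + A i j) / 2 * A j i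
      = 2 * ∑ i, ∑ j, ((A i j + A j i) / 2) ^ 2 := by
    simp_rw [← Finset.sum_add_distrib, Finset.mul_sum]
    exact Finset.sum_congr rfl fun i _ => Finset.sum_congr rfl fun j _ => by ring
  linarith

theorem memLp_sym {X : Type*} [MeasurableSpace X] {μ : Measure X} {f f' : X → ℝ}
    (hf : MemLp f 2 μ) (hf' : MemLp f' 2 μ) : MemLp (fun x => (f x + f' x) / 2) 2 μ := by
  have := (hf.add hf').const_mul (1 / 2)
  refine this.congr_norm ?_ (ae_of_all _ fun x => ?_)
  · exact (hf.1.add hf'.1).div₀ aestronglyMeasurable_const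
  · simp only [Pi.add_apply]; congr 1; ring

theorem integrable_mul_sum_sq {X : Type*} [MeasurableSpace X] {μ : Measure X} {R : X → ℝ}
    (hR : MemLp R ⊤ μ) {A : Fin N → Fin N → X → ℝ} (hA : ∀ i j, MemLp (A i j) 2 μ) :
    Integrable (fun x => R x * ∑ i, ∑ j, ((A i j x + A j i x) / 2) ^ 2) μ := by
  have h1 : Integrable (fun x => ∑ i, ∑ j, ((A i j x + A j i x) / 2) ^ 2) μ :=
    integrable_finsetSum _ fun i _ => integrable_finsetSum _ fun j _ =>
      (memLp_sym (hA i j) (hA j i)).integrable_sq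
  exact memLp_one_iff_integrable.1 (memLp_top_mul hR (memLp_one_iff_integrable.2 h1))

/-- This is `γ/(γ-1) ρ ∇ρ^(γ-1) = ∇ρ^γ`, expressed through the gradient of `√ρ`. -/
theorem rpow_mul_gradPow (hγ : 1 < γ) {x G : ℝ} (hx : 0 < x) :
    γ / (γ - 1) * (x * (deriv (fun y : ℝ => y ^ (2 * (γ - 1))) √x * G))
      = deriv (fun y : ℝ => y ^ (2 * γ)) √x * G := by
  have hs : 0 < √x := Real.sqrt_pos.2 hx
  rw [Real.deriv_rpow_const, Real.deriv_rpow_const]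
  have e : √x ^ (2 * γ - 1) = √x ^ (2 * (γ - 1) - 1) * x := by
    have h1 : (2 * γ - 1) = (2 * (γ - 1) - 1) + 2 := by ring
    rw [h1, Real.rpow_add hs, Real.rpow_two, Real.sq_sqrt hx.le]
  rw [e]
  have : γ - 1 ≠ 0 := by linarith
  field_simp

/-- The convective part of the momentum flux cancels against the two mass flux terms. The pressure
terms add up to `ρ^γ div u + u · ∇ρ^γ`, a divergence with zero integral. What remains is the viscous
stress against `∇u`, where only the symmetric part contributes. -/
theorem integral_limitRate (hγ : 1 < γ) (h : IsFlow T γ a b C ρ u D g)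
    (ht : IsGood T a b C ρ u D g r m t) :
    ∫ x, limitRate T γ ρ u D g (t, x) = - ∫ x, dissipation ρ D t x := by
  have hp := ht.memLp_pow h.pos γ 2
  have hgp := ht.memLp_gradPow h.pos γ
  have key : ∀ j, (∫ x, D j j t x * ρ t x ^ γ) + ∫ x, u j t x * gradPow γ ρ g j t x = 0 := by
    intro j
    -- The field with the single component `u_j` in direction `j` has divergence `∂_j u_j`; pairing
    -- it with `ρ^γ` gives the integration by parts coordinate by coordinate.
    have hw : WDiv (fun k x => if k = j then u j t x else 0) fun x => - D j j t x := by
      intro φ hφ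
      have := ht.wGrad_u j φ hφ j
      simp only [neg_mul, integral_neg, ite_mul, zero_mul, Finset.sum_ite_eq', Finset.mem_univ,
        if_true]
      exact this.symm
    have hB : ∀ k, MemLp (fun x => if k = j then u j t x else 0) 2 volume := by
      intro k
      by_cases hk : k = j
      · simpa [hk] using ht.memLp_u_two j
      · simp [hk]
    have := hw.integral_eq (ht.memLp_D j j).neg hB hp hgp (ht.wGrad_pow h.pos γ)
    simp only [neg_mul, integral_neg, ite_mul, zero_mul, Finset.sum_ite_eq', Finset.mem_univ,
      if_true] at this
    linarith
  have i1 := fun j => integrable_mul_two (ht.memLp_D j j) hp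
  have i2 := fun j => integrable_mul_two (ht.memLp_u_two j) (hgp j)
  have i3 : Integrable (dissipation ρ D t) :=
    integrable_mul_sum_sq (ht.memLp_rho ⊤) ht.memLp_D
  have e : ∫ x, limitRate T γ ρ u D g (t, x) = ∫ x, ((∑ j, D j j t x * ρ t x ^ γ)
      + (∑ j, u j t x * gradPow γ ρ g j t x) - dissipation ρ D t x) := by
    refine integral_congr_ae ?_
    filter_upwards [ht.bound] with x hx
    have hx0 : 0 < ρ t x := h.pos.trans_le hx.1
    simp only [limitRate, zeroExt_apply ht.mem, flux, dissipation]
    rw [← sum_sym_mul fun i j => D i j t x]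
    have e1 : γ / (γ - 1) * ∑ j, ρ t x * u j t x * gradPow (γ - 1) ρ g j t x
        = ∑ j, u j t x * gradPow γ ρ g j t x := by
      rw [Finset.mul_sum]
      refine Finset.sum_congr rfl fun j _ => ?_
      rw [gradPow, gradPow, ← rpow_mul_gradPow hγ hx0]
      ring
    have e2 : ∑ j, D j j t x * ρ t x ^ γ
        = ∑ i, ∑ j, (if i = j then ρ t x ^ γ else 0) * D i j t x := by
      refine Finset.sum_congr rfl fun i _ => ?_
      simp [mul_comm]
    rw [e1, e2, add_sub_right_comm]
    congr 1
    simp_rw [Finset.mul_sum, ← Finset.sum_sub_distrib]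
    exact Finset.sum_congr rfl fun i _ => Finset.sum_congr rfl fun j _ => by ring
  rw [e, ← integral_add_sub (integrable_finsetSum _ fun j _ => i1 j)
    (integrable_finsetSum _ fun j _ => i2 j) i3, integral_finsetSum _ fun j _ => i1 j,
    integral_finsetSum _ fun j _ => i2 j, ← Finset.sum_add_distrib,
    Finset.sum_eq_zero fun j _ => key j, zero_sub]

end EnergyRate

/-! ### The energy identity -/

section EnergyIdentity

variable {N : ℕ} {T γ a b C : ℝ} {ρ : ℝ → Torus N → ℝ} {u : Fin N → ℝ → Torus N → ℝ}
  {D : Fin N → Fin N → ℝ → Torus N → ℝ} {g : Fin N → ℝ → Torus N → ℝ}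
  {r : ℝ → Torus N → ℝ} {m : Fin N → ℝ → Torus N → ℝ} {t : ℝ}

/-- The energy of a density `r` and a momentum `m`. -/
def momentumEnergy (γ : ℝ) (r : Torus N → ℝ) (m : Fin N → Torus N → ℝ) : ℝ :=
  1 / 2 * (∑ i, ∫ x, m i x / r x * m i x) + 1 / (γ - 1) * ∫ x, r x ^ γ

theorem IsFlow.integrableOn_flowEnergy (h : IsFlow T γ a b C ρ u D g) :
    IntegrableOn (flowEnergy γ ρ u) (Ioo 0 T) :=
  ((integrable_finsetSum _ fun i _ => h.integrableOn_kinetic i).const_mul _).add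
    ((h.integrableOn_pow γ).const_mul _)

theorem tendsto_average_energy {α β : ℕ → ℝ} (hT : 0 < T) (h : IsFlow T γ a b C ρ u D g)
    (hv : IsVersion T ρ u r m) (ht : t ∈ Icc 0 T)
    (hα : ∀ n, 0 ≤ α n) (hαβ : ∀ n, α n < β n) (hβ : ∀ n, β n ≤ T) (hαt : ∀ n, α n ≤ t)
    (hβt : ∀ n, t ≤ β n) (h0 : Tendsto (fun n => β n - α n) atTop (𝓝 0)) :
    Tendsto (fun n => (β n - α n)⁻¹ * ∫ s in (α n)..(β n), flowEnergy γ ρ u s) atTop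
      (𝓝 (momentumEnergy γ (r t) fun i => m i t)) := by
  have t1 := tendsto_average_pow hT h hv ht γ hα hαβ hβ hαt hβt h0
  have t2 := fun i => tendsto_average_kinetic hT h hv ht i hα hαβ hβ hαt hβt h0
  refine (((tendsto_finsetSum Finset.univ fun i _ => t2 i).const_mul (1 / 2)).add
    (t1.const_mul (1 / (γ - 1)))).congr fun n => ?_
  have hii : ∀ {k : ℝ → ℝ}, IntegrableOn k (Ioo 0 T) →
      IntervalIntegrable k volume (α n) (β n) := fun hk => by
    rw [intervalIntegrable_iff_integrableOn_Ioo_of_le (hαβ n).le]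
    exact hk.mono_set (Ioo_subset_Ioo (hα n) (hβ n))
  have i1 := fun i => hii (h.integrableOn_kinetic i)
  have i2 := hii (h.integrableOn_pow γ)
  have i3 : IntervalIntegrable (fun s => ∑ i, ∫ x, ρ s x * u i s x * u i s x) volume (α n) (β n) :=
    hii (integrable_finsetSum _ fun i _ => h.integrableOn_kinetic i)
  simp only [flowEnergy]
  rw [intervalIntegral.integral_add (i3.const_mul _) (i2.const_mul _),
    intervalIntegral.integral_const_mul, intervalIntegral.integral_const_mul,
    intervalIntegral.integral_finsetSum fun i _ => i1 i, ← Finset.mul_sum]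
  ring

/-- The lower and upper rates have the same `L¹` limit, so integrating the increments bounds the
change of energy from both sides by minus the dissipation; the windows at the ends yield the
energies at exactly `0` and `t`. -/
theorem energy_identity (hT : 0 < T) (hγ : 1 < γ) (h : IsFlow T γ a b C ρ u D g)
    (hv : IsVersion T ρ u r m) (ht : t ∈ Icc 0 T) :
    momentumEnergy γ (r t) (fun i => m i t) + ∫ s in (0 : ℝ)..t, ∫ x, dissipation ρ D s x
      = momentumEnergy γ (r 0) fun i => m i 0 := by
  rcases ht.1.eq_or_lt with rfl | hpos
  · simp
  -- Positive steps tending to zero and at most `t`, so that both end windows stay inside `[0, t]`.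
  set η : ℕ → ℝ := fun n => t * (1 / ((n : ℝ) + 1)) with hη
  have hη0 : Tendsto η atTop (𝓝 0) := by
    have := (tendsto_one_div_add_atTop_nhds_zero_nat (𝕜 := ℝ)).const_mul t
    rwa [mul_zero] at this
  have hηpos : ∀ n, 0 < η n := fun n => by positivity
  have hηle : ∀ n, η n ≤ t := fun n => by
    refine mul_le_of_le_one_right hpos.le ?_
    rw [div_le_one (by positivity)]
    linarith [n.cast_nonneg (α := ℝ)]
  have hl : Tendsto (fun n => (η n)⁻¹ * ∫ s in (t - η n)..t, flowEnergy γ ρ u s) atTop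
      (𝓝 (momentumEnergy γ (r t) fun i => m i t)) := by
    have := tendsto_average_energy (α := fun n => t - η n) (β := fun _ => t) hT h hv ht
      (fun n => sub_nonneg.2 (hηle n)) (fun n => by linarith [hηpos n]) (fun _ => ht.2)
      (fun n => by linarith [hηpos n]) (fun _ => le_rfl) (by simpa using hη0)
    simpa only [sub_sub_cancel] using this
  have hr : Tendsto (fun n => (η n)⁻¹ * ∫ s in (0 : ℝ)..(η n), flowEnergy γ ρ u s) atTop
      (𝓝 (momentumEnergy γ (r 0) fun i => m i 0)) := by
    have := tendsto_average_energy (α := fun _ => 0) (β := η) hT h hv (left_mem_Icc.2 hT.le)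
      (fun _ => le_rfl) hηpos (fun n => (hηle n).trans ht.2) (fun _ => le_rfl)
      (fun n => (hηpos n).le) (by simpa using hη0)
    simpa only [sub_zero] using this
  have a1 := (tendstoLp_energyRate h hηpos hη0 (G := fun _ j => zeroExt T (gradPow (γ - 1) ρ g j))
    fun j => TendstoLp.const (memLp_zeroExt (h.memLp_gradPow (γ - 1) j))).integral_slice
  have a2 := (tendstoLp_energyRate h hηpos hη0
    (G := fun n j => timeShift T (η n) (gradPow (γ - 1) ρ g j))
    fun j => tendstoLp_shift hη0 one_le_two (by simp) (h.memLp_gradPow (γ - 1) j)).integral_slice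
  have l1 := integral_le_sub_of_increments h.integrableOn_flowEnergy ht.2 hηpos hηle hη0 a1
    (fun n => (ae_isGood_add h hv (hηpos n)).mono fun s hs =>
      energyRate_le hT hγ (hηpos n) h hv hs.1 hs.2) hl hr
  -- The upper bound is the lower bound for minus the energy.
  have l2 := integral_le_sub_of_increments (k := fun s => - flowEnergy γ ρ u s)
    h.integrableOn_flowEnergy.neg ht.2 hηpos hηle hη0 (a2.const_mul (-1))
    (fun n => (ae_isGood_add h hv (hηpos n)).mono fun s hs => by
      have := le_energyRate hT hγ (hηpos n) h hv hs.1 hs.2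
      linarith)
    (by simpa only [intervalIntegral.integral_neg, mul_neg] using hl.neg)
    (by simpa only [intervalIntegral.integral_neg, mul_neg] using hr.neg)
  have e : ∫ s in (0 : ℝ)..t, ∫ x, limitRate T γ ρ u D g (s, x)
      = - ∫ s in (0 : ℝ)..t, ∫ x, dissipation ρ D s x := by
    rw [← intervalIntegral.integral_neg, intervalIntegral.integral_of_le hpos.le,
      intervalIntegral.integral_of_le hpos.le, integral_Ioc_eq_integral_Ioo,
      integral_Ioc_eq_integral_Ioo]
    refine integral_congr_ae ?_
    filter_upwards [ae_restrict_of_ae_restrict_of_subset (Ioo_subset_Ioo_right ht.2)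
      (ae_isGood h hv)] with s hs
    exact integral_limitRate hγ h hs
  rw [intervalIntegral.integral_const_mul] at l2
  linarith

end EnergyIdentity

/-! ### Weakly continuous versions -/

section Versions

variable {N : ℕ} {T γ a b C : ℝ} {ρ : ℝ → Torus N → ℝ} {u : ℝ → Torus N → Vec N}
  {Du : Fin N → ℝ → Torus N → Vec N} {g : Fin N → ℝ → Torus N → ℝ}
  {r : ℝ → Torus N → ℝ} {m : Fin N → ℝ → Torus N → ℝ} {v : ℝ → Torus N → Vec N} {t : ℝ}
  {ρ₀ : Torus N → ℝ} {u₀ : Torus N → Vec N}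

theorem IsWeaklyContinuousVersion.isVersion (h : IsWeaklyContinuousVersion T ρ u r v) :
    IsVersion T ρ (fun i t x => u t x i) r fun i t x => r t x * v t x i where
  ae_rho := ae_slice (p := fun t x => r t x = ρ t x) (h.ae_eq.mono fun _ hz => hz.1)
  ae_m := by
    filter_upwards [ae_slice (p := fun t x => r t x = ρ t x ∧ v t x = u t x) h.ae_eq] with t ht i
    filter_upwards [ht] with x hx
    rw [hx.1, hx.2]
  memLp_rho := h.memLp_rho
  memLp_m i t ht := (h.memLp_m t ht).eval_piLp i
  continuous_rho := h.continuous_rho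
  continuous_m i ψ hψ := h.continuous_m ψ hψ i

theorem ae_spaceTime_of_ae {p : ℝ → Prop} (h : ∀ᵐ t ∂(volume.restrict (Ioo 0 T)), p t) :
    ∀ᵐ z ∂(spaceTime N T), p z.1 :=
  Measure.quasiMeasurePreserving_fst.ae h

/-- The velocity is recovered as `m / r`, which is legitimate at every time because the lower bound
on the density persists under weak limits. -/
theorem IsVersion.exists_isWeaklyContinuousVersion {D : Fin N → Fin N → ℝ → Torus N → ℝ}
    (hT : 0 < T) (h : IsFlow T γ a b C ρ (fun i t x => u t x i) D g)
    (hv : IsVersion T ρ (fun i t x => u t x i) r m) :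
    ∃ r' v, IsWeaklyContinuousVersion T ρ u r' v := by
  classical
  let good : ℝ → Prop := fun t => r t =ᵐ[volume] ρ t ∧
    ∀ i, m i t =ᵐ[volume] fun x => ρ t x * u t x i
  have hgood : ∀ᵐ t ∂(volume.restrict (Ioo 0 T)), good t := by
    filter_upwards [hv.ae_rho, hv.ae_m] with t h1 h2
    exact ⟨h1, h2⟩
  -- At times where the curves agree with the solution, the solution is kept unchanged. Equality on
  -- space-time is then pointwise at these times and follows from a null set of times alone, with no
  -- joint measurability of `r` and `m` required.
  let r' : ℝ → Torus N → ℝ := fun t => if good t then ρ t else r t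
  let v : ℝ → Torus N → Vec N := fun t =>
    if good t then u t else fun x => WithLp.toLp 2 fun i => m i t x / r t x
  have hr : ∀ t, r' t =ᵐ[volume] r t := fun t => by
    by_cases ht : good t
    · simp only [r', ht, if_true]
      exact ht.1.symm
    · simp [r', ht]
  have hm : ∀ i, ∀ t ∈ Icc 0 T, (fun x => r' t x * v t x i) =ᵐ[volume] m i t := fun i t htT => by
    by_cases ht : good t
    · simp only [r', v, ht, if_true]
      exact (ht.2 i).symm
    · simp only [r', v, ht, if_false]
      filter_upwards [hv.bound hT h htT] with x hx
      exact mul_div_cancel₀ _ (h.pos.trans_le hx.1).ne'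
  refine ⟨r', v, ?_, fun t ht => (memLp_congr_ae (hr t)).2 (hv.memLp_rho t ht), fun t ht => ?_,
    fun ψ hψ => ?_, fun ψ hψ i => ?_⟩
  · filter_upwards [ae_spaceTime_of_ae hgood] with z hz
    simp [r', v, hz]
  · exact memLp_piLp_iff.2 fun i => (memLp_congr_ae (hm i t ht)).2 (hv.memLp_m i t ht)
  · refine (hv.continuous_rho ψ hψ).congr fun t _ => ?_
    exact integral_congr_ae ((hr t).mono fun x hx => by simp only [hx])
  · refine (hv.continuous_m i ψ hψ).congr fun t ht => ?_
    exact integral_congr_ae ((hm i t ht).mono fun x hx => by simp only [hx])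

/-- Near time zero the same moments have two limits, one from weak continuity and one from the
initial condition; smooth functions separate integrable ones. -/
theorem ae_eq_of_weak_limit (hT : 0 < T) {W w : ℝ → Torus N → ℝ} {w₀ : Torus N → ℝ}
    (hW : MemLp (W 0) 2 volume) (hc : ∀ ψ : Torus N → ℝ, MemLp ψ 2 volume →
      ContinuousOn (fun t => ∫ x, W t x * ψ x) (Icc 0 T))
    (hWw : ∀ᵐ t ∂(volume.restrict (Ioo 0 T)), W t =ᵐ[volume] w t) (hw₀ : Integrable w₀)
    (hlim : ∀ φ : Torus N → ℝ, IsSmooth φ →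
      Tendsto (fun t => ∫ x, w t x * φ x) (𝓝[>] 0 ⊓ ae volume) (𝓝 (∫ x, w₀ x * φ x))) :
    W 0 =ᵐ[volume] w₀ := by
  have h0 : (0 : ℝ) ∈ Icc 0 T := left_mem_Icc.2 hT.le
  have hne := nearTimes_neBot hT h0
  have hi := integrable_of_memLp_two hW
  have := ae_eq_zero_of_forall_isSmooth (hi.sub hw₀) fun φ hφ => by
    simp only [Pi.sub_apply, sub_mul]
    rw [integral_sub (Integrable.mul_isSmooth hi hφ) (Integrable.mul_isSmooth hw₀ hφ), sub_eq_zero]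
    have h1 := hlim φ hφ
    rw [← nhdsWithin_Ioo_eq_nhdsGT hT] at h1
    refine tendsto_nhds_unique (tendsto_nearTimes (hc φ (hφ.memLp 2)) h0) (h1.congr' ?_)
    filter_upwards [eventually_nearTimes hWw 0] with t ht
    exact integral_congr_ae (ht.mono fun x hx => by simp only [hx])
  filter_upwards [this] with x hx
  exact sub_eq_zero.1 hx

/-- Where `M = R V`, one has `R |V|² = |M|² / R`. The energy is thus a function of density and
momentum, the two quantities that have values at every time. -/
theorem integral_energyDensity (ha : 0 < a) {R : Torus N → ℝ} {V : Torus N → Vec N}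
    {M : Fin N → Torus N → ℝ} (hR : AEStronglyMeasurable R volume) (hb : ∀ᵐ x, R x ∈ Icc a b)
    (hM : ∀ i, MemLp (M i) 2 volume) (hMV : ∀ i, M i =ᵐ[volume] fun x => R x * V x i) :
    Integrable (energyDensity γ R V) ∧ ∫ x, energyDensity γ R V x = momentumEnergy γ R M := by
  have i1 : ∀ i, Integrable fun x => M i x / R x * M i x := fun i =>
    integrable_mul_two (memLp_div_of_bound ha (hM i) hR hb) (hM i)
  have i2 : Integrable fun x => R x ^ γ := integrable_of_memLp_two
    (memLp_comp_of_contDiffAt (contDiffAt_rpow ha γ) (measurable_rpow_const γ) hR hb 2)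
  have e : (fun x => 1 / 2 * (∑ i, M i x / R x * M i x) + 1 / (γ - 1) * R x ^ γ)
      =ᵐ[volume] energyDensity γ R V := by
    filter_upwards [hb, ae_all_iff.2 hMV] with x hx hx'
    have h0 : R x ≠ 0 := (ha.trans_le hx.1).ne'
    rw [energyDensity, EuclideanSpace.real_norm_sq_eq, mul_assoc, one_div_mul_eq_div (γ - 1)]
    congr 2
    rw [Finset.mul_sum]
    refine Finset.sum_congr rfl fun i _ => ?_
    rw [hx']
    field_simp
  have i3 := (integrable_finsetSum Finset.univ fun i _ => i1 i).const_mul (1 / 2)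
  have i4 := i2.const_mul (1 / (γ - 1))
  refine ⟨(i3.add i4).congr e, ?_⟩
  rw [← integral_congr_ae e, integral_add i3 i4, integral_const_mul, integral_const_mul,
    integral_finsetSum _ fun i _ => i1 i, momentumEnergy]

theorem IsFlow.integrable_dissipation {u : Fin N → ℝ → Torus N → ℝ}
    {D : Fin N → Fin N → ℝ → Torus N → ℝ} (h : IsFlow T γ a b C ρ u D g) :
    Integrable (fun z => dissipation ρ D z.1 z.2) (spaceTime N T) :=
  integrable_mul_sum_sq (R := fun z : ℝ × Torus N => ρ z.1 z.2)
    (A := fun i j z => D i j z.1 z.2) (memLp_top_of_mem_Icc h.meas_rho h.bound) h.memLp_D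

theorem integral_spaceTime {f : ℝ → Torus N → ℝ} (ht : t ∈ Icc 0 T)
    (hf : Integrable (fun z => f z.1 z.2) (spaceTime N T)) :
    ∫ z, f z.1 z.2 ∂(spaceTime N t) = ∫ s in (0 : ℝ)..t, ∫ x, f s x := by
  have hle : spaceTime N t ≤ spaceTime N T :=
    Measure.prod_mono (Measure.restrict_mono (Ioo_subset_Ioo_right ht.2) le_rfl) le_rfl
  rw [intervalIntegral.integral_of_le ht.1, integral_Ioc_eq_integral_Ioo, spaceTime]
  exact integral_prod _ (hf.mono_measure hle)

end Versions

end

end DegenerateNS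

/-! ### The energy equality for weak solutions -/

theorem theorem1 (N : ℕ) (T γ : ℝ) (hT : 0 < T) (hγ : 1 < γ)
    (ρ : ℝ → Torus N → ℝ) (u : ℝ → Torus N → Vec N) (Du : Fin N → ℝ → Torus N → Vec N)
    (ρ₀ : Torus N → ℝ) (u₀ : Torus N → Vec N)
    (hsol : IsWeakSolution T γ ρ u Du ρ₀ u₀)
    (ρlow ρhigh : ℝ) (hlow : 0 < ρlow)
    (hbound : ∀ᵐ z ∂(spaceTime N T), ρlow ≤ ρ z.1 z.2 ∧ ρ z.1 z.2 ≤ ρhigh)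
    (p q : ℝ≥0∞) (hpq : p⁻¹ + q⁻¹ ≤ 5 / 12) (hq : 6 ≤ q) (hu : MemLpLq T p q u)
    (hu₀ : MemLp (fun x => √(ρ₀ x) • u₀ x) 4 volume) :
    (∃ (r : ℝ → Torus N → ℝ) (v : ℝ → Torus N → Vec N), IsWeaklyContinuousVersion T ρ u r v) ∧
    Integrable (fun z => ρ z.1 z.2 * strainSq Du z.1 z.2) (spaceTime N T) ∧
    Integrable (energyDensity γ ρ₀ u₀) volume ∧
    ∀ (r : ℝ → Torus N → ℝ) (v : ℝ → Torus N → Vec N), IsWeaklyContinuousVersion T ρ u r v →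
      ∀ t ∈ Icc 0 T,
        Integrable (energyDensity γ (r t) (v t)) volume ∧
        (∫ x, energyDensity γ (r t) (v t) x)
            + (∫ z, ρ z.1 z.2 * strainSq Du z.1 z.2 ∂(spaceTime N t))
          = ∫ x, energyDensity γ ρ₀ u₀ x := by
  obtain ⟨C, g, hflow⟩ := hsol.exists_isFlow hT hlow hbound hpq hq hu
  have h0 : (0 : ℝ) ∈ Icc 0 T := left_mem_Icc.2 hT.le
  have hdiss := hflow.integrable_dissipation
  -- At time zero the version is identified with `ρ₀` and `ρ₀ u₀`. In particular `ρ₀` inherits the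
  -- positive lower bound from `r 0`, so the initial energy is finite and equals that of any version
  -- at time zero.
  have hinit : ∀ {r m}, IsVersion T ρ (fun i t x => u t x i) r m →
      Integrable (energyDensity γ ρ₀ u₀) volume ∧
        ∫ x, energyDensity γ ρ₀ u₀ x = momentumEnergy γ (r 0) fun i => m i 0 := by
    intro r m hv
    have e1 := ae_eq_of_weak_limit hT (hv.memLp_rho 0 h0) hv.continuous_rho hv.ae_rho
      hsol.integrable_rho₀ hsol.initial_rho
    have e2 := fun i => ae_eq_of_weak_limit hT (hv.memLp_m i 0 h0) (hv.continuous_m i)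
      (hv.ae_m.mono fun t ht => ht i) (hsol.integrable_m₀.eval_piLp i)
      fun φ hφ => hsol.initial_m φ hφ i
    have e3 : energyDensity γ (r 0) u₀ =ᵐ[volume] energyDensity γ ρ₀ u₀ :=
      e1.mono fun x hx => by simp only [energyDensity, hx]
    have := integral_energyDensity (γ := γ) (V := u₀) hlow (hv.memLp_rho 0 h0).1
      (hv.bound hT hflow h0) (fun i => hv.memLp_m i 0 h0) fun i => by
        filter_upwards [e1, e2 i] with x h1 h2
        rw [h1, h2]
        rfl
    exact ⟨this.1.congr e3, by rw [← integral_congr_ae e3, this.2]⟩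
  obtain ⟨r, m, hv⟩ := hflow.exists_isVersion hT
  refine ⟨hv.exists_isWeaklyContinuousVersion hT hflow, hdiss, (hinit hv).1, fun r v hrv t ht => ?_⟩
  have hv' := hrv.isVersion
  have hE := integral_energyDensity (γ := γ) (V := v t) hlow (hv'.memLp_rho t ht).1
    (hv'.bound hT hflow ht) (fun i => hv'.memLp_m i t ht) fun i => ae_eq_rfl
  refine ⟨hE.1, ?_⟩
  rw [(hinit hv').2, ← energy_identity hT hγ hflow hv' ht, hE.2]
  congr 1
  exact integral_spaceTime ht hdiss
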